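/- Let $d\ge 2$, let $\Omega\subset\mathbb R^d$ be a bounded open set with smooth boundary and outward unit normal $\nu$, let $N\ge 1$ be an integer and let $T,\mu>0$, $M,K\in\mathbb R$. Let $\Psi_1,\Psi_2,\dots$ be the Gram–Schmidt orthonormalization in $L^2(0,T)$ of the functions $\phi_n(t)=(t-T/2)^{n-1}e^{t-T/2}$, $n\ge1$, and let $S=(s_{mn})_{m,n=1}^N$ with $s_{mn}=\int_0^T\Psi_m(t)\Psi_n'(t)\,dt$. There is a constant $C>0$, depending only on $\Omega,N,T,\mu,M,K$, with the following property. Let $A=(a_{ij})\in C^2(\mathbb R^d,\mathbb R^{d\times d})$ be symmetric with $A(x)\xi\cdot\xi\ge\mu|\xi|^2$ for all $x,\xi\in\mathbb R^d$, let $\mathbf b\in C^1(\mathbb R^d,\mathbb R^d)$ and $c\in C^1(\mathbb R^d)$, and assume that on $\overline\Omega$ the entries of $A$ and their first partial derivatives are bounded by $M$ in absolute value, and $|\mathbf b|\le K$, $|c|\le K$. Put $$\mathcal L v=\operatorname{Div}(A\nabla v)+\mathbf b\cdot\nabla v+cv ,$$ acting componentwise on vector-valued functions, and for $\epsilon>0$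 $$J_\epsilon(U)=\int_\Omega|\mathcal LU-SU|^2\,dx+\epsilon\|U\|_{H^3(\Omega)^N}^2 .$$ For boundary functions $\widetilde F,\widetilde G:\partial\Omega\to\mathbb R^N$ let $H(\widetilde F,\widetilde G)$ be the set of all $V\in H^3(\Omega)^N$ with $V=\widetilde F$ and $A\nabla V\cdot\nu=\widetilde G$ on $\partial\Omega$ (in the sense of traces). Let $\widetilde F^*,\widetilde G^*$ (noiseless data) and $\widetilde F^\delta,\widetilde G^\delta$ (noisy data) be such boundary functions, and let $\epsilon>0$ and $\delta>0$. Assume that 1. $U^*\in H(\widetilde F^*,\widetilde G^*)$ and $\mathcal LU^*=SU^*$ in $\Omega$; 2. $U^\delta$ minimizes $J_\epsilon$ over $H(\widetilde F^\delta,\widetilde G^\delta)$; 3. there is $\mathcal E\in H(\widetilde F^\delta-\widetilde F^*,\widetilde G^\delta-\widetilde G^*)$ with $\|\mathcal E\|_{H^3(\Omega)^N}<\delta$. Let $f^\delta(x)=\sum_{n=1}^N u_n^\delta(x)\Psi_n(0)$ and $f^*(x)=\sum_{n=1}^N u_n^*(x)\Psi_n(0)$, where $U^\delta=(u_1^\delta,\dots,u_N^\delta)$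 and $U^*=(u_1^*,\dots,u_N^*)$. Then $$\|f^\delta-f^*\|_{L^2(\Omega)}\le C\left(\delta+\sqrt\epsilon\,\|U^*\|_{H^3(\Omega)^N}\right).$$ -/

import Mathlib

open MeasureTheory Set
open scoped ContDiff

namespace QuasiReversibility

noncomputable section

/-! ### Weak derivatives and Sobolev norms on an open subset of Euclidean space -/

/-- The classical partial derivative in the direction of the `i`-th coordinate. -/
def partialDeriv {d : ℕ} (i : Fin d) (φ : EuclideanSpace ℝ (Fin d) → ℝ) :
    EuclideanSpace ℝ (Fin d) → ℝ :=
  fun x => fderiv ℝ φ x (EuclideanSpace.single i 1)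

/-- The classical derivative `D^α φ` for a multi-index `α`. -/
def multiDeriv {d : ℕ} (α : Fin d → ℕ) (φ : EuclideanSpace ℝ (Fin d) → ℝ) :
    EuclideanSpace ℝ (Fin d) → ℝ :=
  (List.finRange d).foldr (fun i f => (partialDeriv i)^[α i] f) φ

/-- Test functions: the elements of `C_c^∞(Ω)`. -/
def IsTestFunction {d : ℕ} (Ω : Set (EuclideanSpace ℝ (Fin d)))
    (φ : EuclideanSpace ℝ (Fin d) → ℝ) : Prop :=
  ContDiff ℝ ∞ φ ∧ HasCompactSupport φ ∧ tsupport φ ⊆ Ω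

/-- `g` is the weak derivative `D^α u` on `Ω`. -/
def HasWeakDeriv {d : ℕ} (Ω : Set (EuclideanSpace ℝ (Fin d))) (α : Fin d → ℕ)
    (u g : EuclideanSpace ℝ (Fin d) → ℝ) : Prop :=
  LocallyIntegrableOn u Ω ∧ LocallyIntegrableOn g Ω ∧
    ∀ φ, IsTestFunction Ω φ →
      ∫ x in Ω, u x * multiDeriv α φ x = (-1) ^ (∑ i, α i) * ∫ x in Ω, g x * φ x

/-- Weak derivatives are unique up to a null set, so that the choice made in `weakDeriv` is
harmless. -/
theorem HasWeakDeriv.ae_eq {d : ℕ} {Ω : Set (EuclideanSpace ℝ (Fin d))} (hΩ : IsOpen Ω)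
    {α : Fin d → ℕ} {u g h : EuclideanSpace ℝ (Fin d) → ℝ}
    (hg : HasWeakDeriv Ω α u g) (hh : HasWeakDeriv Ω α u h) :
    ∀ᵐ x ∂(volume.restrict Ω), g x = h x := by
  have key : ∀ᵐ x ∂(volume : Measure (EuclideanSpace ℝ (Fin d))),
      x ∈ Ω → (fun y => g y - h y) x = 0 := by
    refine hΩ.ae_eq_zero_of_integral_contDiff_smul_eq_zero (hg.2.1.sub hh.2.1) ?_
    intro φ hφ hc hs
    have int : ∀ f : EuclideanSpace ℝ (Fin d) → ℝ, LocallyIntegrableOn f Ω →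
        IntegrableOn (fun x => f x * φ x) Ω := by
      intro f hf
      have h1 : IntegrableOn f (tsupport φ) :=
        hf.integrableOn_compact_subset hs hc
      have h2 : IntegrableOn (fun x => f x * φ x) (tsupport φ) :=
        h1.mul_continuousOn hφ.continuous.continuousOn hc
      refine (integrableOn_iff_integrable_of_support_subset ?_).1 h2 |>.integrableOn
      intro x hx
      apply subset_tsupport φ
      intro h0
      exact hx (by simp [h0])
    have e1 := hg.2.2 φ ⟨hφ, hc, hs⟩
    have e2 := hh.2.2 φ ⟨hφ, hc, hs⟩
    have e3 : ∫ x in Ω, g x * φ x = ∫ x in Ω, h x * φ x := by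
      have := e1.symm.trans e2
      exact mul_left_cancel₀ (pow_ne_zero _ (by norm_num)) this
    have e4 : ∫ x in Ω, φ x • (g x - h x) = ∫ x, φ x • (g x - h x) := by
      apply setIntegral_eq_integral_of_forall_compl_eq_zero
      intro x hx
      have : φ x = 0 := by
        by_contra h0
        exact hx (hs (subset_tsupport φ h0))
      simp [this]
    rw [← e4]
    have e5 : ∫ x in Ω, φ x • (g x - h x) = ∫ x in Ω, (g x * φ x - h x * φ x) := by
      congr 1; ext x; simp; ring
    rw [e5, integral_sub (int g hg.2.1) (int h hh.2.1), e3, sub_self]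
  rw [ae_restrict_iff' hΩ.measurableSet]
  filter_upwards [key] with x hx hxΩ
  exact sub_eq_zero.1 (hx hxΩ)

open Classical in
/-- A representative of the weak derivative `D^α u` on `Ω` (and `0` if there is none). -/
def weakDeriv {d : ℕ} (Ω : Set (EuclideanSpace ℝ (Fin d))) (α : Fin d → ℕ)
    (u : EuclideanSpace ℝ (Fin d) → ℝ) : EuclideanSpace ℝ (Fin d) → ℝ :=
  if h : ∃ g, HasWeakDeriv Ω α u g then h.choose else 0

/-- The first order weak derivative `∂_i u` on `Ω`. -/
def weakPartial {d : ℕ} (Ω : Set (EuclideanSpace ℝ (Fin d))) (i : Fin d)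
    (u : EuclideanSpace ℝ (Fin d) → ℝ) : EuclideanSpace ℝ (Fin d) → ℝ :=
  weakDeriv Ω (Pi.single i 1) u

/-- `u ∈ H^k(Ω)`: all weak derivatives of order at most `k` exist and lie in `L²(Ω)`. -/
def MemSobolev {d : ℕ} (Ω : Set (EuclideanSpace ℝ (Fin d))) (k : ℕ)
    (u : EuclideanSpace ℝ (Fin d) → ℝ) : Prop :=
  MemLp u 2 (volume.restrict Ω) ∧
    ∀ α : Fin d → ℕ, ∑ i, α i ≤ k →
      ∃ g, HasWeakDeriv Ω α u g ∧ MemLp g 2 (volume.restrict Ω)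

/-- `U ∈ H³(Ω)^N`. -/
def MemH3 {d N : ℕ} (Ω : Set (EuclideanSpace ℝ (Fin d)))
    (U : EuclideanSpace ℝ (Fin d) → Fin N → ℝ) : Prop :=
  ∀ m, MemSobolev Ω 3 (fun x => U x m)

/-- `‖U‖²` in `H³(Ω)^N`: the sum over the components `m` and over all multi-indices `α` with
`|α| ≤ 3` of `∫_Ω |D^α U_m|²`. -/
def h3NormSq {d N : ℕ} (Ω : Set (EuclideanSpace ℝ (Fin d)))
    (U : EuclideanSpace ℝ (Fin d) → Fin N → ℝ) : ℝ :=
  ∑ m, ∑ k ∈ Finset.range 4, ∑ α ∈ Finset.piAntidiag (Finset.univ : Finset (Fin d)) k,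
    ∫ x in Ω, (weakDeriv Ω α (fun y => U y m) x) ^ 2

/-- `‖U‖` in `H³(Ω)^N`. -/
def h3Norm {d N : ℕ} (Ω : Set (EuclideanSpace ℝ (Fin d)))
    (U : EuclideanSpace ℝ (Fin d) → Fin N → ℝ) : ℝ :=
  Real.sqrt (h3NormSq Ω U)

/-! ### Smooth boundaries, outward normals and traces -/

/-- `ρ` is a smooth defining function of `Ω` on the open neighbourhood `W` of `x`. -/
structure IsLocalDefiningFunction {d : ℕ} (Ω : Set (EuclideanSpace ℝ (Fin d)))
    (x : EuclideanSpace ℝ (Fin d)) (W : Set (EuclideanSpace ℝ (Fin d)))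
    (ρ : EuclideanSpace ℝ (Fin d) → ℝ) : Prop where
  isOpen : IsOpen W
  mem : x ∈ W
  smooth : ContDiffOn ℝ ∞ ρ W
  gradient_ne_zero : ∀ y ∈ W, gradient ρ y ≠ 0
  inter_eq : Ω ∩ W = {y ∈ W | ρ y < 0}

/-- `∂Ω` is smooth, with `Ω` locally on one side of it. -/
def HasSmoothBoundary {d : ℕ} (Ω : Set (EuclideanSpace ℝ (Fin d))) : Prop :=
  ∀ x ∈ frontier Ω, ∃ W ρ, IsLocalDefiningFunction Ω x W ρ

/-- `n` is the outward unit normal of `Ω` at the boundary point `x`. -/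
def IsOutwardNormal {d : ℕ} (Ω : Set (EuclideanSpace ℝ (Fin d)))
    (x n : EuclideanSpace ℝ (Fin d)) : Prop :=
  ∃ W ρ, IsLocalDefiningFunction Ω x W ρ ∧ n = ‖gradient ρ x‖⁻¹ • gradient ρ x

/-- The outward unit normal at a boundary point is unique, so that the choice made in
`outwardNormal` is harmless. -/
theorem IsOutwardNormal.unique {d : ℕ} {Ω : Set (EuclideanSpace ℝ (Fin d))} (hΩ : IsOpen Ω)
    {x n₁ n₂ : EuclideanSpace ℝ (Fin d)} (hx : x ∈ frontier Ω)
    (h₁ : IsOutwardNormal Ω x n₁) (h₂ : IsOutwardNormal Ω x n₂) : n₁ = n₂ := by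
  obtain ⟨W₁, ρ₁, H₁, rfl⟩ := h₁
  obtain ⟨W₂, ρ₂, H₂, rfl⟩ := h₂
  have slope : ∀ W ρ, IsLocalDefiningFunction Ω x W ρ → ∀ v,
      HasDerivAt (fun t : ℝ => ρ (x + t • v)) (inner ℝ (gradient ρ x) v) 0 ∧ ρ x = 0 ∧
        ∀ᶠ t : ℝ in nhdsWithin 0 (Ioi 0), x + t • v ∈ W := by
    intro W ρ H v
    have hW : W ∈ nhds x := H.isOpen.mem_nhds H.mem
    have hd : DifferentiableAt ℝ ρ x :=
      (H.smooth.contDiffAt hW).differentiableAt (by simp)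
    have hline : HasDerivAt (fun t : ℝ => x + t • v) v 0 := by
      simpa using ((hasDerivAt_id (0 : ℝ)).smul_const v).const_add x
    refine ⟨?_, le_antisymm ?_ ?_, ?_⟩
    · have h := hd.hasGradientAt.hasFDerivAt
      have hx0 : x = x + (0 : ℝ) • v := by simp
      rw [hx0] at h
      have := h.comp_hasDerivAt (0 : ℝ) hline
      simpa [Function.comp_def] using this
    · by_contra! h
      have hev : ∀ᶠ y in nhds x, 0 < ρ y := hd.continuousAt.eventually (lt_mem_nhds h)
      have hcl : x ∈ closure Ω := frontier_subset_closure hx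
      obtain ⟨y, ⟨hy0, hyW⟩, hyΩ⟩ :=
        mem_closure_iff_nhds.1 hcl _ (Filter.inter_mem hev hW)
      have : y ∈ {y ∈ W | ρ y < 0} := H.inter_eq ▸ ⟨hyΩ, hyW⟩
      exact absurd this.2 (not_lt.2 (le_of_lt hy0))
    · by_contra! h
      have : x ∈ Ω ∩ W := by rw [H.inter_eq]; exact ⟨H.mem, h⟩
      rw [hΩ.frontier_eq] at hx
      exact hx.2 this.1
    · have hc : Filter.Tendsto (fun t : ℝ => x + t • v) (nhdsWithin 0 (Ioi 0)) (nhds x) := by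
        have := hline.continuousAt.tendsto
        simp only [zero_smul, add_zero] at this
        exact this.mono_left nhdsWithin_le_nhds
      exact hc hW
  by_contra hne
  set g₁ := gradient ρ₁ x with hg₁
  set g₂ := gradient ρ₂ x with hg₂
  have p₁ : 0 < ‖g₁‖ := norm_pos_iff.2 (H₁.gradient_ne_zero x H₁.mem)
  have p₂ : 0 < ‖g₂‖ := norm_pos_iff.2 (H₂.gradient_ne_zero x H₂.mem)
  set m₁ := ‖g₁‖⁻¹ • g₁ with hm₁
  set m₂ := ‖g₂‖⁻¹ • g₂ with hm₂
  have u₁ : ‖m₁‖ = 1 := by rw [hm₁, norm_smul, norm_inv, norm_norm, inv_mul_cancel₀ p₁.ne']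
  have u₂ : ‖m₂‖ = 1 := by rw [hm₂, norm_smul, norm_inv, norm_norm, inv_mul_cancel₀ p₂.ne']
  have hlt : inner ℝ m₁ m₂ < 1 := (inner_lt_one_iff_real_of_norm_eq_one u₁ u₂).2 hne
  have e₁ : g₁ = ‖g₁‖ • m₁ := by rw [hm₁, smul_smul, mul_inv_cancel₀ p₁.ne', one_smul]
  have e₂ : g₂ = ‖g₂‖ • m₂ := by rw [hm₂, smul_smul, mul_inv_cancel₀ p₂.ne', one_smul]
  have s₁ : inner ℝ g₁ (m₂ - m₁) < 0 := by
    rw [e₁, inner_smul_left, inner_sub_right, real_inner_self_eq_norm_sq, u₁]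
    simp only [conj_trivial]
    nlinarith
  have s₂ : 0 < inner ℝ g₂ (m₂ - m₁) := by
    rw [e₂, inner_smul_left, inner_sub_right, real_inner_self_eq_norm_sq, u₂,
      real_inner_comm]
    simp only [conj_trivial]
    nlinarith
  obtain ⟨d₁, z₁, w₁⟩ := slope W₁ ρ₁ H₁ (m₂ - m₁)
  obtain ⟨d₂, z₂, w₂⟩ := slope W₂ ρ₂ H₂ (m₂ - m₁)
  have k₁ := (hasDerivWithinAt_iff_tendsto_slope' (by simp)).1 (d₁.hasDerivWithinAt (s := Ioi 0))
  have k₂ := (hasDerivWithinAt_iff_tendsto_slope' (by simp)).1 (d₂.hasDerivWithinAt (s := Ioi 0))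
  have f₁ := k₁.eventually (gt_mem_nhds s₁)
  have f₂ := k₂.eventually (lt_mem_nhds s₂)
  have pos : ∀ᶠ t : ℝ in nhdsWithin 0 (Ioi 0), 0 < t := self_mem_nhdsWithin
  obtain ⟨t, a₁, a₂, b₁, b₂, ht⟩ := (f₁.and (f₂.and (w₁.and (w₂.and pos)))).exists
  simp only [slope_def_field, zero_smul, add_zero, z₁, z₂, sub_zero] at a₁ a₂
  have c₁ : ρ₁ (x + t • (m₂ - m₁)) < 0 := by
    by_contra! h
    exact absurd a₁ (not_lt.2 (div_nonneg h ht.le))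
  have c₂ : 0 < ρ₂ (x + t • (m₂ - m₁)) := by
    by_contra! h
    exact absurd a₂ (not_lt.2 (div_nonpos_of_nonpos_of_nonneg h ht.le))
  have i₁ : x + t • (m₂ - m₁) ∈ Ω ∩ W₁ := by rw [H₁.inter_eq]; exact ⟨b₁, c₁⟩
  have i₂ : x + t • (m₂ - m₁) ∈ {y ∈ W₂ | ρ₂ y < 0} := by
    rw [← H₂.inter_eq]; exact ⟨i₁.1, b₂⟩
  exact absurd i₂.2 (not_lt.2 c₂.le)

/-- The outward unit normal field `ν` on the boundary of `Ω`. -/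
def outwardNormal {d : ℕ} (Ω : Set (EuclideanSpace ℝ (Fin d)))
    (x : EuclideanSpace ℝ (Fin d)) : EuclideanSpace ℝ (Fin d) :=
  Classical.epsilon (IsOutwardNormal Ω x)

/-- The surface measure on `∂Ω`: the `(d-1)`-dimensional Hausdorff measure, normalized as in
Euclidean geometry. -/
def surfaceMeasure {d : ℕ} (Ω : Set (EuclideanSpace ℝ (Fin d))) :
    Measure (EuclideanSpace ℝ (Fin d)) :=
  (μHE[d - 1]).restrict (frontier Ω)

/-- `g ∈ L²(∂Ω)` is the trace `u|_{∂Ω}` of the Sobolev function `u`: it is the boundary function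
for which the Gauss-Green formula
`∫_Ω (u ∂_i φ + φ ∂_i u) = ∫_{∂Ω} g φ ν_i dσ` holds for all `φ ∈ C^1` and all `i`. On a bounded
smooth domain this determines `g` in `L²(∂Ω)`, and `g` is the restriction of `u` to `∂Ω`
if `u` is `C^1` up to the boundary. -/
def IsTrace {d : ℕ} (Ω : Set (EuclideanSpace ℝ (Fin d)))
    (u g : EuclideanSpace ℝ (Fin d) → ℝ) : Prop :=
  MemLp g 2 (surfaceMeasure Ω) ∧
    ∀ i, ∀ φ : EuclideanSpace ℝ (Fin d) → ℝ, ContDiff ℝ 1 φ →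
      ∫ x in Ω, (u x * partialDeriv i φ x + weakPartial Ω i u x * φ x) =
        ∫ x, g x * φ x * outwardNormal Ω x i ∂(surfaceMeasure Ω)

/-- `A ∇u · ν = g` on `∂Ω`, with `∇u` on `∂Ω` in the sense of traces. -/
def IsConormalTrace {d : ℕ} (Ω : Set (EuclideanSpace ℝ (Fin d)))
    (A : EuclideanSpace ℝ (Fin d) → Matrix (Fin d) (Fin d) ℝ)
    (u g : EuclideanSpace ℝ (Fin d) → ℝ) : Prop :=
  ∃ h : Fin d → EuclideanSpace ℝ (Fin d) → ℝ,
    (∀ j, IsTrace Ω (weakPartial Ω j u) (h j)) ∧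
      ∀ᵐ x ∂(surfaceMeasure Ω), g x = ∑ i, ∑ j, A x i j * h j x * outwardNormal Ω x i

/-! ### The orthonormal basis in time -/

/-- `φ_{n+1}(t) = (t - T/2)^n exp(t - T/2)`. -/
def phi (T : ℝ) (n : ℕ) (t : ℝ) : ℝ := (t - T / 2) ^ n * Real.exp (t - T / 2)

/-- `Ψ_{n+1}`, the result of the Gram-Schmidt orthonormalization of `φ_1, φ_2, …` with respect to
the inner product of `L²(0,T)`. -/
def Psi (T : ℝ) (n : ℕ) : ℝ → ℝ :=
  let r : ℝ → ℝ := fun t =>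
    phi T n t - ∑ k : Fin n, (∫ s in (0 : ℝ)..T, phi T n s * Psi T k s) * Psi T k t
  fun t => (Real.sqrt (∫ s in (0 : ℝ)..T, (r s) ^ 2))⁻¹ * r t
termination_by n
decreasing_by all_goals exact k.2

/-- The matrix `S` with entries `s_{mn} = ∫_0^T Ψ_m(t) Ψ_n'(t) dt`. -/
def matS (T : ℝ) (N : ℕ) : Matrix (Fin N) (Fin N) ℝ :=
  fun m n => ∫ t in (0 : ℝ)..T, Psi T m t * deriv (Psi T n) t

/-- `x ↦ u(x,0)` for `u(x,t) = ∑_{n=1}^N u_n(x) Ψ_n(t)`, where `U = (u_1, …, u_N)`. -/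
def initialValue {d N : ℕ} (T : ℝ) (U : EuclideanSpace ℝ (Fin d) → Fin N → ℝ) :
    EuclideanSpace ℝ (Fin d) → ℝ :=
  fun x => ∑ n : Fin N, U x n * Psi T n 0

/-! ### The elliptic system and the quasi-reversibility functional -/

/-- The standing assumptions on the coefficients: `A ∈ C²` is symmetric and uniformly elliptic with
constant `μ`, and `b` and `c` are of class `C¹`. -/
structure IsEllipticCoeff {d : ℕ} (μ : ℝ)
    (A : EuclideanSpace ℝ (Fin d) → Matrix (Fin d) (Fin d) ℝ)
    (b : EuclideanSpace ℝ (Fin d) → EuclideanSpace ℝ (Fin d))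
    (c : EuclideanSpace ℝ (Fin d) → ℝ) : Prop where
  contDiff_A : ∀ i j, ContDiff ℝ 2 (fun x => A x i j)
  contDiff_b : ContDiff ℝ 1 b
  contDiff_c : ContDiff ℝ 1 c
  symm : ∀ x, (A x).IsSymm
  elliptic : ∀ x ξ : EuclideanSpace ℝ (Fin d), μ * ‖ξ‖ ^ 2 ≤ ∑ i, ∑ j, A x i j * ξ j * ξ i

/-- `‖A‖_{C¹(closure Ω)} ≤ M`: entries and their first partial derivatives are bounded by `M`. -/
def C1NormLE {d : ℕ} (Ω : Set (EuclideanSpace ℝ (Fin d)))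
    (A : EuclideanSpace ℝ (Fin d) → Matrix (Fin d) (Fin d) ℝ) (M : ℝ) : Prop :=
  ∀ x ∈ closure Ω, ∀ i j, |A x i j| ≤ M ∧ ∀ k, |partialDeriv k (fun y => A y i j) x| ≤ M

/-- `ℒ v = Div(A ∇v) + b · ∇v + c v`, with weak derivatives on `Ω`. -/
def ellipticOp {d : ℕ} (Ω : Set (EuclideanSpace ℝ (Fin d)))
    (A : EuclideanSpace ℝ (Fin d) → Matrix (Fin d) (Fin d) ℝ)
    (b : EuclideanSpace ℝ (Fin d) → EuclideanSpace ℝ (Fin d))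
    (c : EuclideanSpace ℝ (Fin d) → ℝ) (v : EuclideanSpace ℝ (Fin d) → ℝ) :
    EuclideanSpace ℝ (Fin d) → ℝ :=
  fun x => ∑ i, weakPartial Ω i (fun y => ∑ j, A y i j * weakPartial Ω j v y) x
    + ∑ i, b x i * weakPartial Ω i v x + c x * v x

/-- The `m`-th component of `ℒ U - S U`. -/
def systemResidual {d N : ℕ} (Ω : Set (EuclideanSpace ℝ (Fin d)))
    (A : EuclideanSpace ℝ (Fin d) → Matrix (Fin d) (Fin d) ℝ)
    (b : EuclideanSpace ℝ (Fin d) → EuclideanSpace ℝ (Fin d))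
    (c : EuclideanSpace ℝ (Fin d) → ℝ) (S : Matrix (Fin N) (Fin N) ℝ)
    (U : EuclideanSpace ℝ (Fin d) → Fin N → ℝ) (x : EuclideanSpace ℝ (Fin d)) (m : Fin N) : ℝ :=
  ellipticOp Ω A b c (fun y => U y m) x - ∑ n, S m n * U x n

/-- `J_ε(U) = ∫_Ω |ℒ U - S U|² + ε ‖U‖²_{H³}`. -/
def functionalJ {d N : ℕ} (Ω : Set (EuclideanSpace ℝ (Fin d)))
    (A : EuclideanSpace ℝ (Fin d) → Matrix (Fin d) (Fin d) ℝ)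
    (b : EuclideanSpace ℝ (Fin d) → EuclideanSpace ℝ (Fin d))
    (c : EuclideanSpace ℝ (Fin d) → ℝ) (S : Matrix (Fin N) (Fin N) ℝ) (ε : ℝ)
    (U : EuclideanSpace ℝ (Fin d) → Fin N → ℝ) : ℝ :=
  (∫ x in Ω, ∑ m, (systemResidual Ω A b c S U x m) ^ 2) + ε * h3NormSq Ω U

/-- The set of all `V ∈ H³(Ω)^N` with `V = F` and `A ∇V · ν = G` on `∂Ω`. -/
def admissible {d N : ℕ} (Ω : Set (EuclideanSpace ℝ (Fin d)))
    (A : EuclideanSpace ℝ (Fin d) → Matrix (Fin d) (Fin d) ℝ)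
    (F G : EuclideanSpace ℝ (Fin d) → Fin N → ℝ) :
    Set (EuclideanSpace ℝ (Fin d) → Fin N → ℝ) :=
  {V | MemH3 Ω V ∧ ∀ m, IsTrace Ω (fun x => V x m) (fun x => F x m) ∧
    IsConormalTrace Ω A (fun x => V x m) (fun x => G x m)}

end

end QuasiReversibility

open QuasiReversibility

namespace QuasiReversibility

/-! ### Weak derivatives and Sobolev functions, all identities up to null sets. -/

section WeakDerivatives

variable {d : ℕ} {Ω : Set (EuclideanSpace ℝ (Fin d))}

/-! ### Classical derivatives of test functions -/

/-! Write `E` for the given extension of the noise and `X = U* + E`. Then `X` has the noisy Cauchy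
data and, since `U*` solves the system, the residual of `E`. Minimality, `J_ε(U^δ) ≤ J_ε(X)`, bounds
both the squared residual of `U^δ` and `ε ‖U^δ‖²` by a multiple of `‖E‖² + ε (‖U*‖² + ‖E‖²)`. If `ε
≤ 1`, the right side is of order `‖E‖² + ε ‖U*‖²`; the difference `W = U^δ - X` has zero Cauchy
data, and the stability estimate `‖W‖ ≤ C ‖ℒW - SW‖` in `L²` (`exists_stability_constant`) finishes.
If `ε ≥ 1`, dividing by `ε` already bounds `U^δ` in `H³`, and no stability is needed. Cauchy–Schwarz
with the numbers `Ψ_n(0)` passes from `U` to `f`.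

Stability comes from a Carleman estimate with the weight `φ = s⁻¹ exp(s x_z)`, where `z` is any
coordinate. For `v = exp(λφ) w` the conjugated operator splits as `P - λK` up to a zero-order term,
and `P K` is a divergence minus a quadratic form in `(∇v, v)` (`rellich_identity`). That form is
positive once `s`, and then `λ`, is large (`carleman_quadratic_lower_bound`). The result is a
pointwise inequality whose divergence term integrates to zero for compactly supported `w`. The
thresholds depend only on the dimension, `μ`, the bound on `A` and the size of `Ω`, so the final
constant is uniform in the coefficients. The terms `b · ∇`, `c` and `S` are of lower order and are
absorbed by a large `λ`; that `S` couples the components is harmless because all of them carry the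
same weight.

To apply this to a Sobolev function, its extension by zero must have two weak derivatives on the
whole space, so the traces of the function and of its gradient must vanish. The Cauchy data give
this (`IsConormalTrace.isTrace_zero`): the symmetry of second derivatives makes the trace of the
gradient normal, and ellipticity then makes it zero. Mollifying the extension reduces to smooth
functions. -/

theorem contDiff_partialDeriv {φ : EuclideanSpace ℝ (Fin d) → ℝ} {n m : WithTop ℕ∞}
    (hφ : ContDiff ℝ n φ) (hmn : m + 1 ≤ n) (i : Fin d) : ContDiff ℝ m (partialDeriv i φ) :=
  (hφ.fderiv_right hmn).clm_apply contDiff_const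

theorem tsupport_partialDeriv_subset (φ : EuclideanSpace ℝ (Fin d) → ℝ) (i : Fin d) :
    tsupport (partialDeriv i φ) ⊆ tsupport φ := by
  refine closure_minimal (fun x hx => ?_) (isClosed_tsupport _)
  refine support_fderiv_subset ℝ (fun h => hx ?_)
  simp [partialDeriv, h]

theorem IsTestFunction.partialDeriv_mem {φ : EuclideanSpace ℝ (Fin d) → ℝ}
    (hφ : IsTestFunction Ω φ) (i : Fin d) : IsTestFunction Ω (partialDeriv i φ) :=
  ⟨contDiff_partialDeriv hφ.1 (by simp) i,
    hφ.2.1.of_isClosed_subset (isClosed_tsupport _) (tsupport_partialDeriv_subset φ i),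
    (tsupport_partialDeriv_subset φ i).trans hφ.2.2⟩

theorem partialDeriv_comm {φ : EuclideanSpace ℝ (Fin d) → ℝ} (hφ : ContDiff ℝ 2 φ)
    (i j : Fin d) : partialDeriv i (partialDeriv j φ) = partialDeriv j (partialDeriv i φ) := by
  have key : ∀ (i j : Fin d) x, partialDeriv i (partialDeriv j φ) x =
      fderiv ℝ (fderiv ℝ φ) x (EuclideanSpace.single i 1) (EuclideanSpace.single j 1) := by
    intro i j x
    have h : DifferentiableAt ℝ (fderiv ℝ φ) x :=
      ((hφ.fderiv_right (m := 1) (by norm_num)).differentiable (by norm_num)) x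
    unfold partialDeriv
    rw [fderiv_clm_apply h (differentiableAt_const _)]
    simp
  ext x
  rw [key, key]
  exact (hφ.contDiffAt.isSymmSndFDerivAt (by simp)) _ _

theorem IsTestFunction.iterate_partialDeriv {φ : EuclideanSpace ℝ (Fin d) → ℝ}
    (hφ : IsTestFunction Ω φ) (i : Fin d) (n : ℕ) :
    IsTestFunction Ω ((partialDeriv i)^[n] φ) := by
  induction n with
  | zero => simpa using hφ
  | succ n ih => rw [Function.iterate_succ_apply']; exact ih.partialDeriv_mem i

theorem IsTestFunction.iterate_partialDeriv_comm {φ : EuclideanSpace ℝ (Fin d) → ℝ}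
    (hφ : IsTestFunction Ω φ) (i j : Fin d) (n : ℕ) :
    partialDeriv i ((partialDeriv j)^[n] φ) =
      (partialDeriv j)^[n] (partialDeriv i φ) := by
  induction n with
  | zero => rfl
  | succ n ih =>
    rw [Function.iterate_succ_apply', Function.iterate_succ_apply', ← ih]
    exact partialDeriv_comm ((hφ.iterate_partialDeriv j n).1.of_le (WithTop.coe_le_coe.2 (le_top : (2 : ℕ∞) ≤ ⊤))) _ _

theorem IsTestFunction.foldr_partialDeriv {φ : EuclideanSpace ℝ (Fin d) → ℝ}
    (hφ : IsTestFunction Ω φ) (α : Fin d → ℕ) (l : List (Fin d)) :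
    IsTestFunction Ω
      (l.foldr (fun i f => (partialDeriv i)^[α i] f) φ) := by
  induction l with
  | nil => exact hφ
  | cons a l ih => exact ih.iterate_partialDeriv a _

theorem IsTestFunction.multiDeriv_mem {φ : EuclideanSpace ℝ (Fin d) → ℝ}
    (hφ : IsTestFunction Ω φ) (α : Fin d → ℕ) : IsTestFunction Ω (multiDeriv α φ) :=
  hφ.foldr_partialDeriv α _

theorem IsTestFunction.partialDeriv_foldr {φ : EuclideanSpace ℝ (Fin d) → ℝ}
    (hφ : IsTestFunction Ω φ) (α : Fin d → ℕ) (j : Fin d) (l : List (Fin d)) :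
    partialDeriv j
        (l.foldr (fun i f => (partialDeriv i)^[α i] f) φ) =
      l.foldr (fun i f => (partialDeriv i)^[α i] f)
        (partialDeriv j φ) := by
  induction l with
  | nil => rfl
  | cons a l ih =>
    simp only [List.foldr_cons]
    rw [(hφ.foldr_partialDeriv α l).iterate_partialDeriv_comm, ih]

theorem multiDeriv_zero (φ : EuclideanSpace ℝ (Fin d) → ℝ) : multiDeriv 0 φ = φ := by
  unfold multiDeriv
  induction List.finRange d with
  | nil => rfl
  | cons a l ih => simp only [List.foldr_cons, Pi.zero_apply, Function.iterate_zero, id_eq]; exact ih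

/-- Partial derivatives of a test function commute, so the extra derivative can be moved to the
innermost position, where an integration by parts sees it. -/
theorem IsTestFunction.multiDeriv_add_single {φ : EuclideanSpace ℝ (Fin d) → ℝ}
    (hφ : IsTestFunction Ω φ) (α : Fin d → ℕ) (j : Fin d) :
    multiDeriv (α + Pi.single j 1) φ =
      multiDeriv α (partialDeriv j φ) := by
  have key : ∀ l : List (Fin d), l.Nodup →
      l.foldr (fun i f => (partialDeriv i)^[(α + Pi.single j 1 : Fin d → ℕ) i] f) φ =
        l.foldr (fun i f => (partialDeriv i)^[α i] f)
          (if j ∈ l then partialDeriv j φ else φ) := by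
    intro l
    induction l with
    | nil => intro _; rfl
    | cons a l ih =>
      intro hl
      rw [List.nodup_cons] at hl
      simp only [List.foldr_cons]
      rw [ih hl.2]
      by_cases haj : a = j
      · subst haj
        have : (α + Pi.single a 1 : Fin d → ℕ) a = α a + 1 := by simp
        rw [this, if_neg hl.1, Function.iterate_succ_apply, hφ.partialDeriv_foldr]
        simp
      · have : (α + Pi.single j 1 : Fin d → ℕ) a = α a := by simp [haj]
        rw [this]
        simp [Ne.symm haj]
  have := key _ (List.nodup_finRange d)
  simpa [multiDeriv] using this

theorem IsTestFunction.multiDeriv_single {φ : EuclideanSpace ℝ (Fin d) → ℝ}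
    (hφ : IsTestFunction Ω φ) (j : Fin d) :
    multiDeriv (Pi.single j 1) φ = partialDeriv j φ := by
  have := hφ.multiDeriv_add_single 0 j
  rwa [zero_add, multiDeriv_zero] at this

/-! ### Calculus of weak derivatives -/

theorem IsTestFunction.integrableOn_mul {f φ : EuclideanSpace ℝ (Fin d) → ℝ}
    (hf : LocallyIntegrableOn f Ω) (hφ : IsTestFunction Ω φ) :
    IntegrableOn (fun x => f x * φ x) Ω := by
  have h2 : IntegrableOn (fun x => f x * φ x) (tsupport φ) :=
    (hf.integrableOn_compact_subset hφ.2.2 hφ.2.1).mul_continuousOn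
      hφ.1.continuous.continuousOn hφ.2.1
  refine (integrableOn_iff_integrable_of_support_subset ?_).1 h2 |>.integrableOn
  intro x hx
  apply subset_tsupport φ
  intro h0
  exact hx (by simp [h0])

theorem HasWeakDeriv.hasWeakDeriv_weakDeriv {α : Fin d → ℕ}
    {u g : EuclideanSpace ℝ (Fin d) → ℝ} (h : HasWeakDeriv Ω α u g) :
    HasWeakDeriv Ω α u (weakDeriv Ω α u) := by
  have h' : ∃ g, HasWeakDeriv Ω α u g := ⟨g, h⟩
  rw [weakDeriv, dif_pos h']
  exact h'.choose_spec

theorem HasWeakDeriv.weakDeriv_ae_eq (hΩ : IsOpen Ω) {α : Fin d → ℕ}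
    {u g : EuclideanSpace ℝ (Fin d) → ℝ} (h : HasWeakDeriv Ω α u g) :
    weakDeriv Ω α u =ᵐ[volume.restrict Ω] g :=
  h.hasWeakDeriv_weakDeriv.ae_eq hΩ h

theorem HasWeakDeriv.add_mul {α : Fin d → ℕ} {u v g h : EuclideanSpace ℝ (Fin d) → ℝ}
    (hu : HasWeakDeriv Ω α u g) (hv : HasWeakDeriv Ω α v h) (r : ℝ) :
    HasWeakDeriv Ω α (fun x => u x + r * v x) (fun x => g x + r * h x) := by
  refine ⟨hu.1.add (hv.1.smul r), hu.2.1.add (hv.2.1.smul r), fun φ hφ => ?_⟩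
  have hm := hφ.multiDeriv_mem α
  have e1 : ∫ x in Ω, (u x + r * v x) * multiDeriv α φ x =
      (∫ x in Ω, u x * multiDeriv α φ x) + r * ∫ x in Ω, v x * multiDeriv α φ x := by
    rw [← integral_const_mul, ← integral_add (hm.integrableOn_mul hu.1)
      ((hm.integrableOn_mul hv.1).const_mul r)]
    congr 1; ext x; ring
  have e2 : ∫ x in Ω, (g x + r * h x) * φ x =
      (∫ x in Ω, g x * φ x) + r * ∫ x in Ω, h x * φ x := by
    rw [← integral_const_mul, ← integral_add (hφ.integrableOn_mul hu.2.1)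
      ((hφ.integrableOn_mul hv.2.1).const_mul r)]
    congr 1; ext x; ring
  rw [e1, e2, hu.2.2 φ hφ, hv.2.2 φ hφ]
  ring

theorem hasWeakDeriv_zero {u : EuclideanSpace ℝ (Fin d) → ℝ} (hu : LocallyIntegrableOn u Ω) :
    HasWeakDeriv Ω 0 u u :=
  ⟨hu, hu, fun φ _ => by simp [multiDeriv_zero]⟩

/-- Testing the definition of `g` against `∂_i φ` and that of `h` against `φ` gives the same
integral of `u`. This links iterated first derivatives, used in the operator, with the multi-index
derivatives in the norm. -/
theorem HasWeakDeriv.of_add_single {α : Fin d → ℕ} {i : Fin d}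
    {u g h : EuclideanSpace ℝ (Fin d) → ℝ} (hg : HasWeakDeriv Ω α u g)
    (hh : HasWeakDeriv Ω (α + Pi.single i 1) u h) : HasWeakDeriv Ω (Pi.single i 1) g h := by
  refine ⟨hg.2.1, hh.2.1, fun φ hφ => ?_⟩
  have e1 := hg.2.2 _ (hφ.partialDeriv_mem i)
  have e2 := hh.2.2 φ hφ
  rw [hφ.multiDeriv_add_single, e1] at e2
  rw [hφ.multiDeriv_single]
  simp only [Pi.add_apply, Finset.sum_add_distrib, pow_add, mul_assoc] at e2
  exact mul_left_cancel₀ (pow_ne_zero _ (by norm_num)) e2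

/-! ### Sobolev functions -/

theorem MemSobolev.hasWeakDeriv {k : ℕ} {u : EuclideanSpace ℝ (Fin d) → ℝ}
    (hu : MemSobolev Ω k u) {α : Fin d → ℕ} (hα : ∑ i, α i ≤ k) :
    HasWeakDeriv Ω α u (weakDeriv Ω α u) := by
  obtain ⟨g, hg, -⟩ := hu.2 α hα
  exact hg.hasWeakDeriv_weakDeriv

theorem MemSobolev.memLp_weakDeriv (hΩ : IsOpen Ω) {k : ℕ}
    {u : EuclideanSpace ℝ (Fin d) → ℝ} (hu : MemSobolev Ω k u) {α : Fin d → ℕ}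
    (hα : ∑ i, α i ≤ k) : MemLp (weakDeriv Ω α u) 2 (volume.restrict Ω) := by
  obtain ⟨g, hg, hg2⟩ := hu.2 α hα
  exact hg2.ae_eq (hg.weakDeriv_ae_eq hΩ).symm

theorem sum_single_one (i : Fin d) : ∑ j, (Pi.single i 1 : Fin d → ℕ) j = 1 := by
  simp

theorem MemSobolev.hasWeakDeriv_weakPartial {u : EuclideanSpace ℝ (Fin d) → ℝ}
    (hu : MemSobolev Ω 3 u) (i : Fin d) :
    HasWeakDeriv Ω (Pi.single i 1) u (weakPartial Ω i u) :=
  hu.hasWeakDeriv (by rw [sum_single_one]; norm_num)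

theorem MemSobolev.memLp_weakPartial (hΩ : IsOpen Ω) {u : EuclideanSpace ℝ (Fin d) → ℝ}
    (hu : MemSobolev Ω 3 u) (i : Fin d) : MemLp (weakPartial Ω i u) 2 (volume.restrict Ω) :=
  hu.memLp_weakDeriv hΩ (by rw [sum_single_one]; norm_num)

theorem sum_single_add_single (i j : Fin d) :
    ∑ k, (Pi.single i 1 + Pi.single j 1 : Fin d → ℕ) k = 2 := by
  simp only [Pi.add_apply, Finset.sum_add_distrib, sum_single_one]

theorem MemSobolev.hasWeakDeriv_weakPartial_weakPartial
    {u : EuclideanSpace ℝ (Fin d) → ℝ} (hu : MemSobolev Ω 3 u) (i j : Fin d) :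
    HasWeakDeriv Ω (Pi.single i 1) (weakPartial Ω j u)
      (weakDeriv Ω (Pi.single j 1 + Pi.single i 1) u) :=
  (hu.hasWeakDeriv_weakPartial j).of_add_single
    (hu.hasWeakDeriv (by rw [sum_single_add_single]; norm_num))

theorem MemSobolev.weakPartial_weakPartial_ae_eq (hΩ : IsOpen Ω)
    {u : EuclideanSpace ℝ (Fin d) → ℝ} (hu : MemSobolev Ω 3 u) (i j : Fin d) :
    weakPartial Ω i (weakPartial Ω j u) =ᵐ[volume.restrict Ω]
      weakDeriv Ω (Pi.single j 1 + Pi.single i 1) u :=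
  (hu.hasWeakDeriv_weakPartial_weakPartial i j).weakDeriv_ae_eq hΩ

theorem MemSobolev.memLp_weakPartial_weakPartial (hΩ : IsOpen Ω)
    {u : EuclideanSpace ℝ (Fin d) → ℝ} (hu : MemSobolev Ω 3 u) (i j : Fin d) :
    MemLp (weakPartial Ω i (weakPartial Ω j u)) 2 (volume.restrict Ω) :=
  (hu.memLp_weakDeriv hΩ (by rw [sum_single_add_single]; norm_num)).ae_eq
    (hu.weakPartial_weakPartial_ae_eq hΩ i j).symm

theorem MemSobolev.add_mul {k : ℕ} {u v : EuclideanSpace ℝ (Fin d) → ℝ}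
    (hu : MemSobolev Ω k u) (hv : MemSobolev Ω k v) (r : ℝ) :
    MemSobolev Ω k (fun x => u x + r * v x) := by
  refine ⟨hu.1.add (hv.1.const_mul r), fun α hα => ?_⟩
  obtain ⟨g, hg, hg2⟩ := hu.2 α hα
  obtain ⟨h, hh, hh2⟩ := hv.2 α hα
  exact ⟨_, hg.add_mul hh r, hg2.add (hh2.const_mul r)⟩

theorem MemSobolev.weakDeriv_add_mul (hΩ : IsOpen Ω) {k : ℕ}
    {u v : EuclideanSpace ℝ (Fin d) → ℝ} (hu : MemSobolev Ω k u) (hv : MemSobolev Ω k v) (r : ℝ)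
    {α : Fin d → ℕ} (hα : ∑ i, α i ≤ k) :
    weakDeriv Ω α (fun x => u x + r * v x) =ᵐ[volume.restrict Ω]
      fun x => weakDeriv Ω α u x + r * weakDeriv Ω α v x :=
  ((hu.hasWeakDeriv hα).add_mul (hv.hasWeakDeriv hα) r).weakDeriv_ae_eq hΩ

theorem MemSobolev.weakPartial_add_mul (hΩ : IsOpen Ω)
    {u v : EuclideanSpace ℝ (Fin d) → ℝ} (hu : MemSobolev Ω 3 u) (hv : MemSobolev Ω 3 v) (r : ℝ)
    (i : Fin d) :
    weakPartial Ω i (fun x => u x + r * v x) =ᵐ[volume.restrict Ω]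
      fun x => weakPartial Ω i u x + r * weakPartial Ω i v x :=
  hu.weakDeriv_add_mul hΩ hv r (by rw [sum_single_one]; norm_num)

/-- The inner `weakPartial` is a chosen representative and is linear only almost everywhere, so the
comparison goes through the multi-index derivative of order two of each function. -/
theorem MemSobolev.weakPartial_weakPartial_add_mul (hΩ : IsOpen Ω)
    {u v : EuclideanSpace ℝ (Fin d) → ℝ} (hu : MemSobolev Ω 3 u) (hv : MemSobolev Ω 3 v) (r : ℝ)
    (i j : Fin d) :
    weakPartial Ω i (weakPartial Ω j (fun x => u x + r * v x)) =ᵐ[volume.restrict Ω]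
      fun x => weakPartial Ω i (weakPartial Ω j u) x
        + r * weakPartial Ω i (weakPartial Ω j v) x := by
  have h := hu.weakDeriv_add_mul hΩ hv r (α := Pi.single j 1 + Pi.single i 1)
    (by rw [sum_single_add_single]; norm_num)
  filter_upwards [h, hu.weakPartial_weakPartial_ae_eq hΩ i j,
    hv.weakPartial_weakPartial_ae_eq hΩ i j,
    (hu.add_mul hv r).weakPartial_weakPartial_ae_eq hΩ i j] with x h1 h2 h3 h4
  rw [h2, h3, h4, h1]

/-! ### The norm of `H³` -/

theorem h3NormSq_nonneg {N : ℕ} (U : EuclideanSpace ℝ (Fin d) → Fin N → ℝ) :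
    0 ≤ h3NormSq Ω U :=
  Finset.sum_nonneg fun _ _ => Finset.sum_nonneg fun _ _ => Finset.sum_nonneg fun _ _ =>
    integral_nonneg fun _ => sq_nonneg _

theorem integral_weakDeriv_sq_le_h3NormSq {N : ℕ} (U : EuclideanSpace ℝ (Fin d) → Fin N → ℝ)
    (m : Fin N) {α : Fin d → ℕ} (hα : ∑ i, α i ≤ 3) :
    ∫ x in Ω, (weakDeriv Ω α (fun y => U y m) x) ^ 2 ≤ h3NormSq Ω U := by
  have nn : ∀ (m : Fin N) (α : Fin d → ℕ),
      0 ≤ ∫ x in Ω, (weakDeriv Ω α (fun y => U y m) x) ^ 2 :=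
    fun _ _ => integral_nonneg fun _ => sq_nonneg _
  unfold h3NormSq
  refine le_trans ?_ (Finset.single_le_sum (f := fun m => ∑ k ∈ Finset.range 4,
    ∑ α ∈ Finset.piAntidiag (Finset.univ : Finset (Fin d)) k,
    ∫ x in Ω, (weakDeriv Ω α (fun y => U y m) x) ^ 2) (fun m _ => Finset.sum_nonneg fun _ _ =>
      Finset.sum_nonneg fun _ _ => nn _ _) (Finset.mem_univ m))
  refine le_trans ?_ (Finset.single_le_sum (f := fun k =>
    ∑ α ∈ Finset.piAntidiag (Finset.univ : Finset (Fin d)) k,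
    ∫ x in Ω, (weakDeriv Ω α (fun y => U y m) x) ^ 2) (fun _ _ =>
      Finset.sum_nonneg fun _ _ => nn _ _) (Finset.mem_range.2 (Nat.lt_succ_of_le hα)))
  exact Finset.single_le_sum (f := fun α =>
    ∫ x in Ω, (weakDeriv Ω α (fun y => U y m) x) ^ 2) (fun _ _ => nn _ _)
    (Finset.mem_piAntidiag.2 ⟨rfl, by simp⟩)

/-- From `(a + r b)² ≤ 2a² + 2r²b²` for each derivative. This substitute for the triangle inequality
is all that the error estimate needs. -/
theorem h3NormSq_add_mul_le (hΩ : IsOpen Ω) {N : ℕ}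
    {U V : EuclideanSpace ℝ (Fin d) → Fin N → ℝ} (hU : MemH3 Ω U) (hV : MemH3 Ω V) (r : ℝ) :
    h3NormSq Ω (fun x m => U x m + r * V x m) ≤ 2 * h3NormSq Ω U + 2 * r ^ 2 * h3NormSq Ω V := by
  unfold h3NormSq
  simp only [Finset.mul_sum, ← Finset.sum_add_distrib]
  refine Finset.sum_le_sum fun m _ => Finset.sum_le_sum fun k hk => Finset.sum_le_sum fun α hα => ?_
  have hα3 : ∑ i, α i ≤ 3 := by
    rw [Finset.mem_piAntidiag] at hα
    rw [hα.1]
    exact Nat.le_of_lt_succ (Finset.mem_range.1 hk)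
  have iU := ((hU m).memLp_weakDeriv hΩ hα3).integrable_sq
  have iV := ((hV m).memLp_weakDeriv hΩ hα3).integrable_sq
  rw [← integral_const_mul, ← integral_const_mul, ← integral_add (iU.const_mul _) (iV.const_mul _)]
  refine integral_mono_ae (((hU m).add_mul (hV m) r).memLp_weakDeriv hΩ hα3).integrable_sq
    ((iU.const_mul _).add (iV.const_mul _)) ?_
  filter_upwards [(hU m).weakDeriv_add_mul hΩ (hV m) r hα3] with x hx
  rw [hx]
  nlinarith [sq_nonneg (weakDeriv Ω α (fun y => U y m) x - r * weakDeriv Ω α (fun y => V y m) x)]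

theorem MemSobolev.integral_sq_le_h3NormSq (hΩ : IsOpen Ω) {N : ℕ}
    {U : EuclideanSpace ℝ (Fin d) → Fin N → ℝ} (hU : MemH3 Ω U) (m : Fin N) :
    ∫ x in Ω, (U x m) ^ 2 ≤ h3NormSq Ω U := by
  have h0 : ∑ i, (0 : Fin d → ℕ) i ≤ 3 := by simp
  refine le_trans (le_of_eq ?_) (integral_weakDeriv_sq_le_h3NormSq U m h0)
  have hl : LocallyIntegrableOn (fun y => U y m) Ω := ((hU m).hasWeakDeriv h0).1
  refine integral_congr_ae ?_
  filter_upwards [(hasWeakDeriv_zero hl).weakDeriv_ae_eq hΩ] with x hx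
  rw [hx]

theorem integral_weakPartial_sq_le_h3NormSq {N : ℕ}
    (U : EuclideanSpace ℝ (Fin d) → Fin N → ℝ) (m : Fin N) (i : Fin d) :
    ∫ x in Ω, (weakPartial Ω i (fun y => U y m) x) ^ 2 ≤ h3NormSq Ω U :=
  integral_weakDeriv_sq_le_h3NormSq U m (by rw [sum_single_one]; norm_num)

theorem integral_weakPartial_weakPartial_sq_le_h3NormSq (hΩ : IsOpen Ω) {N : ℕ}
    {U : EuclideanSpace ℝ (Fin d) → Fin N → ℝ} (hU : MemH3 Ω U) (m : Fin N) (i j : Fin d) :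
    ∫ x in Ω, (weakPartial Ω i (weakPartial Ω j (fun y => U y m)) x) ^ 2 ≤ h3NormSq Ω U := by
  refine le_trans (le_of_eq ?_) (integral_weakDeriv_sq_le_h3NormSq U m
    (α := Pi.single j 1 + Pi.single i 1) (by rw [sum_single_add_single]; norm_num))
  refine integral_congr_ae ?_
  filter_upwards [(hU m).weakPartial_weakPartial_ae_eq hΩ i j] with x hx
  rw [hx]

end WeakDerivatives

end QuasiReversibility

namespace QuasiReversibility

/-! ### The boundary and its surface measure, traces, and vanishing Cauchy data. -/

section Boundary

open Filter Topology

variable {d : ℕ} {Ω : Set (EuclideanSpace ℝ (Fin d))}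

/-! ### The boundary, its normal and its measure -/

theorem IsLocalDefiningFunction.of_mem {x y : EuclideanSpace ℝ (Fin d)}
    {W : Set (EuclideanSpace ℝ (Fin d))} {ρ : EuclideanSpace ℝ (Fin d) → ℝ}
    (H : IsLocalDefiningFunction Ω x W ρ) (hy : y ∈ W) : IsLocalDefiningFunction Ω y W ρ :=
  ⟨H.isOpen, hy, H.smooth, H.gradient_ne_zero, H.inter_eq⟩

theorem IsLocalDefiningFunction.eq_zero {x y : EuclideanSpace ℝ (Fin d)}
    {W : Set (EuclideanSpace ℝ (Fin d))} {ρ : EuclideanSpace ℝ (Fin d) → ℝ} (hΩ : IsOpen Ω)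
    (H : IsLocalDefiningFunction Ω x W ρ) (hy : y ∈ W) (hyΩ : y ∈ frontier Ω) : ρ y = 0 := by
  have hW : W ∈ 𝓝 y := H.isOpen.mem_nhds hy
  refine le_antisymm ?_ ?_
  · by_contra! h
    have hev : ∀ᶠ z in 𝓝 y, 0 < ρ z :=
      (H.smooth.continuousOn.continuousAt hW).eventually (lt_mem_nhds h)
    obtain ⟨z, ⟨hz0, hzW⟩, hzΩ⟩ :=
      mem_closure_iff_nhds.1 (frontier_subset_closure hyΩ) _ (Filter.inter_mem hev hW)
    have : z ∈ {y ∈ W | ρ y < 0} := H.inter_eq ▸ ⟨hzΩ, hzW⟩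
    exact absurd this.2 (not_lt.2 (le_of_lt hz0))
  · by_contra! h
    have : y ∈ Ω ∩ W := by rw [H.inter_eq]; exact ⟨hy, h⟩
    rw [hΩ.frontier_eq] at hyΩ
    exact hyΩ.2 this.1

theorem IsLocalDefiningFunction.outwardNormal_eq {x y : EuclideanSpace ℝ (Fin d)}
    {W : Set (EuclideanSpace ℝ (Fin d))} {ρ : EuclideanSpace ℝ (Fin d) → ℝ} (hΩ : IsOpen Ω)
    (H : IsLocalDefiningFunction Ω x W ρ) (hy : y ∈ W) (hyΩ : y ∈ frontier Ω) :
    outwardNormal Ω y = ‖gradient ρ y‖⁻¹ • gradient ρ y := by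
  have h : IsOutwardNormal Ω y (‖gradient ρ y‖⁻¹ • gradient ρ y) := ⟨W, ρ, H.of_mem hy, rfl⟩
  exact IsOutwardNormal.unique hΩ hyΩ (Classical.epsilon_spec (p := IsOutwardNormal Ω y) ⟨_, h⟩) h

theorem norm_outwardNormal (hΩ : IsOpen Ω) (hs : HasSmoothBoundary Ω)
    {x : EuclideanSpace ℝ (Fin d)} (hx : x ∈ frontier Ω) : ‖outwardNormal Ω x‖ = 1 := by
  obtain ⟨W, ρ, H⟩ := hs x hx
  rw [H.outwardNormal_eq hΩ H.mem hx, norm_smul, norm_inv, norm_norm, inv_mul_cancel₀]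
  exact norm_ne_zero_iff.2 (H.gradient_ne_zero x H.mem)

theorem continuousOn_outwardNormal (hΩ : IsOpen Ω) (hs : HasSmoothBoundary Ω) :
    ContinuousOn (outwardNormal Ω) (frontier Ω) := by
  intro x hx
  obtain ⟨W, ρ, H⟩ := hs x hx
  have hW : W ∈ 𝓝 x := H.isOpen.mem_nhds H.mem
  have hg : ContinuousAt (gradient ρ) x := by
    have h1 : ContinuousAt (fderiv ℝ ρ) x :=
      (H.smooth.continuousOn_fderiv_of_isOpen H.isOpen (by simp)).continuousAt hW
    exact (InnerProductSpace.toDual ℝ _).symm.continuous.continuousAt.comp h1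
  have hc : ContinuousAt (fun y => ‖gradient ρ y‖⁻¹ • gradient ρ y) x :=
    (hg.norm.inv₀ (norm_ne_zero_iff.2 (H.gradient_ne_zero x H.mem))).smul hg
  refine hc.continuousWithinAt.congr_of_eventuallyEq ?_ (H.outwardNormal_eq hΩ H.mem hx)
  filter_upwards [self_mem_nhdsWithin, mem_nhdsWithin_of_mem_nhds hW] with y hy hyW
  exact H.outwardNormal_eq hΩ hyW hy

/-- A set whose chords are nearly orthogonal to `g` is a Lipschitz graph over the hyperplane `g^⊥`:
the orthogonal projection has a Lipschitz inverse on it. Its image is bounded in dimension `n`,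
hence of finite measure, and so is the set. -/
theorem euclideanHausdorffMeasure_lt_top_of_inner_le {n : ℕ}
    [Fact (Module.finrank ℝ (EuclideanSpace ℝ (Fin d)) = n + 1)]
    {g : EuclideanSpace ℝ (Fin d)} (hg : g ≠ 0) {s : Set (EuclideanSpace ℝ (Fin d))}
    (hs : Bornology.IsBounded s)
    (h : ∀ y ∈ s, ∀ z ∈ s, |inner ℝ g (y - z)| ≤ ‖g‖ / 2 * ‖y - z‖) :
    (μHE[n] : Measure (EuclideanSpace ℝ (Fin d))) s < ⊤ := by
  set H := (Submodule.span ℝ {g})ᗮ with hH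
  have hfin : Module.finrank ℝ H = n := Submodule.finrank_orthogonal_span_singleton hg
  let f : s → H := fun y => H.orthogonalProjectionOnto (y : EuclideanSpace ℝ (Fin d))
  have hgn : 0 < ‖g‖ := norm_pos_iff.2 hg
  -- The component of `v` along `g` has length `|⟨g, v⟩| / ‖g‖ ≤ ‖v‖ / 2`, so the projection retains
  -- at least half of `‖v‖`.
  have hanti : AntilipschitzWith 2 f := by
    refine AntilipschitzWith.of_le_mul_dist fun y z => ?_
    have hyz := h y y.2 z z.2
    set v := (y : EuclideanSpace ℝ (Fin d)) - z with hv
    have e1 : dist (f y) (f z) = ‖H.orthogonalProjectionOnto v‖ := by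
      rw [dist_eq_norm, hv, map_sub]
    have e2 : v = (H.orthogonalProjectionOnto v : EuclideanSpace ℝ (Fin d))
        + (inner ℝ g v / ‖g‖ ^ 2) • g := by
      have h3 := Submodule.starProjection_singleton ℝ (v := g) v
      have h4 := Submodule.starProjection_add_starProjection_orthogonal (K := Submodule.span ℝ {g}) v
      rw [h3, add_comm] at h4
      exact h4.symm
    have e3 : ‖(inner ℝ g v / ‖g‖ ^ 2) • g‖ ≤ ‖v‖ / 2 := by
      rw [norm_smul, Real.norm_eq_abs, abs_div, abs_of_nonneg (sq_nonneg ‖g‖), div_mul_eq_mul_div,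
        div_le_iff₀ (by positivity)]
      nlinarith
    have e4 : ‖v‖ ≤ ‖H.orthogonalProjectionOnto v‖ + ‖(inner ℝ g v / ‖g‖ ^ 2) • g‖ := by
      conv_lhs => rw [e2]
      exact norm_add_le _ _
    rw [e1, Subtype.dist_eq, dist_eq_norm, ← hv]
    push_cast
    linarith
  have hb : Bornology.IsBounded (f '' univ) := by
    have : f '' univ = H.orthogonalProjectionOnto '' s := by
      ext z; simp [f]
    rw [this]
    exact H.orthogonalProjectionOnto.lipschitz.isBounded_image hs
  have hfinite : (μH[(n : ℝ)] : Measure H) (f '' univ) < ⊤ := by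
    rw [← hfin]
    exact hb.measure_lt_top
  have h1 : (μH[(n : ℝ)] : Measure s) univ < ⊤ :=
    (hanti.le_hausdorffMeasure_image (by positivity) univ).trans_lt
      (ENNReal.mul_lt_top (by simp) hfinite)
  have h2 : (μH[(n : ℝ)] : Measure (EuclideanSpace ℝ (Fin d))) s < ⊤ := by
    have := (isometry_subtype_coe (s := s)).hausdorffMeasure_image (d := n)
      (Or.inl (by positivity)) univ
    rw [image_univ, Subtype.range_coe] at this
    rwa [this]
  rw [Measure.euclideanHausdorffMeasure_def, Measure.smul_apply, ENNReal.smul_def, smul_eq_mul]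
  exact ENNReal.mul_lt_top (by simp) h2

/-- The boundary is compact, and near each of its points it is contained in the zero set of a
function with nonzero gradient, hence is a Lipschitz graph. -/
theorem isFiniteMeasure_surfaceMeasure (hd : 0 < d) (hΩ : IsOpen Ω)
    (hb : Bornology.IsBounded Ω) (hs : HasSmoothBoundary Ω) :
    IsFiniteMeasure (surfaceMeasure Ω) := by
  have hcomp : IsCompact (frontier Ω) :=
    Metric.isCompact_of_isClosed_isBounded isClosed_frontier
      (hb.closure.subset frontier_subset_closure)
  have : Fact (Module.finrank ℝ (EuclideanSpace ℝ (Fin d)) = (d - 1) + 1) :=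
    ⟨by rw [finrank_euclideanSpace_fin]; omega⟩
  have key : (μHE[d - 1] : Measure (EuclideanSpace ℝ (Fin d))) (frontier Ω) < ⊤ := by
    refine hcomp.measure_lt_top_of_nhdsWithin fun x hx => ?_
    obtain ⟨W, ρ, H⟩ := hs x hx
    have hW : W ∈ 𝓝 x := H.isOpen.mem_nhds H.mem
    have hg := H.gradient_ne_zero x H.mem
    have hgn : 0 < ‖gradient ρ x‖ := norm_pos_iff.2 hg
    have hstrict : HasStrictFDerivAt ρ (fderiv ℝ ρ x) x :=
      (H.smooth.contDiffAt hW).hasStrictFDerivAt (by simp)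
    -- Strict differentiability compares two arbitrary points near `x`. At two boundary points `ρ`
    -- vanishes, so only the linear term is left and it is at most half of the trivial bound.
    have hsm := hstrict.isLittleO.def (half_pos hgn)
    rw [nhds_prod_eq, Filter.eventually_prod_self_iff'] at hsm
    obtain ⟨t, ht, htt⟩ := hsm
    have hball : Metric.ball x 1 ∈ 𝓝 x := Metric.ball_mem_nhds x one_pos
    refine ⟨frontier Ω ∩ (t ∩ (W ∩ Metric.ball x 1)), ?_, ?_⟩
    · exact inter_mem self_mem_nhdsWithin
        (mem_nhdsWithin_of_mem_nhds (inter_mem ht (inter_mem hW hball)))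
    · refine euclideanHausdorffMeasure_lt_top_of_inner_le hg
        (Metric.isBounded_ball.subset fun y hy => hy.2.2.2) fun y hy z hz => ?_
      have h1 := htt y hy.2.1 z hz.2.1
      simp only [H.eq_zero hΩ hy.2.2.1 hy.1, H.eq_zero hΩ hz.2.2.1 hz.1, sub_zero, zero_sub,
        norm_neg, Real.norm_eq_abs] at h1
      have h2 : inner ℝ (gradient ρ x) (y - z) = fderiv ℝ ρ x (y - z) := by
        simp [gradient]
      rw [h2]
      exact h1
  exact ⟨by rw [surfaceMeasure, Measure.restrict_apply_univ]; exact key⟩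

theorem ae_surfaceMeasure_of_forall {p : EuclideanSpace ℝ (Fin d) → Prop}
    (h : ∀ x ∈ frontier Ω, p x) : ∀ᵐ x ∂(surfaceMeasure Ω), p x :=
  ae_restrict_of_forall_mem isClosed_frontier.measurableSet h

theorem aestronglyMeasurable_outwardNormal (hΩ : IsOpen Ω) (hs : HasSmoothBoundary Ω)
    (i : Fin d) : AEStronglyMeasurable (fun x => outwardNormal Ω x i) (surfaceMeasure Ω) := by
  have h : ContinuousOn (fun x => outwardNormal Ω x i) (frontier Ω) :=
    (EuclideanSpace.proj (𝕜 := ℝ) i).continuous.comp_continuousOn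
      (continuousOn_outwardNormal hΩ hs)
  exact h.aestronglyMeasurable isClosed_frontier.measurableSet

theorem abs_outwardNormal_le (hΩ : IsOpen Ω) (hs : HasSmoothBoundary Ω) (i : Fin d) :
    ∀ᵐ x ∂(surfaceMeasure Ω), ‖outwardNormal Ω x i‖ ≤ 1 :=
  ae_surfaceMeasure_of_forall fun _ hx =>
    (PiLp.norm_apply_le _ i).trans (norm_outwardNormal hΩ hs hx).le

theorem _root_.Bornology.IsBounded.exists_bound_of_continuous
    {s : Set (EuclideanSpace ℝ (Fin d))} (hs : Bornology.IsBounded s)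
    {a : EuclideanSpace ℝ (Fin d) → ℝ} (ha : Continuous a) :
    ∃ C, ∀ x ∈ s, ‖a x‖ ≤ C := by
  obtain ⟨C, hC⟩ := (Metric.isCompact_of_isClosed_isBounded isClosed_closure
    hs.closure).exists_bound_of_continuousOn ha.continuousOn
  exact ⟨C, fun x hx => hC x (subset_closure hx)⟩

theorem memLp_continuous_mul (hb : Bornology.IsBounded Ω) (hΩ : IsOpen Ω)
    {a f : EuclideanSpace ℝ (Fin d) → ℝ} (ha : Continuous a)
    (hf : MemLp f 2 (volume.restrict Ω)) :
    MemLp (fun x => a x * f x) 2 (volume.restrict Ω) := by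
  obtain ⟨C, hC⟩ := hb.exists_bound_of_continuous ha
  refine MemLp.of_le_mul (c := C) hf (ha.aestronglyMeasurable.mul hf.1) ?_
  refine ae_restrict_of_forall_mem hΩ.measurableSet fun x hx => ?_
  rw [norm_mul]
  exact mul_le_mul_of_nonneg_right (hC x hx) (norm_nonneg _)

theorem isFiniteMeasure_restrict_of_isBounded (hb : Bornology.IsBounded Ω) :
    IsFiniteMeasure ((volume : Measure (EuclideanSpace ℝ (Fin d))).restrict Ω) :=
  ⟨by rw [Measure.restrict_apply_univ]; exact hb.measure_lt_top⟩

theorem integrable_mul_continuous (hb : Bornology.IsBounded Ω) (hΩ : IsOpen Ω)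
    {a f : EuclideanSpace ℝ (Fin d) → ℝ} (ha : Continuous a)
    (hf : MemLp f 2 (volume.restrict Ω)) : Integrable (fun x => f x * a x) (volume.restrict Ω) := by
  have := isFiniteMeasure_restrict_of_isBounded hb
  simpa only [mul_comm] using (memLp_continuous_mul hb hΩ ha hf).integrable one_le_two

theorem integrable_trace_mul (hd : 0 < d) (hΩ : IsOpen Ω)
    (hb : Bornology.IsBounded Ω) (hs : HasSmoothBoundary Ω)
    {a g : EuclideanSpace ℝ (Fin d) → ℝ} (ha : Continuous a)
    (hg : MemLp g 2 (surfaceMeasure Ω)) (i : Fin d) :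
    Integrable (fun x => g x * a x * outwardNormal Ω x i) (surfaceMeasure Ω) := by
  have := isFiniteMeasure_surfaceMeasure hd hΩ hb hs
  have hbf : Bornology.IsBounded (frontier Ω) := hb.closure.subset frontier_subset_closure
  obtain ⟨C, hC⟩ := hbf.exists_bound_of_continuous ha
  have h1 : Integrable g (surfaceMeasure Ω) := hg.integrable one_le_two
  exact (h1.mul_bdd ha.aestronglyMeasurable (ae_surfaceMeasure_of_forall hC)).mul_bdd
    (aestronglyMeasurable_outwardNormal hΩ hs i) (abs_outwardNormal_le hΩ hs i)

/-! ### Traces -/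

theorem IsTrace.integral_eq_zero (hΩ : IsOpen Ω) {u g φ : EuclideanSpace ℝ (Fin d) → ℝ}
    (hu : IsTrace Ω u g) (hφ : ContDiff ℝ 1 φ) (hφs : ∀ x ∉ Ω, φ x = 0) (i : Fin d) :
    ∫ x in Ω, (u x * partialDeriv i φ x + weakPartial Ω i u x * φ x) = 0 := by
  rw [hu.2 i φ hφ]
  refine integral_eq_zero_of_ae (ae_surfaceMeasure_of_forall fun x hx => ?_)
  rw [hΩ.frontier_eq] at hx
  simp [hφs x hx.2]

/-- Both sides of the Gauss–Green formula are linear. The function `w` is tied to `u + r v` only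
almost everywhere so that the statement also covers the chosen representatives of first derivatives.
-/
theorem IsTrace.add_mul (hd : 0 < d) (hΩ : IsOpen Ω)
    (hb : Bornology.IsBounded Ω) (hs : HasSmoothBoundary Ω)
    {u v w g h : EuclideanSpace ℝ (Fin d) → ℝ} {r : ℝ}
    (hu : IsTrace Ω u g) (hv : IsTrace Ω v h)
    (mu : MemLp u 2 (volume.restrict Ω)) (mv : MemLp v 2 (volume.restrict Ω))
    (mu' : ∀ i, MemLp (weakPartial Ω i u) 2 (volume.restrict Ω))
    (mv' : ∀ i, MemLp (weakPartial Ω i v) 2 (volume.restrict Ω))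
    (hw : w =ᵐ[volume.restrict Ω] fun x => u x + r * v x)
    (hw' : ∀ i, weakPartial Ω i w =ᵐ[volume.restrict Ω]
      fun x => weakPartial Ω i u x + r * weakPartial Ω i v x) :
    IsTrace Ω w (fun x => g x + r * h x) := by
  refine ⟨hu.1.add (hv.1.const_mul r), fun i φ hφ => ?_⟩
  have c1 : Continuous φ := hφ.continuous
  have c2 : Continuous (partialDeriv i φ) :=
    (contDiff_partialDeriv (m := 0) hφ (by simp) i).continuous
  have e1 : ∫ x in Ω, (w x * partialDeriv i φ x + weakPartial Ω i w x * φ x) =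
      (∫ x in Ω, (u x * partialDeriv i φ x + weakPartial Ω i u x * φ x)) +
        r * ∫ x in Ω, (v x * partialDeriv i φ x + weakPartial Ω i v x * φ x) := by
    have iu := (integrable_mul_continuous hb hΩ c2 mu).add
      (integrable_mul_continuous hb hΩ c1 (mu' i))
    have iv := ((integrable_mul_continuous hb hΩ c2 mv).add
      (integrable_mul_continuous hb hΩ c1 (mv' i))).const_mul r
    rw [← integral_const_mul]
    refine Eq.trans (integral_congr_ae ?_) (integral_add iu iv)
    filter_upwards [hw, hw' i] with x h1 h2
    rw [h1, h2]; ring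
  have e2 : ∫ x, (g x + r * h x) * φ x * outwardNormal Ω x i ∂(surfaceMeasure Ω) =
      (∫ x, g x * φ x * outwardNormal Ω x i ∂(surfaceMeasure Ω)) +
        r * ∫ x, h x * φ x * outwardNormal Ω x i ∂(surfaceMeasure Ω) := by
    rw [← integral_const_mul, ← integral_add (integrable_trace_mul hd hΩ hb hs c1 hu.1 i)
      ((integrable_trace_mul hd hΩ hb hs c1 hv.1 i).const_mul r)]
    congr 1; ext x; ring
  rw [e1, e2, hu.2 i φ hφ, hv.2 i φ hφ]

theorem admissible_add_mul (hd : 0 < d) (hΩ : IsOpen Ω)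
    (hb : Bornology.IsBounded Ω) (hs : HasSmoothBoundary Ω) {N : ℕ}
    {A : EuclideanSpace ℝ (Fin d) → Matrix (Fin d) (Fin d) ℝ}
    {F G F' G' U V : EuclideanSpace ℝ (Fin d) → Fin N → ℝ}
    (hU : U ∈ admissible Ω A F G) (hV : V ∈ admissible Ω A F' G') (r : ℝ) :
    (fun x m => U x m + r * V x m) ∈
      admissible Ω A (fun x m => F x m + r * F' x m) (fun x m => G x m + r * G' x m) := by
  refine ⟨fun m => (hU.1 m).add_mul (hV.1 m) r, fun m => ⟨?_, ?_⟩⟩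
  · exact (hU.2 m).1.add_mul hd hΩ hb hs (hV.2 m).1 (hU.1 m).1 (hV.1 m).1
      (fun i => (hU.1 m).memLp_weakPartial hΩ i) (fun i => (hV.1 m).memLp_weakPartial hΩ i)
      (Filter.EventuallyEq.refl _ _)
      (fun i => (hU.1 m).weakPartial_add_mul hΩ (hV.1 m) r i)
  · obtain ⟨h, hh, hG⟩ := (hU.2 m).2
    obtain ⟨h', hh', hG'⟩ := (hV.2 m).2
    refine ⟨fun j x => h j x + r * h' j x, fun j => ?_, ?_⟩
    · exact (hh j).add_mul hd hΩ hb hs (hh' j) ((hU.1 m).memLp_weakPartial hΩ j)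
        ((hV.1 m).memLp_weakPartial hΩ j)
        (fun i => (hU.1 m).memLp_weakPartial_weakPartial hΩ i j)
        (fun i => (hV.1 m).memLp_weakPartial_weakPartial hΩ i j)
        ((hU.1 m).weakPartial_add_mul hΩ (hV.1 m) r j)
        (fun i => (hU.1 m).weakPartial_weakPartial_add_mul hΩ (hV.1 m) r i j)
    · filter_upwards [hG, hG'] with x h1 h2
      rw [h1, h2]
      simp only [Finset.mul_sum, ← Finset.sum_add_distrib]
      refine Finset.sum_congr rfl fun i _ => Finset.sum_congr rfl fun j _ => ?_
      ring

/-! ### Functions with vanishing Cauchy data -/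

/-- Let `h` be the trace of the gradient. As `u` vanishes on the boundary, its tangential
derivatives do too, which reads `h_j ν_i = h_i ν_j`; hence `h = lam • ν`. The conormal condition
becomes `lam (Aν · ν) = 0`, and ellipticity forces `lam = 0`. -/
theorem IsConormalTrace.isTrace_zero {μ : ℝ} (hμ : 0 < μ) (hd : 0 < d) (hΩ : IsOpen Ω)
    (hb : Bornology.IsBounded Ω) (hs : HasSmoothBoundary Ω)
    {A : EuclideanSpace ℝ (Fin d) → Matrix (Fin d) (Fin d) ℝ}
    (hA : ∀ x ξ : EuclideanSpace ℝ (Fin d), μ * ‖ξ‖ ^ 2 ≤ ∑ i, ∑ j, A x i j * ξ j * ξ i)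
    {u : EuclideanSpace ℝ (Fin d) → ℝ} (mu : MemSobolev Ω 3 u)
    (h0 : IsTrace Ω u 0) (h1 : IsConormalTrace Ω A u 0) (j : Fin d) :
    IsTrace Ω (weakPartial Ω j u) 0 := by
  obtain ⟨h, hh, hc⟩ := h1
  have := isFiniteMeasure_surfaceMeasure hd hΩ hb hs
  -- With zero trace, integration by parts is valid against every `C¹` function, without a support
  -- condition.
  have zero : ∀ i, ∀ φ : EuclideanSpace ℝ (Fin d) → ℝ, ContDiff ℝ 1 φ →
      ∫ x in Ω, weakPartial Ω i u x * φ x = - ∫ x in Ω, u x * partialDeriv i φ x := by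
    intro i φ hφ
    have := h0.2 i φ hφ
    have c2 : Continuous (partialDeriv i φ) :=
      (contDiff_partialDeriv (m := 0) hφ (by simp) i).continuous
    rw [integral_add (integrable_mul_continuous hb hΩ c2 mu.1)
      (integrable_mul_continuous hb hΩ hφ.continuous (mu.memLp_weakPartial hΩ i))] at this
    simp at this
    linarith
  -- Two integrations by parts turn `∫ h_j φ ν_i` into `-∫ u ∂_j ∂_i φ + ∫ (∂_i ∂_j u) φ`, which is
  -- symmetric in `i` and `j`.
  have sym : ∀ i j, ∀ᵐ x ∂(surfaceMeasure Ω),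
      h j x * outwardNormal Ω x i - h i x * outwardNormal Ω x j = 0 := by
    intro i j
    have ih : ∀ i j, Integrable (fun x => h j x * outwardNormal Ω x i) (surfaceMeasure Ω) := by
      intro i j
      simpa using integrable_trace_mul hd hΩ hb hs (continuous_const (y := (1 : ℝ))) (hh j).1 i
    refine ae_eq_zero_of_integral_contDiff_smul_eq_zero
      ((ih i j).sub (ih j i)).locallyIntegrable fun φ hφ _ => ?_
    have φ1 : ContDiff ℝ 1 φ := hφ.of_le (by simp)
    have φ2 : ContDiff ℝ 2 φ := hφ.of_le (WithTop.coe_le_coe.2 (le_top : (2 : ℕ∞) ≤ ⊤))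
    have e : ∀ i j, ∫ x, h j x * φ x * outwardNormal Ω x i ∂(surfaceMeasure Ω) =
        (- ∫ x in Ω, u x * partialDeriv j (partialDeriv i φ) x) +
          ∫ x in Ω, weakPartial Ω i (weakPartial Ω j u) x * φ x := by
      intro i j
      have φi : ContDiff ℝ 1 (partialDeriv i φ) := contDiff_partialDeriv φ2 (by norm_num) i
      rw [← (hh j).2 i φ φ1, integral_add
        (integrable_mul_continuous hb hΩ φi.continuous (mu.memLp_weakPartial hΩ j))
        (integrable_mul_continuous hb hΩ φ1.continuous (mu.memLp_weakPartial_weakPartial hΩ i j)),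
        zero j _ φi]
    have e' : ∫ x in Ω, weakPartial Ω i (weakPartial Ω j u) x * φ x =
        ∫ x in Ω, weakPartial Ω j (weakPartial Ω i u) x * φ x := by
      refine integral_congr_ae ?_
      filter_upwards [mu.weakPartial_weakPartial_ae_eq hΩ i j,
        mu.weakPartial_weakPartial_ae_eq hΩ j i] with x h1 h2
      rw [h1, h2, add_comm]
    have : ∫ x, φ x • (h j x * outwardNormal Ω x i - h i x * outwardNormal Ω x j)
        ∂(surfaceMeasure Ω) = (∫ x, h j x * φ x * outwardNormal Ω x i ∂(surfaceMeasure Ω))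
          - ∫ x, h i x * φ x * outwardNormal Ω x j ∂(surfaceMeasure Ω) := by
      rw [← integral_sub (integrable_trace_mul hd hΩ hb hs φ1.continuous (hh j).1 i)
        (integrable_trace_mul hd hΩ hb hs φ1.continuous (hh i).1 j)]
      congr 1; ext x; simp only [smul_eq_mul]; ring
    rw [this, e, e, e', partialDeriv_comm φ2 j i, sub_self]
  have hzero : ∀ᵐ x ∂(surfaceMeasure Ω), h j x = 0 := by
    have hn := ae_surfaceMeasure_of_forall (Ω := Ω) fun x hx => norm_outwardNormal hΩ hs hx
    have hsym : ∀ᵐ x ∂(surfaceMeasure Ω), ∀ i j,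
      h j x * outwardNormal Ω x i - h i x * outwardNormal Ω x j = 0 :=
      ae_all_iff.2 fun i => ae_all_iff.2 fun j => sym i j
    filter_upwards [hn, hsym, hc] with x hn hsym hc
    set ν := outwardNormal Ω x with hν
    have hn2 : ∑ i, ν i * ν i = 1 := by
      have := EuclideanSpace.norm_sq_eq ν
      rw [hn] at this
      simp only [Real.norm_eq_abs, sq_abs] at this
      simpa [pow_two] using this.symm
    set lam := ∑ i, h i x * ν i with hlam
    have hj : ∀ j, h j x = lam * ν j := by
      intro j
      calc h j x = ∑ i, h j x * ν i * ν i := by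
            simp only [mul_assoc, ← Finset.mul_sum]; rw [hn2, mul_one]
        _ = ∑ i, h i x * ν i * ν j := Finset.sum_congr rfl fun i _ => by
            have := hsym i j
            rw [sub_eq_zero] at this
            rw [this]; ring
        _ = lam * ν j := by rw [hlam, Finset.sum_mul]
    have h3 : (0 : ℝ) = lam * ∑ i, ∑ j, A x i j * ν j * ν i := by
      rw [Finset.mul_sum]
      simp only [Finset.mul_sum]
      rw [show (0 : ℝ) = (0 : EuclideanSpace ℝ (Fin d) → ℝ) x from rfl, hc]
      refine Finset.sum_congr rfl fun i _ => Finset.sum_congr rfl fun j _ => ?_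
      rw [hj j]; ring
    have h4 := hA x ν
    rw [hn] at h4
    have h5 : lam = 0 := by
      rcases mul_eq_zero.1 h3.symm with h | h
      · exact h
      · rw [h] at h4; norm_num at h4; linarith
    rw [hj j, h5, zero_mul]
  refine ⟨MemLp.zero, fun i φ hφ => ?_⟩
  rw [(hh j).2 i φ hφ]
  refine integral_congr_ae ?_
  filter_upwards [hzero] with x hx
  simp [hx]

end Boundary

end QuasiReversibility

namespace QuasiReversibility

/-! ### The operator in nondivergence form and its bound from `H³` to `L²`. -/

section EllipticOperator

variable {d : ℕ} {Ω : Set (EuclideanSpace ℝ (Fin d))}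

/-! ### The elliptic operator in nondivergence form -/

theorem partialDeriv_mul {f g : EuclideanSpace ℝ (Fin d) → ℝ} {x : EuclideanSpace ℝ (Fin d)}
    (hf : DifferentiableAt ℝ f x) (hg : DifferentiableAt ℝ g x) (i : Fin d) :
    partialDeriv i (fun y => f y * g y) x =
      partialDeriv i f x * g x + f x * partialDeriv i g x := by
  unfold partialDeriv
  rw [fderiv_fun_mul hf hg]
  simp
  ring

theorem IsTrace.hasWeakDeriv_mul (hΩ : IsOpen Ω)
    {a u g : EuclideanSpace ℝ (Fin d) → ℝ} (ha : ContDiff ℝ 1 a) (hu : IsTrace Ω u g) (i : Fin d)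
    (lu : LocallyIntegrableOn u Ω) (lu' : LocallyIntegrableOn (weakPartial Ω i u) Ω) :
    HasWeakDeriv Ω (Pi.single i 1) (fun x => a x * u x)
      (fun x => partialDeriv i a x * u x + a x * weakPartial Ω i u x) := by
  have cda : Continuous (partialDeriv i a) :=
    (contDiff_partialDeriv (m := 0) ha (by simp) i).continuous
  have l1 : LocallyIntegrableOn (fun x => a x * u x) Ω :=
    lu.continuousOn_mul ha.continuous.continuousOn hΩ.isLocallyClosed
  have l2 : LocallyIntegrableOn (fun x => partialDeriv i a x * u x + a x * weakPartial Ω i u x) Ω :=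
    (lu.continuousOn_mul cda.continuousOn hΩ.isLocallyClosed).add
      (lu'.continuousOn_mul ha.continuous.continuousOn hΩ.isLocallyClosed)
  refine ⟨l1, l2, fun φ hφ => ?_⟩
  have φ1 : ContDiff ℝ 1 φ := hφ.1.of_le (by simp)
  have h := hu.integral_eq_zero hΩ (ha.mul φ1) (fun x hx => by
    have : φ x = 0 := by
      by_contra h0
      exact hx (hφ.2.2 (subset_tsupport φ h0))
    simp [this]) i
  rw [hφ.multiDeriv_single, sum_single_one]
  have e : ∫ x in Ω, (u x * partialDeriv i (fun y => a y * φ y) x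
      + weakPartial Ω i u x * (a x * φ x)) =
      (∫ x in Ω, a x * u x * partialDeriv i φ x)
        + ∫ x in Ω, (partialDeriv i a x * u x + a x * weakPartial Ω i u x) * φ x := by
    refine Eq.trans ?_ (integral_add ((hφ.partialDeriv_mem i).integrableOn_mul l1)
      (hφ.integrableOn_mul l2))
    congr 1; ext x
    rw [partialDeriv_mul (ha.differentiable (by simp) x) (φ1.differentiable (by simp) x)]
    ring
  have h' := e.symm.trans h
  linarith

theorem hasWeakDeriv_sum {ι : Type*} (s : Finset ι) {α : Fin d → ℕ}
    {u g : ι → EuclideanSpace ℝ (Fin d) → ℝ} (h : ∀ j ∈ s, HasWeakDeriv Ω α (u j) (g j)) :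
    HasWeakDeriv Ω α (fun x => ∑ j ∈ s, u j x) (fun x => ∑ j ∈ s, g j x) := by
  classical
  induction s using Finset.induction_on with
  | empty =>
    have l0 : LocallyIntegrableOn (fun _ : EuclideanSpace ℝ (Fin d) => (0 : ℝ)) Ω :=
      (locallyIntegrable_const 0).locallyIntegrableOn Ω
    exact ⟨by simpa using l0, by simpa using l0, fun φ _ => by simp⟩
  | insert a s ha ih =>
    simp only [Finset.sum_insert ha]
    simpa using (h a (Finset.mem_insert_self a s)).add_mul
      (ih fun j hj => h j (Finset.mem_insert_of_mem hj)) 1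

/-- The operator `ℒ` with the derivatives of the flux written out. -/
noncomputable def expandedOp (Ω : Set (EuclideanSpace ℝ (Fin d)))
    (A : EuclideanSpace ℝ (Fin d) → Matrix (Fin d) (Fin d) ℝ)
    (b : EuclideanSpace ℝ (Fin d) → EuclideanSpace ℝ (Fin d))
    (c : EuclideanSpace ℝ (Fin d) → ℝ) (v : EuclideanSpace ℝ (Fin d) → ℝ) :
    EuclideanSpace ℝ (Fin d) → ℝ :=
  fun x => ∑ i, ∑ j, (partialDeriv i (fun y => A y i j) x * weakPartial Ω j v x
    + A x i j * weakPartial Ω i (weakPartial Ω j v) x)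
    + ∑ i, b x i * weakPartial Ω i v x + c x * v x

/-- The conormal trace is used only for the traces of `∂_j v` that it carries: they allow the
product rule with the `C¹` entries of `A`. -/
theorem ellipticOp_ae_eq (hΩ : IsOpen Ω)
    {A : EuclideanSpace ℝ (Fin d) → Matrix (Fin d) (Fin d) ℝ}
    {b : EuclideanSpace ℝ (Fin d) → EuclideanSpace ℝ (Fin d)}
    {c : EuclideanSpace ℝ (Fin d) → ℝ} (hA : ∀ i j, ContDiff ℝ 1 (fun x => A x i j))
    {v g : EuclideanSpace ℝ (Fin d) → ℝ} (hv : MemSobolev Ω 3 v) (hg : IsConormalTrace Ω A v g) :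
    ellipticOp Ω A b c v =ᵐ[volume.restrict Ω] expandedOp Ω A b c v := by
  obtain ⟨h, hh, -⟩ := hg
  have key : ∀ i, weakPartial Ω i (fun y => ∑ j, A y i j * weakPartial Ω j v y)
      =ᵐ[volume.restrict Ω] fun x => ∑ j, (partialDeriv i (fun y => A y i j) x * weakPartial Ω j v x
        + A x i j * weakPartial Ω i (weakPartial Ω j v) x) := by
    intro i
    refine (hasWeakDeriv_sum Finset.univ fun j _ => (hh j).hasWeakDeriv_mul hΩ (hA i j) i
      (hv.hasWeakDeriv_weakPartial j).2.1 ?_).weakDeriv_ae_eq hΩ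
    exact (hv.hasWeakDeriv_weakPartial_weakPartial i j).hasWeakDeriv_weakDeriv.2.1
  filter_upwards [Filter.eventually_all.2 key] with x hx
  simp only [ellipticOp, expandedOp, hx]

theorem memLp_expandedOp (hΩ : IsOpen Ω) (hb : Bornology.IsBounded Ω)
    {A : EuclideanSpace ℝ (Fin d) → Matrix (Fin d) (Fin d) ℝ}
    {b : EuclideanSpace ℝ (Fin d) → EuclideanSpace ℝ (Fin d)}
    {c : EuclideanSpace ℝ (Fin d) → ℝ} (hA : ∀ i j, ContDiff ℝ 1 (fun x => A x i j))
    (cb : Continuous b) (cc : Continuous c)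
    {v : EuclideanSpace ℝ (Fin d) → ℝ} (hv : MemSobolev Ω 3 v) :
    MemLp (expandedOp Ω A b c v) 2 (volume.restrict Ω) := by
  refine ((memLp_finsetSum _ fun i _ => memLp_finsetSum _ fun j _ => ?_).add
    (memLp_finsetSum _ fun i _ => ?_)).add (memLp_continuous_mul hb hΩ cc hv.1)
  · exact (memLp_continuous_mul hb hΩ
      (contDiff_partialDeriv (m := 0) (hA i j) (by simp) i).continuous
      (hv.memLp_weakPartial hΩ j)).add (memLp_continuous_mul hb hΩ (hA i j).continuous
      (hv.memLp_weakPartial_weakPartial hΩ i j))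
  · exact memLp_continuous_mul hb hΩ ((EuclideanSpace.proj (𝕜 := ℝ) i).continuous.comp cb)
      (hv.memLp_weakPartial hΩ i)

theorem expandedOp_add_mul (hΩ : IsOpen Ω)
    {A : EuclideanSpace ℝ (Fin d) → Matrix (Fin d) (Fin d) ℝ}
    {b : EuclideanSpace ℝ (Fin d) → EuclideanSpace ℝ (Fin d)}
    {c : EuclideanSpace ℝ (Fin d) → ℝ} {u v : EuclideanSpace ℝ (Fin d) → ℝ}
    (hu : MemSobolev Ω 3 u) (hv : MemSobolev Ω 3 v) (r : ℝ) :
    expandedOp Ω A b c (fun x => u x + r * v x) =ᵐ[volume.restrict Ω]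
      fun x => expandedOp Ω A b c u x + r * expandedOp Ω A b c v x := by
  filter_upwards [Filter.eventually_all.2 fun i => hu.weakPartial_add_mul hΩ hv r i,
    Filter.eventually_all.2 fun i => Filter.eventually_all.2 fun j =>
      hu.weakPartial_weakPartial_add_mul hΩ hv r i j] with x h1 h2
  simp only [expandedOp, h1, h2]
  simp only [mul_add, Finset.sum_add_distrib, Finset.mul_sum, mul_left_comm _ r]
  ring

variable {N : ℕ}

theorem systemResidual_ae_eq (hΩ : IsOpen Ω)
    {A : EuclideanSpace ℝ (Fin d) → Matrix (Fin d) (Fin d) ℝ}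
    {b : EuclideanSpace ℝ (Fin d) → EuclideanSpace ℝ (Fin d)}
    {c : EuclideanSpace ℝ (Fin d) → ℝ} (hA : ∀ i j, ContDiff ℝ 1 (fun x => A x i j))
    (S : Matrix (Fin N) (Fin N) ℝ) {F G U : EuclideanSpace ℝ (Fin d) → Fin N → ℝ}
    (hU : U ∈ admissible Ω A F G) (m : Fin N) :
    (fun x => systemResidual Ω A b c S U x m) =ᵐ[volume.restrict Ω]
      fun x => expandedOp Ω A b c (fun y => U y m) x - ∑ n, S m n * U x n := by
  filter_upwards [ellipticOp_ae_eq (b := b) (c := c) hΩ hA (hU.1 m) (hU.2 m).2] with x hx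
  rw [systemResidual, hx]

theorem memLp_systemResidual (hΩ : IsOpen Ω) (hb : Bornology.IsBounded Ω)
    {A : EuclideanSpace ℝ (Fin d) → Matrix (Fin d) (Fin d) ℝ}
    {b : EuclideanSpace ℝ (Fin d) → EuclideanSpace ℝ (Fin d)}
    {c : EuclideanSpace ℝ (Fin d) → ℝ} (hA : ∀ i j, ContDiff ℝ 1 (fun x => A x i j))
    (cb : Continuous b) (cc : Continuous c)
    (S : Matrix (Fin N) (Fin N) ℝ) {F G U : EuclideanSpace ℝ (Fin d) → Fin N → ℝ}
    (hU : U ∈ admissible Ω A F G) (m : Fin N) :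
    MemLp (fun x => systemResidual Ω A b c S U x m) 2 (volume.restrict Ω) := by
  refine MemLp.ae_eq (systemResidual_ae_eq hΩ hA S hU m).symm
    ((memLp_expandedOp hΩ hb hA cb cc (hU.1 m)).sub (memLp_finsetSum _ fun n _ => ?_))
  exact (hU.1 n).1.const_mul _

theorem systemResidual_add_mul (hd : 0 < d) (hΩ : IsOpen Ω) (hb : Bornology.IsBounded Ω)
    (hs : HasSmoothBoundary Ω)
    {A : EuclideanSpace ℝ (Fin d) → Matrix (Fin d) (Fin d) ℝ}
    {b : EuclideanSpace ℝ (Fin d) → EuclideanSpace ℝ (Fin d)}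
    {c : EuclideanSpace ℝ (Fin d) → ℝ} (hA : ∀ i j, ContDiff ℝ 1 (fun x => A x i j))
    (S : Matrix (Fin N) (Fin N) ℝ) {F G F' G' U V : EuclideanSpace ℝ (Fin d) → Fin N → ℝ}
    (hU : U ∈ admissible Ω A F G) (hV : V ∈ admissible Ω A F' G') (r : ℝ) (m : Fin N) :
    (fun x => systemResidual Ω A b c S (fun x m => U x m + r * V x m) x m)
      =ᵐ[volume.restrict Ω]
        fun x => systemResidual Ω A b c S U x m + r * systemResidual Ω A b c S V x m := by
  filter_upwards [systemResidual_ae_eq (b := b) (c := c) hΩ hA S hU m,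
    systemResidual_ae_eq (b := b) (c := c) hΩ hA S hV m,
    systemResidual_ae_eq (b := b) (c := c) hΩ hA S (admissible_add_mul hd hΩ hb hs hU hV r) m,
    expandedOp_add_mul (A := A) (b := b) (c := c) hΩ (hU.1 m) (hV.1 m) r] with x h1 h2 h3 h4
  rw [h1, h2, h3, h4]
  simp only [mul_add, Finset.sum_add_distrib, mul_sub, Finset.mul_sum]
  rw [Finset.sum_congr rfl fun n _ => show S m n * (r * V x n) = r * (S m n * V x n) by ring]
  ring

theorem sq_le_sq_of_abs_le {a b : ℝ} (h : |a| ≤ b) : a ^ 2 ≤ b ^ 2 := by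
  rw [← sq_abs]
  exact pow_le_pow_left₀ (abs_nonneg _) h 2

theorem sum_mul_sq_le {n : ℕ} {k : ℝ} (f g : Fin n → ℝ) (hf : ∀ i, |f i| ≤ k) :
    (∑ i, f i * g i) ^ 2 ≤ n * ∑ i, k ^ 2 * g i ^ 2 := by
  have h := sq_sum_le_card_mul_sum_sq (s := (Finset.univ : Finset (Fin n)))
    (f := fun i => f i * g i)
  rw [Finset.card_univ, Fintype.card_fin] at h
  refine h.trans (mul_le_mul_of_nonneg_left (Finset.sum_le_sum fun i _ => ?_) (by positivity))
  rw [mul_pow]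
  exact mul_le_mul_of_nonneg_right (sq_le_sq_of_abs_le (hf i)) (sq_nonneg _)

/-- Cauchy–Schwarz on four groups of terms: the expanded divergence, the drift, the potential and
the coupling by `S`. -/
theorem expandedOp_sq_le {M K L : ℝ} {x : EuclideanSpace ℝ (Fin d)}
    {A : EuclideanSpace ℝ (Fin d) → Matrix (Fin d) (Fin d) ℝ}
    {b : EuclideanSpace ℝ (Fin d) → EuclideanSpace ℝ (Fin d)}
    {c : EuclideanSpace ℝ (Fin d) → ℝ}
    (hM : ∀ i j, |A x i j| ≤ M ∧ ∀ k, |partialDeriv k (fun y => A y i j) x| ≤ M)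
    (hbc : ‖b x‖ ≤ K ∧ |c x| ≤ K)
    (S : Matrix (Fin N) (Fin N) ℝ) (hS : ∀ m n, |S m n| ≤ L)
    (U : EuclideanSpace ℝ (Fin d) → Fin N → ℝ) (m : Fin N) :
    (expandedOp Ω A b c (fun y => U y m) x - ∑ n, S m n * U x n) ^ 2 ≤
      4 * (d * ∑ _i : Fin d, ((2 * d) * ∑ j, M ^ 2 * (weakPartial Ω j (fun y => U y m) x) ^ 2)
        + d * ∑ i, ((2 * d) * ∑ j, M ^ 2 *
            (weakPartial Ω i (weakPartial Ω j (fun y => U y m)) x) ^ 2)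
        + d * ∑ i, K ^ 2 * (weakPartial Ω i (fun y => U y m) x) ^ 2
        + K ^ 2 * (U x m) ^ 2 + N * ∑ n, L ^ 2 * (U x n) ^ 2) := by
  have t1 : (∑ i, ∑ j, (partialDeriv i (fun y => A y i j) x * weakPartial Ω j (fun y => U y m) x
      + A x i j * weakPartial Ω i (weakPartial Ω j (fun y => U y m)) x)) ^ 2 ≤
      d * ∑ _i : Fin d, ((2 * d) * ∑ j, M ^ 2 * (weakPartial Ω j (fun y => U y m) x) ^ 2)
        + d * ∑ i, ((2 * d) * ∑ j, M ^ 2 *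
            (weakPartial Ω i (weakPartial Ω j (fun y => U y m)) x) ^ 2) := by
    have h := sq_sum_le_card_mul_sum_sq (s := (Finset.univ : Finset (Fin d)))
      (f := fun i => ∑ j, (partialDeriv i (fun y => A y i j) x * weakPartial Ω j (fun y => U y m) x
      + A x i j * weakPartial Ω i (weakPartial Ω j (fun y => U y m)) x))
    rw [Finset.card_univ, Fintype.card_fin] at h
    refine h.trans ?_
    rw [← mul_add, ← Finset.sum_add_distrib]
    refine mul_le_mul_of_nonneg_left (Finset.sum_le_sum fun i _ => ?_) (by positivity)
    rw [Finset.sum_add_distrib]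
    have h1 := sum_mul_sq_le (fun j => partialDeriv i (fun y => A y i j) x)
      (fun j => weakPartial Ω j (fun y => U y m) x) (fun j => (hM i j).2 i)
    have h2 := sum_mul_sq_le (fun j => A x i j)
      (fun j => weakPartial Ω i (weakPartial Ω j (fun y => U y m)) x) (fun j => (hM i j).1)
    refine add_sq_le.trans ?_
    linarith
  have t2 := sum_mul_sq_le (fun i => b x i) (fun i => weakPartial Ω i (fun y => U y m) x)
    (fun i => (PiLp.norm_apply_le (b x) i).trans hbc.1)
  have t3 : (c x * U x m) ^ 2 ≤ K ^ 2 * (U x m) ^ 2 := by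
    rw [mul_pow]
    exact mul_le_mul_of_nonneg_right (sq_le_sq_of_abs_le hbc.2) (sq_nonneg _)
  have t4 := sum_mul_sq_le (fun n => S m n) (fun n => U x n) (fun n => hS m n)
  have four : ∀ a b c d : ℝ, (a + b + c - d) ^ 2 ≤ 4 * (a ^ 2 + b ^ 2 + c ^ 2 + d ^ 2) := by
    intro a b c d
    nlinarith [sq_nonneg (a - b), sq_nonneg (a - c), sq_nonneg (a + d), sq_nonneg (b - c),
      sq_nonneg (b + d), sq_nonneg (c + d)]
  refine (four _ _ _ _).trans (mul_le_mul_of_nonneg_left ?_ (by norm_num))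
  linarith

/-- An `L²` bound for the residual by the norm of `H³`. -/
theorem integral_systemResidual_sq_le (hΩ : IsOpen Ω) (hb : Bornology.IsBounded Ω) {M K L : ℝ}
    {A : EuclideanSpace ℝ (Fin d) → Matrix (Fin d) (Fin d) ℝ}
    {b : EuclideanSpace ℝ (Fin d) → EuclideanSpace ℝ (Fin d)}
    {c : EuclideanSpace ℝ (Fin d) → ℝ} (hA : ∀ i j, ContDiff ℝ 1 (fun x => A x i j))
    (cb : Continuous b) (cc : Continuous c)
    (hM : C1NormLE Ω A M) (hbc : ∀ x ∈ closure Ω, ‖b x‖ ≤ K ∧ |c x| ≤ K)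
    (S : Matrix (Fin N) (Fin N) ℝ) (hS : ∀ m n, |S m n| ≤ L)
    {F G U : EuclideanSpace ℝ (Fin d) → Fin N → ℝ}
    (hU : U ∈ admissible Ω A F G) :
    ∫ x in Ω, ∑ m, (systemResidual Ω A b c S U x m) ^ 2 ≤
      N * (4 * (d * (d * ((2 * d) * (d * M ^ 2))) + d * (d * ((2 * d) * (d * M ^ 2)))
        + d * (d * K ^ 2) + K ^ 2 + N * (N * L ^ 2))) * h3NormSq Ω U := by
  set H := h3NormSq Ω U with hH
  rw [integral_finsetSum _ fun m _ => (memLp_systemResidual hΩ hb hA cb cc S hU m).integrable_sq,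
    mul_assoc]
  have hone : ∀ m, ∫ x in Ω, (systemResidual Ω A b c S U x m) ^ 2 ≤
      (4 * (d * (d * ((2 * d) * (d * M ^ 2))) + d * (d * ((2 * d) * (d * M ^ 2)))
        + d * (d * K ^ 2) + K ^ 2 + N * (N * L ^ 2))) * H := by
    intro m
    have i1 : ∀ j, Integrable (fun x => (weakPartial Ω j (fun y => U y m) x) ^ 2)
      (volume.restrict Ω) := fun j => ((hU.1 m).memLp_weakPartial hΩ j).integrable_sq
    have i2 : ∀ i j, Integrable (fun x => (weakPartial Ω i (weakPartial Ω j (fun y => U y m)) x) ^ 2)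
      (volume.restrict Ω) := fun i j =>
        ((hU.1 m).memLp_weakPartial_weakPartial hΩ i j).integrable_sq
    have i0 : ∀ n, Integrable (fun x => (U x n) ^ 2) (volume.restrict Ω) := fun n =>
      (hU.1 n).1.integrable_sq
    have j1 : Integrable (fun x => (d : ℝ) * ∑ _i : Fin d, ((2 * d : ℝ) * ∑ j, M ^ 2 *
        (weakPartial Ω j (fun y => U y m) x) ^ 2)) (volume.restrict Ω) :=
      (integrable_finsetSum _ fun i _ => (integrable_finsetSum _ fun j _ =>
        (i1 j).const_mul _).const_mul _).const_mul _
    have j2 : Integrable (fun x => (d : ℝ) * ∑ i, ((2 * d : ℝ) * ∑ j, M ^ 2 *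
        (weakPartial Ω i (weakPartial Ω j (fun y => U y m)) x) ^ 2)) (volume.restrict Ω) :=
      (integrable_finsetSum _ fun i _ => (integrable_finsetSum _ fun j _ =>
        (i2 i j).const_mul _).const_mul _).const_mul _
    have j3 : Integrable (fun x => (d : ℝ) * ∑ i, K ^ 2 *
        (weakPartial Ω i (fun y => U y m) x) ^ 2) (volume.restrict Ω) :=
      (integrable_finsetSum _ fun i _ => (i1 i).const_mul _).const_mul _
    have j4 : Integrable (fun x => (N : ℝ) * ∑ n, L ^ 2 * (U x n) ^ 2) (volume.restrict Ω) :=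
      (integrable_finsetSum _ fun i _ => (i0 i).const_mul _).const_mul _
    have j0 : Integrable (fun x => K ^ 2 * (U x m) ^ 2) (volume.restrict Ω) := (i0 m).const_mul _
    have hle : ∫ x in Ω, (systemResidual Ω A b c S U x m) ^ 2 ≤ ∫ x in Ω,
      4 * (d * ∑ _i : Fin d, ((2 * d) * ∑ j, M ^ 2 * (weakPartial Ω j (fun y => U y m) x) ^ 2)
        + d * ∑ i, ((2 * d) * ∑ j, M ^ 2 *
            (weakPartial Ω i (weakPartial Ω j (fun y => U y m)) x) ^ 2)
        + d * ∑ i, K ^ 2 * (weakPartial Ω i (fun y => U y m) x) ^ 2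
        + K ^ 2 * (U x m) ^ 2 + N * ∑ n, L ^ 2 * (U x n) ^ 2) := by
      refine integral_mono_ae (memLp_systemResidual hΩ hb hA cb cc S hU m).integrable_sq
        (((((j1.add j2).add j3).add j0).add j4).const_mul 4) ?_
      filter_upwards [systemResidual_ae_eq (b := b) (c := c) hΩ hA S hU m,
        ae_restrict_mem hΩ.measurableSet] with x hx hxΩ
      rw [hx]
      exact expandedOp_sq_le (fun i j => hM x (subset_closure hxΩ) i j)
        (hbc x (subset_closure hxΩ)) S hS U m
    refine hle.trans ?_
    have k1 : ∀ j, ∫ x in Ω, (weakPartial Ω j (fun y => U y m) x) ^ 2 ≤ H := fun j =>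
      integral_weakPartial_sq_le_h3NormSq U m j
    have k2 : ∀ i j, ∫ x in Ω, (weakPartial Ω i (weakPartial Ω j (fun y => U y m)) x) ^ 2 ≤ H :=
      fun i j => integral_weakPartial_weakPartial_sq_le_h3NormSq hΩ hU.1 m i j
    have k0 : ∀ n, ∫ x in Ω, (U x n) ^ 2 ≤ H := fun n =>
      MemSobolev.integral_sq_le_h3NormSq hΩ hU.1 n
    have sumle : ∀ (n : ℕ) (a B : ℝ) (f : Fin n → EuclideanSpace ℝ (Fin d) → ℝ), 0 ≤ a →
        (∀ i, Integrable (f i) (volume.restrict Ω)) → (∀ i, ∫ x in Ω, f i x ≤ B) →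
        ∫ x in Ω, a * ∑ i, f i x ≤ a * (n * B) := by
      intro n a B f ha hf hB
      rw [integral_const_mul, integral_finsetSum _ fun i _ => hf i]
      refine mul_le_mul_of_nonneg_left ?_ ha
      refine (Finset.sum_le_sum fun i _ => hB i).trans ?_
      simp
    have cle : ∀ (a B : ℝ) (f : EuclideanSpace ℝ (Fin d) → ℝ), 0 ≤ a →
        ∫ x in Ω, f x ≤ B → ∫ x in Ω, a * f x ≤ a * B := by
      intro a B f ha hB
      rw [integral_const_mul]
      exact mul_le_mul_of_nonneg_left hB ha
    have s1 := sumle d d ((2 * d) * (d * (M ^ 2 * H))) _ (by positivity)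
      (fun _ => (integrable_finsetSum _ fun j _ => (i1 j).const_mul (M ^ 2)).const_mul (2 * d : ℝ))
      (fun _ => sumle d (2 * d) (M ^ 2 * H) _ (by positivity) (fun j => (i1 j).const_mul (M ^ 2))
        (fun j => cle _ _ _ (by positivity) (k1 j)))
    have s2 := sumle d d ((2 * d) * (d * (M ^ 2 * H))) _ (by positivity)
      (fun i => (integrable_finsetSum _ fun j _ => (i2 i j).const_mul (M ^ 2)).const_mul
        (2 * d : ℝ))
      (fun i => sumle d (2 * d) (M ^ 2 * H) _ (by positivity) (fun j => (i2 i j).const_mul (M ^ 2))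
        (fun j => cle _ _ _ (by positivity) (k2 i j)))
    have s3 := sumle d d (K ^ 2 * H) _ (by positivity) (fun j => (i1 j).const_mul (K ^ 2))
        (fun j => cle _ _ _ (by positivity) (k1 j))
    have s4 := sumle N N (L ^ 2 * H) _ (by positivity) (fun j => (i0 j).const_mul (L ^ 2))
        (fun j => cle _ _ _ (by positivity) (k0 j))
    have s0 := cle (K ^ 2) H _ (by positivity) (k0 m)
    rw [integral_const_mul, integral_add (((j1.fun_add j2).fun_add j3).fun_add j0) j4,
      integral_add ((j1.fun_add j2).fun_add j3) j0, integral_add (j1.fun_add j2) j3,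
      integral_add j1 j2]
    linarith
  refine (Finset.sum_le_sum fun m _ => hone m).trans ?_
  simp

end EllipticOperator

end QuasiReversibility

namespace QuasiReversibility

/-! ### Positivity of the quadratic form behind the Carleman estimate. -/

section Carleman

/-! ### The quadratic form in the Carleman estimate -/

theorem abs_sum_mul_le {d : ℕ} {k : ℝ} {f g : Fin d → ℝ} (hf : ∀ i, |f i| ≤ k) :
    |∑ i, f i * g i| ≤ k * ∑ i, |g i| := by
  refine (Finset.abs_sum_le_sum_abs _ _).trans ?_
  rw [Finset.mul_sum]
  refine Finset.sum_le_sum fun i _ => ?_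
  rw [abs_mul]
  exact mul_le_mul_of_nonneg_right (hf i) (abs_nonneg _)

theorem abs_sum_le_card_mul {d : ℕ} {k : ℝ} {f : Fin d → ℝ} (hf : ∀ i, |f i| ≤ k) :
    |∑ i, f i| ≤ d * k := by
  refine (Finset.abs_sum_le_sum_abs _ _).trans ((Finset.sum_le_sum fun i _ => hf i).trans ?_)
  simp

/-- Here `Y = |∇v|²`, `X` is the `ℓ¹` norm of `∇v`, `β = a_zz`, `fl = (A∇v)_z`, `E = A∇v · ∇v`, and
the `Z_i` collect the terms with derivatives of `A`. Only `s β E` and `s β²` carry a favourable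
factor `s`, and `2 s fl²` is nonnegative. A large `s` beats the `Z_i`, and a large `lam` beats the
mixed term in `v` and `∇v`, which has no factor `lam`. -/
theorem carleman_scalar_bound {d μ M s lam p v X Y β fl Z1 Z2 Z3 Z4 Z5 E : ℝ} (hd0 : 0 < d)
    (hμ : 0 < μ) (hs : 0 < s) (hp : 0 < p) (hM : 0 ≤ M)
    (hsμ : 4 * d ^ 2 * M ^ 2 + 2 * d * M ^ 2 + 1 ≤ s * μ ^ 2)
    (hlam : d * (2 * s ^ 2 * M ^ 2 + 2 * s * d * M ^ 2) ^ 2 ≤ lam ^ 2 * p ^ 2)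
    (hY0 : 0 ≤ Y) (hXY : X ^ 2 ≤ d * Y) (hβμ : μ ≤ β) (hβM : |β| ≤ M)
    (hfl : |fl| ≤ M * X) (b1 : |Z1| ≤ d * (M ^ 2 * X ^ 2)) (b2 : |Z2| ≤ d * M)
    (b3 : |Z3| ≤ d * (M ^ 2 * X)) (b4 : |Z4| ≤ d * M ^ 2) (b5 : |Z5| ≤ d * (M ^ 2 * X ^ 2))
    (bE : |E| ≤ M * X ^ 2) (hEl : μ * Y ≤ E) :
    p * Y / 2 + lam ^ 2 * p ^ 3 * v ^ 2 / 2 ≤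
      p * (2 * (s * fl ^ 2 + Z1) + (s * β - Z2) * E - Z5)
        + v * (2 * s * p * (s * β * fl + Z3))
        + lam ^ 2 * v ^ 2 * p ^ 3 * (s * β ^ 2 + Z4 + β * Z2) := by
  set c := 2 * s ^ 2 * M ^ 2 + 2 * s * d * M ^ 2 with hc
  have g1 : s * μ ^ 2 * Y ≤ s * β * E := by
    have h1 : μ * (μ * Y) ≤ β * E := mul_le_mul hβμ hEl (by positivity) (hμ.le.trans hβμ)
    have h2 := mul_le_mul_of_nonneg_left h1 hs.le
    linarith
  have g2 : Z2 * E ≤ d * M ^ 2 * X ^ 2 := by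
    have : |Z2 * E| ≤ (d * M) * (M * X ^ 2) := by
      rw [abs_mul]
      exact mul_le_mul b2 bE (abs_nonneg _) (by positivity)
    have := (le_abs_self _).trans this
    linarith
  have g3 : |s * β * fl + Z3| ≤ s * M ^ 2 * X + d * (M ^ 2 * X) := by
    refine (abs_add_le _ _).trans (add_le_add ?_ b3)
    rw [abs_mul, abs_mul, abs_of_pos hs, mul_assoc, mul_assoc]
    refine mul_le_mul_of_nonneg_left ?_ hs.le
    rw [show M ^ 2 * X = M * (M * X) by ring]
    exact mul_le_mul hβM hfl (abs_nonneg _) hM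
  have g3' : -(p * (c * (|v| * X))) ≤ v * (2 * s * p * (s * β * fl + Z3)) := by
    have h1 : |v * (2 * s * p * (s * β * fl + Z3))| ≤
        |v| * (2 * s * p * (s * M ^ 2 * X + d * (M ^ 2 * X))) := by
      rw [abs_mul, abs_mul, abs_of_pos (show 0 < 2 * s * p by positivity)]
      exact mul_le_mul_of_nonneg_left (mul_le_mul_of_nonneg_left g3 (by positivity)) (abs_nonneg _)
    have h2 := neg_abs_le (v * (2 * s * p * (s * β * fl + Z3)))
    have h3 : |v| * (2 * s * p * (s * M ^ 2 * X + d * (M ^ 2 * X))) = p * (c * (|v| * X)) := by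
      rw [hc]; ring
    linarith
  -- Young's inequality, weighted so that half of `Y` is spent; `X² ≤ d Y` accounts for the factor
  -- `d` in `hlam`.
  have g4 : c * (|v| * X) ≤ Y / 2 + lam ^ 2 * p ^ 2 * v ^ 2 / 2 := by
    have h1 : 2 * d * (c * (|v| * X)) ≤ X ^ 2 + d * (d * c ^ 2 * v ^ 2) := by
      have h := sq_nonneg (X - d * c * |v|)
      have h2 : (X - d * c * |v|) ^ 2 = X ^ 2 - 2 * d * (c * (|v| * X)) + d * (d * c ^ 2 * |v| ^ 2) := by
        ring
      rw [h2, sq_abs] at h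
      linarith
    have h2 : d * c ^ 2 * v ^ 2 ≤ lam ^ 2 * p ^ 2 * v ^ 2 :=
      mul_le_mul_of_nonneg_right hlam (sq_nonneg _)
    have h3 := mul_le_mul_of_nonneg_left h2 hd0.le
    have h4 : d * (2 * (c * (|v| * X))) ≤ d * (Y + lam ^ 2 * p ^ 2 * v ^ 2) := by linarith
    have := le_of_mul_le_mul_left h4 hd0
    linarith
  -- The summand `2 d M²` in `hsμ` pays for `Z4` and `β Z2`, each at most `d M²`.
  have g5 : 1 ≤ s * β ^ 2 + Z4 + β * Z2 := by
    have h1 : |β * Z2| ≤ M * (d * M) := by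
      rw [abs_mul]
      exact mul_le_mul hβM b2 (abs_nonneg _) hM
    have h2 := (abs_le.1 h1).1
    have h3 := (abs_le.1 b4).1
    have h4 : s * μ ^ 2 ≤ s * β ^ 2 :=
      mul_le_mul_of_nonneg_left (pow_le_pow_left₀ hμ.le hβμ 2) hs.le
    have h5 : 0 ≤ 4 * d ^ 2 * M ^ 2 := by positivity
    have h6 : M * (d * M) = d * M ^ 2 := by ring
    linarith
  -- The errors `2 Z1`, `Z2 E` and `Z5` amount to at most `4 d M² X² ≤ 4 d² M² Y`, the first summand
  -- in `hsμ`; the summand `1` leaves `Y` over.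
  have g6 : Y ≤ s * β * E - 4 * (d * M ^ 2 * X ^ 2) := by
    have h2 : d * M ^ 2 * X ^ 2 ≤ d * M ^ 2 * (d * Y) :=
      mul_le_mul_of_nonneg_left hXY (by positivity)
    have h3 : (4 * d ^ 2 * M ^ 2 + 2 * d * M ^ 2 + 1) * Y ≤ s * μ ^ 2 * Y :=
      mul_le_mul_of_nonneg_right hsμ hY0
    have h4 : 0 ≤ 2 * d * M ^ 2 * Y := by positivity
    have h5 : (4 * d ^ 2 * M ^ 2 + 2 * d * M ^ 2 + 1) * Y =
      4 * (d * M ^ 2 * (d * Y)) + 2 * d * M ^ 2 * Y + Y := by ring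
    linarith
  have g7 : 0 ≤ s * fl ^ 2 := by positivity
  have z1 := (abs_le.1 b1).1
  have z5 := (abs_le.1 b5).2
  have f1 : Y - (Y / 2 + lam ^ 2 * p ^ 2 * v ^ 2 / 2) ≤
      2 * (s * fl ^ 2 + Z1) + (s * β - Z2) * E - Z5 - c * (|v| * X) := by
    have h1 : (s * β - Z2) * E = s * β * E - Z2 * E := by ring
    linarith
  have f2 := mul_le_mul_of_nonneg_left f1 hp.le
  have f3 : lam ^ 2 * v ^ 2 * p ^ 3 * 1 ≤ lam ^ 2 * v ^ 2 * p ^ 3 * (s * β ^ 2 + Z4 + β * Z2) :=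
    mul_le_mul_of_nonneg_left g5 (by positivity)
  have f4 : p * (Y - (Y / 2 + lam ^ 2 * p ^ 2 * v ^ 2 / 2)) + lam ^ 2 * v ^ 2 * p ^ 3 * 1 =
    p * Y / 2 + lam ^ 2 * p ^ 3 * v ^ 2 / 2 := by ring
  rw [← f4]
  linarith

/-- The lower bound for the quadratic form arising from the commutator, with `a` the matrix, `da`
its gradient, `V` and `v` the gradient and the value of the function. -/
theorem carleman_quadratic_lower_bound {d : ℕ} (z : Fin d) {μ M s lam p v : ℝ} (hμ : 0 < μ)
    (hs : 0 < s) (hp : 0 < p) (hM : 0 ≤ M)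
    (hsμ : 4 * d ^ 2 * M ^ 2 + 2 * d * M ^ 2 + 1 ≤ s * μ ^ 2)
    (hlam : d * (2 * s ^ 2 * M ^ 2 + 2 * s * d * M ^ 2) ^ 2 ≤ lam ^ 2 * p ^ 2)
    (a : Fin d → Fin d → ℝ) (da : Fin d → Fin d → Fin d → ℝ) (V : Fin d → ℝ)
    (ha : ∀ i j, |a i j| ≤ M) (hda : ∀ i j k, |da i j k| ≤ M)
    (hell : ∀ ξ : Fin d → ℝ, μ * ∑ i, ξ i ^ 2 ≤ ∑ i, (∑ j, a i j * ξ j) * ξ i)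
    (hsym : ∀ i j, a i j = a j i)
    (B : Fin d → ℝ) (hB : ∀ i, B i = p * a i z)
    (dB : Fin d → Fin d → ℝ) (hdB : ∀ i k, dB i k = p * ((if i = z then s else 0) * a k z + da i k z))
    (dα : Fin d → ℝ)
    (hdα : ∀ i, dα i = (if i = z then 2 * s else 0) * p ^ 2 * a z z + p ^ 2 * da i z z)
    (dθ : Fin d → ℝ)
    (hdθ : ∀ i, dθ i = 2 * s * p * ((if i = z then s else 0) * a z z + da i z z)) :
    p * (∑ i, V i ^ 2) / 2 + lam ^ 2 * p ^ 3 * v ^ 2 / 2 ≤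
      - (lam ^ 2 * (p ^ 2 * a z z)) * (2 * s * p * a z z) * v ^ 2
      + 2 * ∑ i, (∑ j, a i j * V j) * ∑ k, dB i k * V k
      + (2 * s * p * a z z - ∑ i, dB i i) * ∑ i, (∑ j, a i j * V j) * V i
      + v * ∑ i, (∑ j, a i j * V j) * dθ i
      - ∑ i, B i * ∑ j, ∑ k, da i j k * V k * V j
      + lam ^ 2 * (∑ i, (dα i * B i + p ^ 2 * a z z * dB i i)) * v ^ 2 := by
  set X := ∑ i, |V i| with hX
  set Y := ∑ i, V i ^ 2 with hY
  set fl : Fin d → ℝ := fun i => ∑ j, a i j * V j with hfl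
  set β := a z z with hβ
  have hX0 : 0 ≤ X := Finset.sum_nonneg fun _ _ => abs_nonneg _
  have hY0 : 0 ≤ Y := Finset.sum_nonneg fun _ _ => sq_nonneg _
  have hXY : X ^ 2 ≤ d * Y := by
    have := sq_sum_le_card_mul_sum_sq (s := (Finset.univ : Finset (Fin d))) (f := fun i => |V i|)
    simpa using this
  have hfl_le : ∀ i, |fl i| ≤ M * X := fun i => abs_sum_mul_le (ha i)
  have hsum_le : ∀ f : Fin d → ℝ, (∀ i, |f i| ≤ M) → |∑ i, f i * V i| ≤ M * X :=
    fun f hf => abs_sum_mul_le hf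
  have hMX : 0 ≤ M * X := mul_nonneg hM hX0
  -- Ellipticity in the direction of the `z`-th coordinate.
  have hβμ : μ ≤ β := by
    have := hell (Pi.single z 1)
    simpa [Pi.single_apply, Finset.sum_ite_eq', ite_pow] using this
  have hβM : |β| ≤ M := ha z z
  -- the error terms
  set Z1 := ∑ i, fl i * ∑ k, da i k z * V k with hZ1
  set Z2 := ∑ i, da i i z with hZ2
  set Z3 := ∑ i, fl i * da i z z with hZ3
  set Z4 := ∑ i, da i z z * a i z with hZ4
  set Z5 := ∑ i, a i z * ∑ j, ∑ k, da i j k * V k * V j with hZ5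
  set E := ∑ i, fl i * V i with hE
  have b1 : |Z1| ≤ d * (M ^ 2 * X ^ 2) := abs_sum_le_card_mul fun i => by
    rw [abs_mul, show M ^ 2 * X ^ 2 = (M * X) * (M * X) by ring]
    exact mul_le_mul (hfl_le i) (hsum_le _ fun k => hda i k z) (abs_nonneg _) hMX
  have b2 : |Z2| ≤ d * M := abs_sum_le_card_mul fun i => hda i i z
  have b3 : |Z3| ≤ d * (M ^ 2 * X) := abs_sum_le_card_mul fun i => by
    rw [abs_mul, show M ^ 2 * X = (M * X) * M by ring]
    exact mul_le_mul (hfl_le i) (hda i z z) (abs_nonneg _) hMX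
  have b4 : |Z4| ≤ d * M ^ 2 := abs_sum_le_card_mul fun i => by
    rw [abs_mul, pow_two]
    exact mul_le_mul (hda i z z) (ha i z) (abs_nonneg _) hM
  have b5 : |Z5| ≤ d * (M ^ 2 * X ^ 2) := abs_sum_le_card_mul fun i => by
    rw [abs_mul, show M ^ 2 * X ^ 2 = M * (M * X * X) by ring]
    refine mul_le_mul (ha i z) ?_ (abs_nonneg _) hM
    simp only [← Finset.sum_mul]
    exact abs_sum_mul_le fun j => hsum_le _ (hda i j)
  have bE : |E| ≤ M * X ^ 2 := by
    rw [show M * X ^ 2 = M * X * X by ring]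
    exact abs_sum_mul_le hfl_le
  have hEl : μ * Y ≤ E := hell V
  -- rewriting the terms
  have e1 : ∑ i, fl i * ∑ k, dB i k * V k = p * (s * fl z ^ 2 + Z1) := by
    have h1 : ∀ i, fl i * ∑ k, dB i k * V k =
        (if i = z then p * (s * (fl i * fl z)) else 0) + p * (fl i * ∑ k, da i k z * V k) := by
      intro i
      have h2 : ∑ k, dB i k * V k = p * ((if i = z then s else 0) * fl z + ∑ k, da i k z * V k) := by
        rw [hfl]
        simp only [Finset.mul_sum, mul_add, ← Finset.sum_add_distrib]
        refine Finset.sum_congr rfl fun k _ => ?_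
        rw [hdB, hsym k z]; ring
      rw [h2]
      split_ifs <;> ring
    simp only [h1, Finset.sum_add_distrib, Finset.sum_ite_eq', Finset.mem_univ, if_true,
      ← Finset.mul_sum]
    ring
  have e2 : ∑ i, dB i i = p * (s * β + Z2) := by
    have h1 : ∀ i, dB i i = (if i = z then p * (s * a i z) else 0) + p * da i i z := by
      intro i
      rw [hdB]
      split_ifs <;> ring
    simp only [h1, Finset.sum_add_distrib, Finset.sum_ite_eq', Finset.mem_univ, if_true,
      ← Finset.mul_sum]
    ring
  have e3 : ∑ i, fl i * dθ i = 2 * s * p * (s * β * fl z + Z3) := by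
    have h1 : ∀ i, fl i * dθ i = (if i = z then 2 * s * p * (s * β * fl i) else 0)
        + 2 * s * p * (fl i * da i z z) := by
      intro i
      rw [hdθ]
      split_ifs <;> ring
    simp only [h1, Finset.sum_add_distrib, Finset.sum_ite_eq', Finset.mem_univ, if_true,
      ← Finset.mul_sum]
    ring
  have e4 : ∑ i, B i * ∑ j, ∑ k, da i j k * V k * V j = p * Z5 := by
    rw [hZ5, Finset.mul_sum]
    refine Finset.sum_congr rfl fun i _ => ?_
    rw [hB]; ring
  have e5 : ∑ i, (dα i * B i + p ^ 2 * β * dB i i) =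
      p ^ 3 * (2 * s * β ^ 2 + Z4 + β * (s * β + Z2)) := by
    rw [Finset.sum_add_distrib, ← Finset.mul_sum, e2]
    have h1 : ∀ i, dα i * B i = (if i = z then 2 * s * p ^ 3 * β * a i z else 0)
        + p ^ 3 * (da i z z * a i z) := by
      intro i
      rw [hdα, hB]
      split_ifs <;> ring
    simp only [h1, Finset.sum_add_distrib, Finset.sum_ite_eq', Finset.mem_univ, if_true,
      ← Finset.mul_sum]
    ring
  rw [e1, e2, e3, e4, e5]
  set c := 2 * s ^ 2 * M ^ 2 + 2 * s * d * M ^ 2 with hc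
  have hd0 : (0 : ℝ) < d := by
    have : 0 < d := z.pos
    exact_mod_cast this
  have h := carleman_scalar_bound (v := v) hd0 hμ hs hp hM hsμ hlam hY0 hXY hβμ hβM (hfl_le z)
    b1 b2 b3 b4 b5 bE hEl
  refine h.trans (le_of_eq ?_)
  ring

end Carleman

end QuasiReversibility

namespace QuasiReversibility

/-! ### The Rellich identity and conjugation with the weight. -/

section Rellich

variable {d : ℕ}

/-! ### The Rellich identity -/

theorem partialDeriv_add {f g : EuclideanSpace ℝ (Fin d) → ℝ} {x : EuclideanSpace ℝ (Fin d)}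
    (hf : DifferentiableAt ℝ f x) (hg : DifferentiableAt ℝ g x) (i : Fin d) :
    partialDeriv i (fun y => f y + g y) x = partialDeriv i f x + partialDeriv i g x := by
  unfold partialDeriv
  rw [fderiv_fun_add hf hg]
  simp

theorem partialDeriv_sub {f g : EuclideanSpace ℝ (Fin d) → ℝ} {x : EuclideanSpace ℝ (Fin d)}
    (hf : DifferentiableAt ℝ f x) (hg : DifferentiableAt ℝ g x) (i : Fin d) :
    partialDeriv i (fun y => f y - g y) x = partialDeriv i f x - partialDeriv i g x := by
  unfold partialDeriv
  rw [fderiv_fun_sub hf hg]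
  simp

theorem partialDeriv_const_mul {f : EuclideanSpace ℝ (Fin d) → ℝ} {x : EuclideanSpace ℝ (Fin d)}
    (hf : DifferentiableAt ℝ f x) (c : ℝ) (i : Fin d) :
    partialDeriv i (fun y => c * f y) x = c * partialDeriv i f x := by
  unfold partialDeriv
  rw [fderiv_const_mul hf]
  simp

theorem partialDeriv_sum {ι : Type*} {s : Finset ι} {f : ι → EuclideanSpace ℝ (Fin d) → ℝ}
    {x : EuclideanSpace ℝ (Fin d)} (hf : ∀ j ∈ s, DifferentiableAt ℝ (f j) x) (i : Fin d) :
    partialDeriv i (fun y => ∑ j ∈ s, f j y) x = ∑ j ∈ s, partialDeriv i (f j) x := by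
  unfold partialDeriv
  rw [fderiv_fun_sum hf]
  simp

/-- The components of `A ∇v`. -/
noncomputable def flux (A : EuclideanSpace ℝ (Fin d) → Matrix (Fin d) (Fin d) ℝ)
    (v : EuclideanSpace ℝ (Fin d) → ℝ) (i : Fin d) : EuclideanSpace ℝ (Fin d) → ℝ :=
  fun x => ∑ j, A x i j * partialDeriv j v x

/-- The vector field whose divergence appears in the Rellich identity. -/
noncomputable def rellichField (A : EuclideanSpace ℝ (Fin d) → Matrix (Fin d) (Fin d) ℝ)
    (B : Fin d → EuclideanSpace ℝ (Fin d) → ℝ) (α θ v : EuclideanSpace ℝ (Fin d) → ℝ)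
    (i : Fin d) : EuclideanSpace ℝ (Fin d) → ℝ :=
  fun x => flux A v i x * (2 * ∑ k, B k x * partialDeriv k v x + θ x * v x)
    - B i x * ∑ j, flux A v j x * partialDeriv j v x + α x * B i x * (v x * v x)

/-- Pointwise content of the Rellich identity: `V` and `W` stand for the gradient and Hessian of
`v`, `fl` for the flux. Apart from the factor `∑ i, dfl i i`, all second derivatives cancel, by the
symmetry of `a` and `W`, so that the remainder is quadratic in `(V, v)`. -/
theorem rellich_algebra (a : Fin d → Fin d → ℝ) (da : Fin d → Fin d → Fin d → ℝ)
    (hsym : ∀ i j, a i j = a j i) (V B dα dθ fl : Fin d → ℝ) (W dB dfl : Fin d → Fin d → ℝ)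
    (hW : ∀ i j, W i j = W j i) (α θ v : ℝ) (hfl : ∀ i, fl i = ∑ j, a i j * V j)
    (hdfl : ∀ i j, dfl i j = ∑ k, (da i j k * V k + a j k * W i k)) :
    ∑ i, (dfl i i * (2 * ∑ k, B k * V k + θ * v)
        + fl i * (2 * ∑ k, (dB i k * V k + B k * W i k) + (dθ i * v + θ * V i))
        - (dB i i * (∑ j, fl j * V j) + B i * ∑ j, (dfl i j * V j + fl j * W i j))
        + ((dα i * B i + α * dB i i) * (v * v) + α * B i * (V i * v + v * V i))) =
      (∑ i, dfl i i + α * v) * (2 * ∑ k, B k * V k + θ * v) - α * θ * v ^ 2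
      + 2 * ∑ i, fl i * ∑ k, dB i k * V k
      + (θ - ∑ i, dB i i) * ∑ i, fl i * V i
      + v * ∑ i, fl i * dθ i
      - ∑ i, B i * ∑ j, ∑ k, da i j k * V k * V j
      + (∑ i, (dα i * B i + α * dB i i)) * v ^ 2 := by
  -- The Hessian term. It occurs with `+2` from differentiating `2 B · ∇v`, and with `-1` twice from
  -- differentiating `A∇v · ∇v`.
  set R := ∑ i, B i * ∑ j, fl j * W i j with hR
  have h1 : ∑ i, B i * ∑ j, dfl i j * V j = (∑ i, B i * ∑ j, ∑ k, da i j k * V k * V j) + R := by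
    rw [hR, ← Finset.sum_add_distrib]
    refine Finset.sum_congr rfl fun i _ => ?_
    rw [← mul_add]
    congr 1
    have : ∑ j, fl j * W i j = ∑ j, ∑ k, a j k * W i k * V j := by
      rw [Finset.sum_comm]
      refine Finset.sum_congr rfl fun j _ => ?_
      rw [hfl, Finset.sum_mul]
      refine Finset.sum_congr rfl fun k _ => ?_
      rw [hsym]; ring
    rw [this, ← Finset.sum_add_distrib]
    refine Finset.sum_congr rfl fun j _ => ?_
    rw [hdfl, Finset.sum_mul, ← Finset.sum_add_distrib]
    refine Finset.sum_congr rfl fun k _ => ?_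
    ring
  have h2 : ∑ i, fl i * ∑ k, B k * W i k = R := by
    rw [hR]
    simp only [Finset.mul_sum]
    rw [Finset.sum_comm]
    refine Finset.sum_congr rfl fun j _ => Finset.sum_congr rfl fun k _ => ?_
    rw [hW]; ring
  set K := 2 * ∑ k, B k * V k + θ * v with hK
  set E := ∑ i, fl i * V i with hE
  have h3 : ∀ i, (dfl i i * K + fl i * (2 * ∑ k, (dB i k * V k + B k * W i k) + (dθ i * v + θ * V i))
        - (dB i i * E + B i * ∑ j, (dfl i j * V j + fl j * W i j))
        + ((dα i * B i + α * dB i i) * (v * v) + α * B i * (V i * v + v * V i))) =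
      K * dfl i i + 2 * (fl i * ∑ k, dB i k * V k) + 2 * (fl i * ∑ k, B k * W i k)
        + v * (fl i * dθ i) + θ * (fl i * V i) - E * dB i i - B i * (∑ j, dfl i j * V j)
        - B i * (∑ j, fl j * W i j) + v ^ 2 * (dα i * B i + α * dB i i) + 2 * α * v * (B i * V i) := by
    intro i
    simp only [Finset.sum_add_distrib]
    ring
  simp only [h3]
  simp only [Finset.sum_add_distrib, Finset.sum_sub_distrib, ← Finset.mul_sum]
  rw [h1, h2, ← hE]
  rw [hK]
  ring

variable {A : EuclideanSpace ℝ (Fin d) → Matrix (Fin d) (Fin d) ℝ}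
  {B : Fin d → EuclideanSpace ℝ (Fin d) → ℝ} {α θ v : EuclideanSpace ℝ (Fin d) → ℝ}

theorem contDiff_flux (hA : ∀ i j, ContDiff ℝ 1 (fun x => A x i j)) (hv : ContDiff ℝ 2 v)
    (i : Fin d) : ContDiff ℝ 1 (flux A v i) :=
  ContDiff.sum fun j _ => (hA i j).mul (contDiff_partialDeriv hv (by norm_num) j)

theorem contDiff_rellichField (hA : ∀ i j, ContDiff ℝ 1 (fun x => A x i j))
    (hB : ∀ i, ContDiff ℝ 1 (B i)) (hα : ContDiff ℝ 1 α) (hθ : ContDiff ℝ 1 θ)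
    (hv : ContDiff ℝ 2 v) (i : Fin d) : ContDiff ℝ 1 (rellichField A B α θ v i) := by
  have hv1 : ContDiff ℝ 1 v := hv.of_le (by norm_num)
  have hp : ∀ j, ContDiff ℝ 1 (partialDeriv j v) := fun j =>
    contDiff_partialDeriv hv (by norm_num) j
  have hf := fun i => contDiff_flux hA hv i
  refine (((hf i).mul ((contDiff_const.mul (ContDiff.sum fun k _ => (hB k).mul (hp k))).add
    (hθ.mul hv1))).sub ((hB i).mul (ContDiff.sum fun j _ => (hf j).mul (hp j)))).add
    ((hα.mul (hB i)).mul (hv1.mul hv1))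

theorem partialDeriv_flux (hA : ∀ i j, ContDiff ℝ 1 (fun x => A x i j)) (hv : ContDiff ℝ 2 v)
    (i j : Fin d) (x : EuclideanSpace ℝ (Fin d)) :
    partialDeriv i (flux A v j) x = ∑ k, (partialDeriv i (fun y => A y j k) x * partialDeriv k v x
      + A x j k * partialDeriv i (partialDeriv k v) x) := by
  have dA : ∀ i j, DifferentiableAt ℝ (fun x => A x i j) x := fun i j =>
    (hA i j).differentiable (by simp) x
  have dV : ∀ j, DifferentiableAt ℝ (partialDeriv j v) x := fun j =>
    (contDiff_partialDeriv (m := 1) hv (by norm_num) j).differentiable (by simp) x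
  unfold flux
  rw [partialDeriv_sum fun k _ => (dA j k).fun_mul (dV k)]
  exact Finset.sum_congr rfl fun k _ => partialDeriv_mul (dA j k) (dV k) i

/-- `Div(A∇v) + α v` is multiplied by `2 B · ∇v + θ v`. Up to a divergence the product is a
quadratic form in `(∇v, v)`; the functions `B`, `α` and `θ` remain free at this stage. -/
theorem rellich_identity (hA : ∀ i j, ContDiff ℝ 1 (fun x => A x i j))
    (hB : ∀ i, ContDiff ℝ 1 (B i)) (hα : ContDiff ℝ 1 α) (hθ : ContDiff ℝ 1 θ)
    (hv : ContDiff ℝ 2 v) (x : EuclideanSpace ℝ (Fin d)) (hsym : ∀ i j, A x i j = A x j i) :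
    ∑ i, partialDeriv i (rellichField A B α θ v i) x =
      (∑ i, partialDeriv i (flux A v i) x + α x * v x)
        * (2 * ∑ k, B k x * partialDeriv k v x + θ x * v x) - α x * θ x * v x ^ 2
      + 2 * ∑ i, flux A v i x * ∑ k, partialDeriv i (B k) x * partialDeriv k v x
      + (θ x - ∑ i, partialDeriv i (B i) x) * ∑ i, flux A v i x * partialDeriv i v x
      + v x * ∑ i, flux A v i x * partialDeriv i θ x
      - ∑ i, B i x * ∑ j, ∑ k, partialDeriv i (fun y => A y j k) x * partialDeriv k v x
          * partialDeriv j v x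
      + (∑ i, (partialDeriv i α x * B i x + α x * partialDeriv i (B i) x)) * v x ^ 2 := by
  have dV : ∀ j, DifferentiableAt ℝ (partialDeriv j v) x := fun j =>
    (contDiff_partialDeriv (m := 1) hv (by norm_num) j).differentiable (by simp) x
  have dv : DifferentiableAt ℝ v x := hv.differentiable (by simp) x
  have dB : ∀ j, DifferentiableAt ℝ (B j) x := fun j => (hB j).differentiable (by simp) x
  have dα : DifferentiableAt ℝ α x := hα.differentiable (by simp) x
  have dθ : DifferentiableAt ℝ θ x := hθ.differentiable (by simp) x
  have df : ∀ j, DifferentiableAt ℝ (flux A v j) x := fun j =>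
    (contDiff_flux hA hv j).differentiable (by simp) x
  have dBV : DifferentiableAt ℝ (fun y => ∑ k, B k y * partialDeriv k v y) x :=
    DifferentiableAt.fun_sum fun k _ => (dB k).fun_mul (dV k)
  have dfV : DifferentiableAt ℝ (fun y => ∑ k, flux A v k y * partialDeriv k v y) x :=
    DifferentiableAt.fun_sum fun k _ => (df k).fun_mul (dV k)
  rw [← rellich_algebra (fun i j => A x i j) (fun i j k => partialDeriv i (fun y => A y j k) x) hsym
    (fun i => partialDeriv i v x) (fun i => B i x) (fun i => partialDeriv i α x)
    (fun i => partialDeriv i θ x) (fun i => flux A v i x)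
    (fun i j => partialDeriv i (partialDeriv j v) x) (fun i j => partialDeriv i (B j) x)
    (fun i j => partialDeriv i (flux A v j) x) (fun i j => by rw [partialDeriv_comm hv])
    (α x) (θ x) (v x) (fun i => rfl) (fun i j => partialDeriv_flux hA hv i j x)]
  refine Finset.sum_congr rfl fun i _ => ?_
  unfold rellichField
  rw [partialDeriv_add (((df i).fun_mul ((dBV.const_mul 2).fun_add (dθ.fun_mul dv))).fun_sub
      ((dB i).fun_mul dfV)) ((dα.fun_mul (dB i)).fun_mul (dv.fun_mul dv)),
    partialDeriv_sub ((df i).fun_mul ((dBV.const_mul 2).fun_add (dθ.fun_mul dv)))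
      ((dB i).fun_mul dfV),
    partialDeriv_mul (df i) ((dBV.const_mul 2).fun_add (dθ.fun_mul dv)),
    partialDeriv_add (dBV.const_mul 2) (dθ.fun_mul dv),
    partialDeriv_const_mul dBV, partialDeriv_mul dθ dv, partialDeriv_mul (dB i) dfV,
    partialDeriv_mul (dα.fun_mul (dB i)) (dv.fun_mul dv), partialDeriv_mul dα (dB i),
    partialDeriv_mul dv dv, partialDeriv_sum fun k _ => (dB k).fun_mul (dV k),
    partialDeriv_sum fun k _ => (df k).fun_mul (dV k),
    Finset.sum_congr rfl fun k _ => partialDeriv_mul (dB k) (dV k) i,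
    Finset.sum_congr rfl fun k _ => partialDeriv_mul (df k) (dV k) i]

/-! ### Conjugation with an exponential weight -/

theorem partialDeriv_exp_mul {φ w : EuclideanSpace ℝ (Fin d) → ℝ} (hφ : ContDiff ℝ 1 φ)
    (hw : ContDiff ℝ 1 w) (lam : ℝ) (i : Fin d) (x : EuclideanSpace ℝ (Fin d)) :
    partialDeriv i (fun y => Real.exp (lam * φ y) * w y) x =
      Real.exp (lam * φ x) * (partialDeriv i w x + lam * partialDeriv i φ x * w x) := by
  have dφ : DifferentiableAt ℝ φ x := hφ.differentiable (by simp) x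
  have dw : DifferentiableAt ℝ w x := hw.differentiable (by simp) x
  rw [partialDeriv_mul ((dφ.const_mul lam).exp) dw]
  have : partialDeriv i (fun y => Real.exp (lam * φ y)) x =
      Real.exp (lam * φ x) * (lam * partialDeriv i φ x) := by
    unfold partialDeriv
    rw [fderiv_exp (dφ.const_mul lam), fderiv_const_mul dφ]
    simp
  rw [this]
  ring

/-- Each derivative falling on the exponential brings down `lam ∇φ`. The symmetry of `A` identifies
`∇φ · A∇w` with `B · ∇w`, so that the two first-order contributions merge into one with factor `2
lam`. -/
theorem conjugated_operator {φ w : EuclideanSpace ℝ (Fin d) → ℝ}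
    (hA : ∀ i j, ContDiff ℝ 1 (fun x => A x i j)) (hsym : ∀ x i j, A x i j = A x j i)
    (hB : ∀ i, ContDiff ℝ 1 (B i))
    (hφ : ContDiff ℝ 2 φ) (hw : ContDiff ℝ 2 w) (lam : ℝ)
    (hBφ : ∀ i x, B i x = ∑ j, A x i j * partialDeriv j φ x)
    (x : EuclideanSpace ℝ (Fin d)) :
    let v := fun y => Real.exp (lam * φ y) * w y
    Real.exp (lam * φ x) * ∑ i, partialDeriv i (flux A w i) x =
      ∑ i, partialDeriv i (flux A v i) x - 2 * lam * ∑ i, B i x * partialDeriv i v x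
        + lam ^ 2 * (∑ i, B i x * partialDeriv i φ x) * v x
        - lam * (∑ i, partialDeriv i (B i) x) * v x := by
  intro v
  have hφ1 : ContDiff ℝ 1 φ := hφ.of_le (by norm_num)
  have hw1 : ContDiff ℝ 1 w := hw.of_le (by norm_num)
  have hD : ∀ i y, partialDeriv i v y =
      Real.exp (lam * φ y) * (partialDeriv i w y + lam * partialDeriv i φ y * w y) := fun i y =>
    partialDeriv_exp_mul hφ1 hw1 lam i y
  have hfl : ∀ i, flux A v i =
      fun y => Real.exp (lam * φ y) * (flux A w i y + lam * (B i y * w y)) := by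
    intro i
    ext y
    simp only [flux, hD, hBφ, Finset.sum_mul, Finset.mul_sum, ← Finset.sum_add_distrib]
    refine Finset.sum_congr rfl fun j _ => ?_
    ring
  have hdfl : ∀ i, partialDeriv i (flux A v i) x = Real.exp (lam * φ x) *
      (partialDeriv i (flux A w i) x + lam * (partialDeriv i (B i) x * w x + B i x * partialDeriv i w x)
        + lam * partialDeriv i φ x * (flux A w i x + lam * (B i x * w x))) := by
    intro i
    have c1 : ContDiff ℝ 1 (fun y => B i y * w y) := (hB i).mul hw1
    have c2 := contDiff_flux hA hw i
    rw [hfl, partialDeriv_exp_mul hφ1 (c2.add (contDiff_const.mul c1)),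
      partialDeriv_add (c2.differentiable (by simp) x)
        ((c1.differentiable (by simp) x).const_mul lam),
      partialDeriv_const_mul (c1.differentiable (by simp) x),
      partialDeriv_mul ((hB i).differentiable (by simp) x) (hw1.differentiable (by simp) x)]
  have hsymm : ∑ i, partialDeriv i φ x * flux A w i x = ∑ i, B i x * partialDeriv i w x := by
    simp only [flux, hBφ, Finset.mul_sum, Finset.sum_mul]
    rw [Finset.sum_comm]
    refine Finset.sum_congr rfl fun i _ => Finset.sum_congr rfl fun j _ => ?_
    rw [hsym]; ring
  have e1 : ∑ i, partialDeriv i (flux A v i) x = Real.exp (lam * φ x) *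
      (∑ i, partialDeriv i (flux A w i) x + lam * w x * ∑ i, partialDeriv i (B i) x
        + 2 * lam * ∑ i, B i x * partialDeriv i w x
        + lam ^ 2 * w x * ∑ i, B i x * partialDeriv i φ x) := by
    rw [two_mul, add_mul]
    nth_rewrite 1 [← hsymm]
    simp only [hdfl, Finset.mul_sum, ← Finset.sum_add_distrib]
    refine Finset.sum_congr rfl fun i _ => ?_
    ring
  have e2 : ∑ i, B i x * partialDeriv i v x = Real.exp (lam * φ x) *
      (∑ i, B i x * partialDeriv i w x + lam * w x * ∑ i, B i x * partialDeriv i φ x) := by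
    simp only [hD, Finset.mul_sum, ← Finset.sum_add_distrib]
    refine Finset.sum_congr rfl fun i _ => ?_
    ring
  rw [e1, e2]
  ring

end Rellich

end QuasiReversibility

namespace QuasiReversibility

/-! ### From positivity to the Carleman estimate for smooth functions. -/

section CarlemanEstimate

variable {d : ℕ}

/-! ### The Carleman estimate for smooth functions -/

/-- The derivative of the weight. -/
noncomputable def weightSlope (z : Fin d) (s : ℝ) (x : EuclideanSpace ℝ (Fin d)) : ℝ :=
  Real.exp (s * x z)

/-- The Carleman weight. -/
noncomputable def weight (z : Fin d) (s : ℝ) (x : EuclideanSpace ℝ (Fin d)) : ℝ :=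
  s⁻¹ * weightSlope z s x

theorem contDiff_coord {n : WithTop ℕ∞} (z : Fin d) :
    ContDiff ℝ n (fun x : EuclideanSpace ℝ (Fin d) => x z) :=
  (EuclideanSpace.proj (𝕜 := ℝ) z).contDiff

theorem contDiff_weightSlope {n : WithTop ℕ∞} (z : Fin d) (s : ℝ) :
    ContDiff ℝ n (weightSlope z s) :=
  (contDiff_const.mul (contDiff_coord z)).exp

theorem contDiff_weight {n : WithTop ℕ∞} (z : Fin d) (s : ℝ) : ContDiff ℝ n (weight z s) :=
  contDiff_const.mul (contDiff_weightSlope z s)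

theorem partialDeriv_weightSlope (z i : Fin d) (s : ℝ) (x : EuclideanSpace ℝ (Fin d)) :
    partialDeriv i (weightSlope z s) x = if i = z then s * weightSlope z s x else 0 := by
  have h0 : HasFDerivAt (fun x : EuclideanSpace ℝ (Fin d) => x z)
    (EuclideanSpace.proj (𝕜 := ℝ) z) x := (EuclideanSpace.proj (𝕜 := ℝ) z).hasFDerivAt
  have h1 : HasFDerivAt (weightSlope z s)
      (Real.exp (s * x z) • (s • EuclideanSpace.proj (𝕜 := ℝ) z)) x := (h0.const_mul s).exp
  unfold partialDeriv
  rw [h1.fderiv]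
  by_cases h : i = z
  · subst h
    simp [weightSlope, mul_comm]
  · simp [h, Ne.symm h]

theorem partialDeriv_weight (z i : Fin d) {s : ℝ} (hs : s ≠ 0) (x : EuclideanSpace ℝ (Fin d)) :
    partialDeriv i (weight z s) x = if i = z then weightSlope z s x else 0 := by
  unfold weight
  rw [partialDeriv_const_mul ((contDiff_weightSlope (n := 1) z s).differentiable (by simp) x),
    partialDeriv_weightSlope]
  split_ifs
  · field_simp
  · simp

/-- The vector field of the Rellich identity in the Carleman estimate. -/
noncomputable def carlemanField (A : EuclideanSpace ℝ (Fin d) → Matrix (Fin d) (Fin d) ℝ)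
    (z : Fin d) (s lam : ℝ) (v : EuclideanSpace ℝ (Fin d) → ℝ) (i : Fin d) :
    EuclideanSpace ℝ (Fin d) → ℝ :=
  rellichField A (fun i x => weightSlope z s x * A x i z)
    (fun x => lam ^ 2 * (weightSlope z s x * weightSlope z s x * A x z z))
    (fun x => 2 * s * (weightSlope z s x * A x z z)) v i

variable {A : EuclideanSpace ℝ (Fin d) → Matrix (Fin d) (Fin d) ℝ}

theorem contDiff_carlemanField (hA : ∀ i j, ContDiff ℝ 1 (fun x => A x i j))
    {v : EuclideanSpace ℝ (Fin d) → ℝ} (hv : ContDiff ℝ 2 v)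
    (z : Fin d) (s lam : ℝ) (i : Fin d) : ContDiff ℝ 1 (carlemanField A z s lam v i) := by
  have hp : ContDiff ℝ 1 (weightSlope z s) := contDiff_weightSlope z s
  exact contDiff_rellichField hA (fun i => hp.mul (hA i z))
    (contDiff_const.mul ((hp.mul hp).mul (hA z z))) (contDiff_const.mul (hp.mul (hA z z))) hv i

/-- `f` is the conjugated operator applied to `v`, `D` a divergence and `Q` the positive form. Since
`(P - lam Kq)² ≥ -4 lam P Kq`, the product `P Kq = D - Q` cannot be very negative without `f` being
large; so `Q` is controlled by `f²` and `lam D`. The leftover `lam g v` is absorbed into the `lam³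
p³ v²` supplied by `Q`. The final factors `6` and `12` are three times those in `h3`, the price of
returning from `v` to `w`. -/
theorem carleman_absorption {p lam f P Kq Q g G v Y Yw D p0 : ℝ} (hlam : 0 < lam)
    (hp0 : 0 < p0) (hp0p : p0 ≤ p) (hp01 : p0 ≤ 1) (hY : 0 ≤ Y)
    (hf : f = P - lam * Kq + lam * g * v) (hD : D = P * Kq + Q)
    (hQ : p * Y / 2 + lam ^ 2 * p ^ 3 * v ^ 2 / 2 ≤ Q) (hg : |g| ≤ p * G)
    (hG : 2 * G ^ 2 ≤ lam * p) (hYw : Yw ≤ 2 * Y + 2 * lam ^ 2 * p ^ 2 * v ^ 2) :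
    p0 ^ 3 * lam * (Yw + lam ^ 2 * v ^ 2) ≤ 6 * f ^ 2 + 12 * lam * D := by
  have hp : 0 < p := hp0.trans_le hp0p
  have h1 : -(4 * lam * (P * Kq)) ≤ 2 * f ^ 2 + 2 * (lam ^ 2 * (g ^ 2 * v ^ 2)) := by
    have e1 : (f - lam * g * v) ^ 2 = (P + lam * Kq) ^ 2 - 4 * lam * (P * Kq) := by
      rw [hf]; ring
    have e2 := sq_nonneg (P + lam * Kq)
    have e3 : 2 * f ^ 2 + 2 * (lam ^ 2 * (g ^ 2 * v ^ 2)) - (f - lam * g * v) ^ 2 =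
      (f + lam * g * v) ^ 2 := by ring
    have e4 := sq_nonneg (f + lam * g * v)
    linarith
  have h2 : 2 * (lam ^ 2 * (g ^ 2 * v ^ 2)) ≤ lam ^ 3 * p ^ 3 * v ^ 2 := by
    have e1 : g ^ 2 * v ^ 2 ≤ (p * G) ^ 2 * v ^ 2 :=
      mul_le_mul_of_nonneg_right (sq_le_sq_of_abs_le hg) (sq_nonneg _)
    have e2 := mul_le_mul_of_nonneg_left e1 (sq_nonneg lam)
    have e3 : lam ^ 2 * p ^ 2 * v ^ 2 * (2 * G ^ 2) ≤ lam ^ 2 * p ^ 2 * v ^ 2 * (lam * p) :=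
      mul_le_mul_of_nonneg_left hG (by positivity)
    have e4 : lam ^ 2 * p ^ 2 * v ^ 2 * (2 * G ^ 2) = 2 * (lam ^ 2 * ((p * G) ^ 2 * v ^ 2)) := by ring
    have e5 : lam ^ 2 * p ^ 2 * v ^ 2 * (lam * p) = lam ^ 3 * p ^ 3 * v ^ 2 := by ring
    linarith
  have h3 : 2 * lam * p * Y + lam ^ 3 * p ^ 3 * v ^ 2 ≤ 2 * f ^ 2 + 4 * lam * D := by
    have e1 := mul_le_mul_of_nonneg_left hQ (show 0 ≤ 4 * lam by positivity)
    have e2 : 4 * lam * (p * Y / 2 + lam ^ 2 * p ^ 3 * v ^ 2 / 2) =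
      2 * lam * p * Y + 2 * (lam ^ 3 * p ^ 3 * v ^ 2) := by ring
    have e3 : 4 * lam * D = 4 * lam * (P * Kq) + 4 * lam * Q := by rw [hD]; ring
    linarith
  -- One constant must serve for the weights `p` and `p³`; as `p0 ≤ 1`, the cube of `p0` lies below
  -- both.
  have hp03 : p0 ^ 3 ≤ p := by
    refine le_trans ?_ hp0p
    have := pow_le_of_le_one hp0.le hp01 (n := 3) (by norm_num)
    exact this
  have hp03' : p0 ^ 3 ≤ p ^ 3 := pow_le_pow_left₀ hp0.le hp0p 3
  have k1 : p0 ^ 3 * lam * (Yw + lam ^ 2 * v ^ 2) ≤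
      p0 ^ 3 * lam * (2 * Y + 2 * lam ^ 2 * p ^ 2 * v ^ 2 + lam ^ 2 * v ^ 2) :=
    mul_le_mul_of_nonneg_left (by linarith) (by positivity)
  have k2 : p0 ^ 3 * (2 * lam * Y) ≤ p * (2 * lam * Y) :=
    mul_le_mul_of_nonneg_right hp03 (by positivity)
  have k3 : p0 ^ 3 * (2 * lam ^ 3 * p ^ 2 * v ^ 2) ≤ p * (2 * lam ^ 3 * p ^ 2 * v ^ 2) :=
    mul_le_mul_of_nonneg_right hp03 (by positivity)
  have k4 : p0 ^ 3 * (lam ^ 3 * v ^ 2) ≤ p ^ 3 * (lam ^ 3 * v ^ 2) :=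
    mul_le_mul_of_nonneg_right hp03' (by positivity)
  have k5 : 0 ≤ lam * p * Y := by positivity
  have k6 : p0 ^ 3 * lam * (2 * Y + 2 * lam ^ 2 * p ^ 2 * v ^ 2 + lam ^ 2 * v ^ 2) =
    p0 ^ 3 * (2 * lam * Y) + p0 ^ 3 * (2 * lam ^ 3 * p ^ 2 * v ^ 2) + p0 ^ 3 * (lam ^ 3 * v ^ 2) := by
    ring
  have k7 : p * (2 * lam * Y) + p * (2 * lam ^ 3 * p ^ 2 * v ^ 2) + p ^ 3 * (lam ^ 3 * v ^ 2) =
    2 * (lam * p * Y) + 3 * (lam ^ 3 * p ^ 3 * v ^ 2) := by ring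
  linarith

set_option maxHeartbeats 1000000 in
theorem carleman_pointwise (z : Fin d) {μ M s lam p0 : ℝ} (hμ : 0 < μ)
    (hs : 0 < s) (hM : 0 ≤ M) (hlam : 0 < lam) (hp0 : 0 < p0) (hp01 : p0 ≤ 1)
    (hsμ : 4 * d ^ 2 * M ^ 2 + 2 * d * M ^ 2 + 1 ≤ s * μ ^ 2)
    (hlam1 : d * (2 * s ^ 2 * M ^ 2 + 2 * s * d * M ^ 2) ^ 2 ≤ lam ^ 2 * p0 ^ 2)
    (hlam2 : 2 * (s * M + d * M) ^ 2 ≤ lam * p0)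
    (hA : ∀ i j, ContDiff ℝ 1 (fun x => A x i j)) (hsym : ∀ x i j, A x i j = A x j i)
    {w : EuclideanSpace ℝ (Fin d) → ℝ} (hw : ContDiff ℝ 2 w) (x : EuclideanSpace ℝ (Fin d))
    (hell : ∀ ξ : Fin d → ℝ, μ * ∑ i, ξ i ^ 2 ≤ ∑ i, (∑ j, A x i j * ξ j) * ξ i)
    (hAM : ∀ i j, |A x i j| ≤ M) (hdAM : ∀ i j k, |partialDeriv i (fun y => A y j k) x| ≤ M)
    (hp0x : p0 ≤ weightSlope z s x) :
    p0 ^ 3 * lam * (∑ j, (Real.exp (lam * weight z s x) * partialDeriv j w x) ^ 2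
        + lam ^ 2 * (Real.exp (lam * weight z s x) * w x) ^ 2) ≤
      6 * (Real.exp (lam * weight z s x) * ∑ i, partialDeriv i (flux A w i) x) ^ 2
        + 12 * lam * ∑ i, partialDeriv i
          (carlemanField A z s lam (fun y => Real.exp (lam * weight z s y) * w y) i) x := by
  have cp : ContDiff ℝ 1 (weightSlope z s) := contDiff_weightSlope z s
  have dp : DifferentiableAt ℝ (weightSlope z s) x := cp.differentiable (by simp) x
  have dA : ∀ i j, DifferentiableAt ℝ (fun x => A x i j) x := fun i j =>
    (hA i j).differentiable (by simp) x
  have hw1 : ContDiff ℝ 1 w := hw.of_le (by norm_num)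
  set B : Fin d → EuclideanSpace ℝ (Fin d) → ℝ := fun i x => weightSlope z s x * A x i z with hBdef
  have hB : ∀ i, ContDiff ℝ 1 (B i) := fun i => cp.mul (hA i z)
  -- Chosen equal to `lam² A∇φ · ∇φ`, so that `Div(A∇v) + α v` is exactly the part of the conjugated
  -- operator that is even in `lam`.
  set α : EuclideanSpace ℝ (Fin d) → ℝ :=
    fun x => lam ^ 2 * (weightSlope z s x * weightSlope z s x * A x z z) with hαdef
  have hα : ContDiff ℝ 1 α := contDiff_const.mul ((cp.mul cp).mul (hA z z))
  -- With `θ = k s p a_zz` the leading coefficients of the form, on `A∇v · ∇v` and on `lam² v²`, are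
  -- `(k - 1) s p a_zz` and `(3 - k) s p³ a_zz²`. Both must be positive; `k = 2` balances them.
  set θ : EuclideanSpace ℝ (Fin d) → ℝ := fun x => 2 * s * (weightSlope z s x * A x z z) with hθdef
  have hθ : ContDiff ℝ 1 θ := contDiff_const.mul (cp.mul (hA z z))
  have hBφ : ∀ i x, B i x = ∑ j, A x i j * partialDeriv j (weight z s) x := by
    intro i x
    simp only [partialDeriv_weight z _ hs.ne', mul_ite, mul_zero, Finset.sum_ite_eq',
      Finset.mem_univ, if_true, hBdef]
    ring
  have hconj := conjugated_operator hA hsym hB (contDiff_weight z s) hw lam hBφ x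
  set v : EuclideanSpace ℝ (Fin d) → ℝ := fun y => Real.exp (lam * weight z s y) * w y with hv
  have hv2 : ContDiff ℝ 2 v := (contDiff_const.mul (contDiff_weight z s)).exp.mul hw
  have hrell := rellich_identity hA hB hα hθ hv2 x (hsym x)
  set p := weightSlope z s x with hp
  have hppos : 0 < p := hp0.trans_le hp0x
  have hDB : ∀ i k, partialDeriv i (B k) x =
      p * ((if i = z then s else 0) * A x k z + partialDeriv i (fun y => A y k z) x) := by
    intro i k
    rw [hBdef, partialDeriv_mul dp (dA k z), partialDeriv_weightSlope, ← hp]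
    split_ifs <;> ring
  have hDα : ∀ i, partialDeriv i α x = lam ^ 2 * ((if i = z then 2 * s else 0) * p ^ 2 * A x z z
      + p ^ 2 * partialDeriv i (fun y => A y z z) x) := by
    intro i
    rw [hαdef, partialDeriv_const_mul ((dp.fun_mul dp).fun_mul (dA z z)),
      partialDeriv_mul (dp.fun_mul dp) (dA z z), partialDeriv_mul dp dp, partialDeriv_weightSlope,
      ← hp]
    split_ifs <;> ring
  have hDθ : ∀ i, partialDeriv i θ x = 2 * s * p * ((if i = z then s else 0) * A x z z
      + partialDeriv i (fun y => A y z z) x) := by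
    intro i
    rw [hθdef, partialDeriv_const_mul (dp.fun_mul (dA z z)), partialDeriv_mul dp (dA z z),
      partialDeriv_weightSlope, ← hp]
    split_ifs <;> ring
  have hlam1' : d * (2 * s ^ 2 * M ^ 2 + 2 * s * d * M ^ 2) ^ 2 ≤ lam ^ 2 * p ^ 2 :=
    hlam1.trans (mul_le_mul_of_nonneg_left (pow_le_pow_left₀ hp0.le hp0x 2) (sq_nonneg _))
  have hlam2' : 2 * (s * M + d * M) ^ 2 ≤ lam * p :=
    hlam2.trans (mul_le_mul_of_nonneg_left hp0x hlam.le)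
  have hQ := carleman_quadratic_lower_bound z (lam := lam) (p := p) (v := v x) hμ hs hppos hM hsμ
    hlam1' (fun i j => A x i j) (fun i j k => partialDeriv i (fun y => A y j k) x)
    (fun i => partialDeriv i v x) hAM hdAM hell (hsym x) (fun i => B i x) (fun i => rfl)
    (fun i k => partialDeriv i (B k) x) hDB _ (fun i => rfl)
    (fun i => partialDeriv i θ x) hDθ
  have hg : |2 * s * p * A x z z - ∑ i, partialDeriv i (B i) x| ≤ p * (s * M + d * M) := by
    have e : 2 * s * p * A x z z - ∑ i, partialDeriv i (B i) x =
        p * (s * A x z z - ∑ i, partialDeriv i (fun y => A y i z) x) := by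
      simp only [hDB, mul_add, Finset.sum_add_distrib, ite_mul, zero_mul, mul_ite, mul_zero,
        Finset.sum_ite_eq', Finset.mem_univ, if_true, ← Finset.mul_sum]
      ring
    rw [e, abs_mul, abs_of_pos hppos]
    refine mul_le_mul_of_nonneg_left ((abs_sub _ _).trans (add_le_add ?_ ?_)) hppos.le
    · rw [abs_mul, abs_of_pos hs]
      exact mul_le_mul_of_nonneg_left (hAM z z) hs.le
    · exact abs_sum_le_card_mul fun i => hdAM i i z
  have hYw : ∑ j, (Real.exp (lam * weight z s x) * partialDeriv j w x) ^ 2 ≤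
      2 * ∑ j, (partialDeriv j v x) ^ 2 + 2 * lam ^ 2 * p ^ 2 * v x ^ 2 := by
    have e1 : ∀ j, (Real.exp (lam * weight z s x) * partialDeriv j w x) ^ 2 ≤
        2 * (partialDeriv j v x) ^ 2 + if j = z then 2 * lam ^ 2 * p ^ 2 * v x ^ 2 else 0 := by
      intro j
      have e2 := partialDeriv_exp_mul (contDiff_weight z s) hw1 lam j x
      rw [partialDeriv_weight z j hs.ne', ← hp] at e2
      have e3 : Real.exp (lam * weight z s x) * partialDeriv j w x =
          partialDeriv j v x - (if j = z then lam * p * v x else 0) := by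
        rw [hv, e2]
        split_ifs <;> ring
      rw [e3]
      split_ifs
      · nlinarith [sq_nonneg (partialDeriv j v x + lam * p * v x)]
      · nlinarith [sq_nonneg (partialDeriv j v x)]
    refine (Finset.sum_le_sum fun j _ => e1 j).trans ?_
    simp [Finset.sum_add_distrib, Finset.mul_sum]
  have hαx : α x = lam ^ 2 * (p ^ 2 * A x z z) := by
    simp only [hαdef, ← hp]
    ring
  have hθx : θ x = 2 * s * p * A x z z := by
    simp only [hθdef, ← hp]
    ring
  have hαφ : lam ^ 2 * ∑ i, B i x * partialDeriv i (weight z s) x = α x := by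
    simp only [partialDeriv_weight z _ hs.ne', mul_ite, mul_zero, Finset.sum_ite_eq',
      Finset.mem_univ, if_true, hBdef, hαdef]
    ring
  have hS : ∑ i, (partialDeriv i α x * B i x + α x * partialDeriv i (B i) x) =
      lam ^ 2 * ∑ i, (((if i = z then 2 * s else 0) * p ^ 2 * A x z z
        + p ^ 2 * partialDeriv i (fun y => A y z z) x) * B i x
        + p ^ 2 * A x z z * partialDeriv i (B i) x) := by
    rw [Finset.mul_sum]
    refine Finset.sum_congr rfl fun i _ => ?_
    rw [hDα, hαx]
    ring
  have hflux : ∀ i, ∑ j, A x i j * partialDeriv j v x = flux A v i x := fun _ => rfl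
  simp only [hflux] at hQ
  rw [hS, hαx, hθx] at hrell
  rw [hαφ, hαx] at hconj
  -- Adding `θ v` to the multiplier leaves the defect `lam (θ - div B) v` in the conjugated
  -- operator: this is the term `lam g v`, with `|g| ≤ p (s M + d M)`.
  refine carleman_absorption hlam hp0 hp0x hp01 (Finset.sum_nonneg fun _ _ => sq_nonneg _) ?_
    (hrell.trans ?_) hQ hg hlam2' hYw
    (P := ∑ i, partialDeriv i (flux A v i) x + lam ^ 2 * (p ^ 2 * A x z z) * v x)
    (Kq := 2 * ∑ k, B k x * partialDeriv k v x + 2 * s * p * A x z z * v x)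
  · rw [hconj]
    ring
  · ring

theorem integral_partialDeriv_eq_zero {F : EuclideanSpace ℝ (Fin d) → ℝ} (hF : ContDiff ℝ 1 F)
    (hc : HasCompactSupport F) (i : Fin d) : ∫ x, partialDeriv i F x = 0 := by
  have c1 : Continuous (partialDeriv i F) :=
    (contDiff_partialDeriv (m := 0) hF (by simp) i).continuous
  have i1 : Integrable (partialDeriv i F) := c1.integrable_of_hasCompactSupport
    (hc.of_isClosed_subset (isClosed_tsupport _) (tsupport_partialDeriv_subset F i))
  have i2 : Integrable F := hF.continuous.integrable_of_hasCompactSupport hc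
  have := integral_mul_fderiv_eq_neg_fderiv_mul_of_integrable (μ := volume)
    (f := fun _ : EuclideanSpace ℝ (Fin d) => (1 : ℝ)) (g := F) (v := EuclideanSpace.single i 1)
    (by simp) (by simp only [one_mul]; exact i1) (by simpa using i2)
    (fun x _ => differentiableAt_const _) (fun x _ => hF.differentiable (by simp) x)
  simpa [partialDeriv] using this

/-- The pointwise inequality is integrated; the divergence of a compactly supported field
contributes nothing. The weight, `κ` and `lam₀` precede `A` in the quantifiers, and the bounds on
`A` are asked only on the support of `w`: the uniformity of the final constant rests on the former,
the use of mollification on the latter. -/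
theorem carleman_estimate (z : Fin d) {μ M : ℝ} (hμ : 0 < μ) (hM : 0 ≤ M) (R : ℝ) :
    ∃ φ : EuclideanSpace ℝ (Fin d) → ℝ, Continuous φ ∧ ∃ κ > 0, ∃ lam₀ > 0,
      ∀ A : EuclideanSpace ℝ (Fin d) → Matrix (Fin d) (Fin d) ℝ,
      (∀ i j, ContDiff ℝ 1 (fun x => A x i j)) → (∀ x i j, A x i j = A x j i) →
      (∀ x, ∀ ξ : Fin d → ℝ, μ * ∑ i, ξ i ^ 2 ≤ ∑ i, (∑ j, A x i j * ξ j) * ξ i) →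
      ∀ w : EuclideanSpace ℝ (Fin d) → ℝ, ContDiff ℝ 2 w → HasCompactSupport w →
      (∀ x ∈ tsupport w, ‖x‖ ≤ R ∧ (∀ i j, |A x i j| ≤ M) ∧
        ∀ i j k, |partialDeriv i (fun y => A y j k) x| ≤ M) →
      ∀ lam ≥ lam₀,
        κ * lam * ∫ x, (∑ j, (Real.exp (lam * φ x) * partialDeriv j w x) ^ 2
            + lam ^ 2 * (Real.exp (lam * φ x) * w x) ^ 2) ≤
          ∫ x, (Real.exp (lam * φ x) * ∑ i, partialDeriv i (flux A w i) x) ^ 2 := by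
  set s : ℝ := (4 * d ^ 2 * M ^ 2 + 2 * d * M ^ 2 + 1) / μ ^ 2 with hs
  have hspos : 0 < s := by positivity
  have hsμ : 4 * d ^ 2 * M ^ 2 + 2 * d * M ^ 2 + 1 ≤ s * μ ^ 2 := by
    rw [hs, div_mul_cancel₀ _ (by positivity)]
  -- The minimum of `exp(s x_z)` over `|x_z| ≤ |R|`.
  set p0 : ℝ := Real.exp (-(s * |R|)) with hp0
  have hp0pos : 0 < p0 := Real.exp_pos _
  have hp01 : p0 ≤ 1 := by
    rw [hp0, Real.exp_le_one_iff]
    have : 0 ≤ s * |R| := by positivity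
    linarith
  set c := 2 * s ^ 2 * M ^ 2 + 2 * s * d * M ^ 2 with hc
  have hc0 : 0 ≤ c := by positivity
  -- The threshold for `lam` is a sum so that `lam * p0` exceeds both `d c` and `2 (s M + d M)²`; as
  -- `d ≥ 1`, the former gives `d c² ≤ (lam p0)²`. The summand `1` keeps the threshold positive. `κ`
  -- is `p0³` divided by the factor `6` of the pointwise inequality.
  refine ⟨weight z s, (contDiff_weight (n := 0) z s).continuous, p0 ^ 3 / 6, by positivity,
    (1 + d * c + 2 * (s * M + d * M) ^ 2) / p0, by positivity, ?_⟩
  intro A hA hsym hell w hw hwc hbd lam hlam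
  have hlamp : 1 + d * c + 2 * (s * M + d * M) ^ 2 ≤ lam * p0 := (div_le_iff₀ hp0pos).1 hlam
  have hlampos : 0 < lam := lt_of_lt_of_le (by positivity) hlam
  have hd0 : (1 : ℝ) ≤ d := by
    have : 1 ≤ d := z.pos
    exact_mod_cast this
  have hlam1 : d * c ^ 2 ≤ lam ^ 2 * p0 ^ 2 := by
    have h1 : d * c ≤ lam * p0 := by
      have := sq_nonneg (s * M + d * M)
      linarith
    have h2 : (d * c) ^ 2 ≤ (lam * p0) ^ 2 := pow_le_pow_left₀ (by positivity) h1 2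
    have h3 : d * c ^ 2 ≤ (d * c) ^ 2 := by
      rw [mul_pow]
      refine mul_le_mul_of_nonneg_right ?_ (sq_nonneg _)
      nlinarith
    calc d * c ^ 2 ≤ (d * c) ^ 2 := h3
      _ ≤ (lam * p0) ^ 2 := h2
      _ = lam ^ 2 * p0 ^ 2 := mul_pow _ _ _
  have hlam2 : 2 * (s * M + d * M) ^ 2 ≤ lam * p0 := by
    have : 0 ≤ d * c := by positivity
    linarith
  set v : EuclideanSpace ℝ (Fin d) → ℝ := fun y => Real.exp (lam * weight z s y) * w y with hv
  have hexp : ContDiff ℝ 2 (fun y : EuclideanSpace ℝ (Fin d) => Real.exp (lam * weight z s y)) :=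
    (contDiff_const.mul (contDiff_weight z s)).exp
  have hv2 : ContDiff ℝ 2 v := hexp.mul hw
  have hF := fun i => contDiff_carlemanField hA hv2 z s lam i
  have hw0 : ∀ x ∉ tsupport w, w x = 0 := fun x hx => image_eq_zero_of_notMem_tsupport hx
  have hDw0 : ∀ j, ∀ x ∉ tsupport w, partialDeriv j w x = 0 := fun j x hx =>
    image_eq_zero_of_notMem_tsupport fun h => hx (tsupport_partialDeriv_subset w j h)
  have hDv0 : ∀ j, ∀ x ∉ tsupport w, partialDeriv j v x = 0 := fun j x hx => by
    rw [hv, partialDeriv_exp_mul (contDiff_weight z s) (hw.of_le (by norm_num)), hw0 x hx,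
      hDw0 j x hx]
    ring
  have sub : ∀ F : EuclideanSpace ℝ (Fin d) → ℝ, (∀ x ∉ tsupport w, F x = 0) →
      tsupport F ⊆ tsupport w := fun F h =>
    closure_minimal (fun x hx => by_contra fun hxw => hx (h x hxw)) (isClosed_tsupport _)
  have hF0 : ∀ i, tsupport (carlemanField A z s lam v i) ⊆ tsupport w := fun i =>
    sub _ fun x hx => by
      have hv0 : v x = 0 := by rw [hv]; simp [hw0 x hx]
      simp [carlemanField, rellichField, flux, hDv0 _ x hx, hv0]
  have hfl0 : ∀ i, tsupport (flux A w i) ⊆ tsupport w := fun i =>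
    sub _ fun x hx => by simp [flux, hDw0 _ x hx]
  have hDF0 : ∀ i, ∀ x ∉ tsupport w, partialDeriv i (carlemanField A z s lam v i) x = 0 :=
    fun i x hx => image_eq_zero_of_notMem_tsupport fun h =>
      hx (hF0 i (tsupport_partialDeriv_subset _ i h))
  have hDfl0 : ∀ i, ∀ x ∉ tsupport w, partialDeriv i (flux A w i) x = 0 :=
    fun i x hx => image_eq_zero_of_notMem_tsupport fun h =>
      hx (hfl0 i (tsupport_partialDeriv_subset _ i h))
  have hpt : ∀ x, p0 ^ 3 * lam * (∑ j, (Real.exp (lam * weight z s x) * partialDeriv j w x) ^ 2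
        + lam ^ 2 * (Real.exp (lam * weight z s x) * w x) ^ 2) ≤
      6 * (Real.exp (lam * weight z s x) * ∑ i, partialDeriv i (flux A w i) x) ^ 2
        + 12 * lam * ∑ i, partialDeriv i (carlemanField A z s lam v i) x := by
    intro x
    by_cases hx : x ∈ tsupport w
    · obtain ⟨h1, h2, h3⟩ := hbd x hx
      refine carleman_pointwise z hμ hspos hM hlampos hp0pos hp01 hsμ hlam1 hlam2 hA hsym hw x
        (hell x) h2 h3 ?_
      rw [hp0, weightSlope]
      refine Real.exp_le_exp.2 ?_
      have h4 : |x z| ≤ |R| := (PiLp.norm_apply_le x z).trans (h1.trans (le_abs_self R))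
      have h5 : -|R| ≤ x z := (abs_le.1 h4).1
      have := mul_le_mul_of_nonneg_left h5 hspos.le
      linarith
    · simp [hw0 x hx, hDw0 _ x hx, hDF0 _ x hx, hDfl0 _ x hx]
  have ce : Continuous (fun y : EuclideanSpace ℝ (Fin d) => Real.exp (lam * weight z s y)) :=
    hexp.continuous
  have cDw : ∀ j, Continuous (partialDeriv j w) := fun j =>
    (contDiff_partialDeriv (m := 1) hw (by norm_num) j).continuous
  have cDfl : ∀ j, Continuous (partialDeriv j (flux A w j)) := fun j =>
    (contDiff_partialDeriv (m := 0) (contDiff_flux hA hw j) (by simp) j).continuous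
  have cDF : ∀ j, Continuous (partialDeriv j (carlemanField A z s lam v j)) := fun j =>
    (contDiff_partialDeriv (m := 0) (hF j) (by simp) j).continuous
  have i1 : Integrable (fun x => ∑ j, (Real.exp (lam * weight z s x) * partialDeriv j w x) ^ 2
      + lam ^ 2 * (Real.exp (lam * weight z s x) * w x) ^ 2) := by
    refine Continuous.integrable_of_hasCompactSupport
      ((continuous_finsetSum _ fun j _ => (ce.mul (cDw j)).pow 2).add
        (continuous_const.mul ((ce.mul hw.continuous).pow 2))) (HasCompactSupport.intro hwc ?_)
    intro x hx
    simp [hw0 x hx, hDw0 _ x hx]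
  have i2 : Integrable (fun x =>
      (Real.exp (lam * weight z s x) * ∑ i, partialDeriv i (flux A w i) x) ^ 2) := by
    refine Continuous.integrable_of_hasCompactSupport
      ((ce.mul (continuous_finsetSum _ fun j _ => cDfl j)).pow 2) (HasCompactSupport.intro hwc ?_)
    intro x hx
    simp [hDfl0 _ x hx]
  have i3 : ∀ i, Integrable (fun x => partialDeriv i (carlemanField A z s lam v i) x) := fun i =>
    (cDF i).integrable_of_hasCompactSupport (HasCompactSupport.intro hwc fun x hx => hDF0 i x hx)
  have hint := integral_mono (i1.const_mul (p0 ^ 3 * lam))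
    ((i2.const_mul 6).add ((integrable_finsetSum _ fun i _ => i3 i).const_mul (12 * lam))) hpt
  have e0 : ∫ x, ∑ i, partialDeriv i (carlemanField A z s lam v i) x = 0 := by
    rw [integral_finsetSum _ fun i _ => i3 i]
    exact Finset.sum_eq_zero fun i _ => integral_partialDeriv_eq_zero (hF i)
      (hwc.of_isClosed_subset (isClosed_tsupport _) (hF0 i)) i
  simp only [Pi.add_apply] at hint
  rw [integral_add (i2.const_mul 6) ((integrable_finsetSum _ fun i _ => i3 i).const_mul _),
    integral_const_mul, integral_const_mul, integral_const_mul, e0, mul_zero, add_zero] at hint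
  linarith

end CarlemanEstimate

end QuasiReversibility

namespace QuasiReversibility

/-! ### Mollification in `L²`. -/

section Mollification

open Filter Topology
open scoped Convolution ENNReal

variable {d : ℕ}

/-! ### Mollification -/

theorem MemLp.exists_eLpNorm_translate_sub_le {f : EuclideanSpace ℝ (Fin d) → ℝ}
    (hf : MemLp f 2 volume) {δ : ℝ≥0∞} (hδ : δ ≠ 0) :
    ∃ r > 0, ∀ c : EuclideanSpace ℝ (Fin d), ‖c‖ < r →
      eLpNorm (fun x => f (c + x) - f x) 2 volume ≤ δ := by
  have : Fact ((2 : ℝ≥0∞) ≠ ⊤) := ⟨by norm_num⟩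
  have hcont : Continuous fun c : EuclideanSpace ℝ (Fin d) => DomAddAct.mk c +ᵥ hf.toLp f :=
    (DomAddAct.continuous_mk).vadd continuous_const
  have h0 : DomAddAct.mk (0 : EuclideanSpace ℝ (Fin d)) +ᵥ hf.toLp f = hf.toLp f := by
    simp
  have ht := hcont.tendsto 0
  rw [h0] at ht
  have hev := EMetric.tendsto_nhds.1 ht δ (pos_iff_ne_zero.2 hδ)
  obtain ⟨r, hr, hball⟩ := Metric.eventually_nhds_iff.1 hev
  refine ⟨r, hr, fun c hc => ?_⟩
  have h1 := (hball (show dist c 0 < r by simpa using hc)).le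
  rw [DomAddAct.mk_vadd_toLp, Lp.edist_toLp_toLp] at h1
  exact h1

/-- The mollification of `f` by the kernel `η`. -/
noncomputable def mollify (η f : EuclideanSpace ℝ (Fin d) → ℝ) : EuclideanSpace ℝ (Fin d) → ℝ :=
  f ⋆[ContinuousLinearMap.mul ℝ ℝ, volume] η

theorem mollify_apply (η f : EuclideanSpace ℝ (Fin d) → ℝ) (x : EuclideanSpace ℝ (Fin d)) :
    mollify η f x = ∫ t, f t * η (x - t) := rfl

theorem contDiff_mollify {η f : EuclideanSpace ℝ (Fin d) → ℝ} (hη : ContDiff ℝ ∞ η)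
    (hηc : HasCompactSupport η) (hf : LocallyIntegrable f) : ContDiff ℝ ∞ (mollify η f) :=
  hηc.contDiff_convolution_right _ hf hη

theorem integrable_mul_translate {η f : EuclideanSpace ℝ (Fin d) → ℝ} (hη : Continuous η)
    (hηc : HasCompactSupport η) (hf : LocallyIntegrable f) (x : EuclideanSpace ℝ (Fin d)) :
    Integrable (fun t => f t * η (x - t)) :=
  hηc.convolutionExists_right (ContinuousLinearMap.mul ℝ ℝ) hf hη x

/-- The integration by parts formula is applied to `s ↦ η (x - s)`. No boundary term can appear, as
the formula holds on the whole space: mollification commutes with the weak derivative. -/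
theorem partialDeriv_mollify {η f g : EuclideanSpace ℝ (Fin d) → ℝ} (hη : ContDiff ℝ ∞ η)
    (hηc : HasCompactSupport η) (hf : LocallyIntegrable f) (hg : LocallyIntegrable g) (i : Fin d)
    (hfg : ∀ φ : EuclideanSpace ℝ (Fin d) → ℝ, ContDiff ℝ 1 φ →
      ∫ x, (f x * partialDeriv i φ x + g x * φ x) = 0) :
    partialDeriv i (mollify η f) = mollify η g := by
  ext x
  have η1 : ContDiff ℝ 1 η := hη.of_le (by simp)
  have h1 := hηc.hasFDerivAt_convolution_right (ContinuousLinearMap.mul ℝ ℝ) hf η1 x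
  have hDc : HasCompactSupport (partialDeriv i η) :=
    hηc.of_isClosed_subset (isClosed_tsupport _) (tsupport_partialDeriv_subset η i)
  have hDcont : Continuous (partialDeriv i η) :=
    (contDiff_partialDeriv (m := 0) η1 (by simp) i).continuous
  have e1 : partialDeriv i (mollify η f) x = ∫ t, f t * partialDeriv i η (x - t) := by
    unfold partialDeriv
    rw [mollify, h1.fderiv, convolution_precompR_apply _ hf (hηc.fderiv ℝ)
      (η1.continuous_fderiv (by simp))]
    rfl
  have e2 : ∀ t, partialDeriv i (fun s => η (x - s)) t = - partialDeriv i η (x - t) := by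
    intro t
    unfold partialDeriv
    have h : HasFDerivAt (fun s => η (x - s))
        ((fderiv ℝ η (x - t)).comp (-ContinuousLinearMap.id ℝ _)) t :=
      ((η1.differentiable (by simp) (x - t)).hasFDerivAt).comp t ((hasFDerivAt_id t).const_sub x)
    rw [h.fderiv]
    simp
  have h2 := hfg (fun s => η (x - s)) (η1.comp (contDiff_const.sub contDiff_id))
  simp only [e2, mul_neg] at h2
  rw [integral_add (integrable_mul_translate hDcont hDc hf x).fun_neg
    (integrable_mul_translate η1.continuous hηc hg x), integral_neg] at h2
  rw [e1, mollify_apply]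
  linarith

theorem mollify_eq_zero {η f : EuclideanSpace ℝ (Fin d) → ℝ} {s : Set (EuclideanSpace ℝ (Fin d))}
    {r : ℝ} (hf : ∀ x ∉ s, f x = 0) (hη : ∀ x, r ≤ ‖x‖ → η x = 0)
    {x : EuclideanSpace ℝ (Fin d)} (hx : x ∉ Metric.thickening r s) : mollify η f x = 0 := by
  rw [mollify_apply]
  refine integral_eq_zero_of_ae (Eventually.of_forall fun t => ?_)
  by_cases ht : t ∈ s
  · have : r ≤ ‖x - t‖ := by
      by_contra! h
      exact hx (Metric.mem_thickening_iff.2 ⟨t, ht, by rwa [dist_eq_norm]⟩)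
    simp [hη _ this]
  · simp [hf t ht]

theorem mollify_congr_ae {η f g : EuclideanSpace ℝ (Fin d) → ℝ} (h : f =ᵐ[volume] g) :
    mollify η f = mollify η g := by
  ext x
  rw [mollify_apply, mollify_apply]
  refine integral_congr_ae ?_
  filter_upwards [h] with t ht
  rw [ht]

theorem lintegral_enorm_sq_le {α : Type*} [MeasurableSpace α] {ν : Measure α}
    [IsProbabilityMeasure ν] {g : α → ℝ} (hg : AEStronglyMeasurable g ν) :
    (∫⁻ t, ‖g t‖ₑ ∂ν) ^ (2 : ℝ) ≤ ∫⁻ t, ‖g t‖ₑ ^ (2 : ℝ) ∂ν := by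
  have h := eLpNorm_le_eLpNorm_of_exponent_le (p := 1) (q := 2) one_le_two hg
  rw [eLpNorm_one_eq_lintegral_enorm,
    eLpNorm_eq_lintegral_rpow_enorm_toReal (by norm_num) (by norm_num)] at h
  have h2 := ENNReal.rpow_le_rpow h (z := 2) (by norm_num)
  rw [← ENNReal.rpow_mul] at h2
  simpa using h2

/-- `mollify η f - f` is the average of translates `f(· - t) - f` over the probability measure `η
dt`, which is carried by `‖t‖ < r`; Jensen and Tonelli give the bound. A genuinely measurable `f`
makes the integrand jointly measurable. -/
theorem eLpNorm_mollify_sub_le_of_measurable {η f : EuclideanSpace ℝ (Fin d) → ℝ}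
    (hη : Continuous η) (hηc : HasCompactSupport η) (hη0 : ∀ x, 0 ≤ η x) (hη1 : ∫ x, η x = 1)
    (hfm : Measurable f) (hf : LocallyIntegrable f) {r : ℝ} (hηr : ∀ x, r ≤ ‖x‖ → η x = 0)
    {δ : ℝ≥0∞} (hδ : ∀ c : EuclideanSpace ℝ (Fin d), ‖c‖ < r →
      eLpNorm (fun x => f (c + x) - f x) 2 volume ≤ δ) :
    eLpNorm (mollify η f - f) 2 volume ≤ δ := by
  have hηi : Integrable η := hη.integrable_of_hasCompactSupport hηc
  set ν : Measure (EuclideanSpace ℝ (Fin d)) :=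
    volume.withDensity fun t => ENNReal.ofReal (η t) with hν
  have hmη : Measurable fun t => ENNReal.ofReal (η t) := hη.measurable.ennreal_ofReal
  have hprob : IsProbabilityMeasure ν := by
    constructor
    rw [hν, withDensity_apply _ MeasurableSet.univ, Measure.restrict_univ,
      ← ofReal_integral_eq_lintegral_ofReal hηi (Eventually.of_forall hη0), hη1, ENNReal.ofReal_one]
  have hpt : ∀ x, ‖(mollify η f - f) x‖ₑ ≤ ∫⁻ t, ‖f (-t + x) - f x‖ₑ ∂ν := by
    intro x
    have i1 : Integrable (fun t => f (x - t) * η t) := by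
      have := (integrable_mul_translate hη hηc hf x).comp_sub_left x
      simpa using this
    have e1 : (mollify η f - f) x = ∫ t, (f (-t + x) - f x) * η t := by
      have e2 : mollify η f x = ∫ t, f (x - t) * η t := by
        rw [mollify_apply, ← integral_sub_left_eq_self _ volume x]
        simp
      have e3 : f x = ∫ t, f x * η t := by rw [integral_const_mul, hη1, mul_one]
      rw [Pi.sub_apply, e2]
      conv_lhs => rw [e3]
      rw [← integral_sub i1 (hηi.const_mul _)]
      refine integral_congr_ae (Eventually.of_forall fun t => ?_)
      simp only [neg_add_eq_sub]
      ring
    rw [e1]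
    refine (enorm_integral_le_lintegral_enorm _).trans (le_of_eq ?_)
    rw [hν, lintegral_withDensity_eq_lintegral_mul _ hmη (by fun_prop)]
    refine lintegral_congr fun t => ?_
    rw [enorm_mul, Pi.mul_apply, mul_comm, Real.enorm_of_nonneg (hη0 t)]
  have hmeas : Measurable (fun q : EuclideanSpace ℝ (Fin d) × EuclideanSpace ℝ (Fin d) =>
      ‖f (-q.2 + q.1) - f q.1‖ₑ ^ (2 : ℝ)) := by
    have m1 : Measurable fun q : EuclideanSpace ℝ (Fin d) × EuclideanSpace ℝ (Fin d) =>
      f (-q.2 + q.1) := hfm.comp (measurable_snd.neg.add measurable_fst)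
    exact (m1.sub (hfm.comp measurable_fst)).enorm.pow_const _
  have key : ∫⁻ x, ‖(mollify η f - f) x‖ₑ ^ (2 : ℝ) ≤ δ ^ (2 : ℝ) := by
    calc ∫⁻ x, ‖(mollify η f - f) x‖ₑ ^ (2 : ℝ)
        ≤ ∫⁻ x, ∫⁻ t, ‖f (-t + x) - f x‖ₑ ^ (2 : ℝ) ∂ν := by
          refine lintegral_mono fun x => ?_
          refine (ENNReal.rpow_le_rpow (hpt x) (by norm_num)).trans (lintegral_enorm_sq_le ?_)
          have : Measurable fun t : EuclideanSpace ℝ (Fin d) => f (-t + x) - f x :=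
            (hfm.comp (measurable_neg.add_const x)).sub_const _
          exact this.aestronglyMeasurable
      _ = ∫⁻ t, (∫⁻ x, ‖f (-t + x) - f x‖ₑ ^ (2 : ℝ)) ∂ν :=
          lintegral_lintegral_swap hmeas.aemeasurable
      _ ≤ ∫⁻ _t, δ ^ (2 : ℝ) ∂ν := by
          refine lintegral_mono_ae ?_
          rw [hν, ae_withDensity_iff hmη]
          refine Eventually.of_forall fun t ht => ?_
          have htr : ‖-t‖ < r := by
            by_contra! h
            rw [norm_neg] at h
            exact ht (by rw [hηr t h, ENNReal.ofReal_zero])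
          have h := hδ (-t) htr
          rw [eLpNorm_eq_lintegral_rpow_enorm_toReal (by norm_num) (by norm_num)] at h
          have h2 := ENNReal.rpow_le_rpow h (z := 2) (by norm_num)
          rw [← ENNReal.rpow_mul] at h2
          simpa using h2
      _ = δ ^ (2 : ℝ) := by simp
  rw [eLpNorm_eq_lintegral_rpow_enorm_toReal (by norm_num) (by norm_num)]
  have h2 := ENNReal.rpow_le_rpow key (z := 1 / 2) (by norm_num)
  rw [← ENNReal.rpow_mul δ] at h2
  simpa using h2

theorem MemLp.exists_eLpNorm_mollify_sub_le {f : EuclideanSpace ℝ (Fin d) → ℝ}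
    (hf : MemLp f 2 volume) {δ : ℝ≥0∞} (hδ : δ ≠ 0) :
    ∃ r > 0, ∀ η : EuclideanSpace ℝ (Fin d) → ℝ, Continuous η → HasCompactSupport η →
      (∀ x, 0 ≤ η x) → ∫ x, η x = 1 → (∀ x, r ≤ ‖x‖ → η x = 0) →
      eLpNorm (mollify η f - f) 2 volume ≤ δ := by
  -- Neither the mollification nor the `L²` distance sees the change to a measurable representative.
  set f' := hf.1.mk f with hf'
  have hae : f =ᵐ[volume] f' := hf.1.ae_eq_mk
  have hfl : MemLp f' 2 volume := hf.ae_eq hae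
  obtain ⟨r, hr, h⟩ := MemLp.exists_eLpNorm_translate_sub_le hfl hδ
  refine ⟨r, hr, fun η c1 c2 c3 c4 c5 => ?_⟩
  have h1 := eLpNorm_mollify_sub_le_of_measurable c1 c2 c3 c4
    hf.1.stronglyMeasurable_mk.measurable (hfl.locallyIntegrable one_le_two) c5 h
  rw [mollify_congr_ae hae]
  refine (eLpNorm_congr_ae ?_).trans_le h1
  filter_upwards [hae] with x hx
  rw [Pi.sub_apply, Pi.sub_apply, hx]

/-- A sequence of mollifying kernels. -/
theorem exists_mollifier_sequence (d : ℕ) :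
    ∃ η : ℕ → EuclideanSpace ℝ (Fin d) → ℝ, (∀ k, ContDiff ℝ ∞ (η k)) ∧
      (∀ k, HasCompactSupport (η k)) ∧ (∀ r > 0, ∀ᶠ k in atTop, ∀ x, r ≤ ‖x‖ → η k x = 0) ∧
      ∀ f : EuclideanSpace ℝ (Fin d) → ℝ, MemLp f 2 volume →
        Tendsto (fun k => eLpNorm (mollify (η k) f - f) 2 volume) atTop (𝓝 0) := by
  let φ : ℕ → ContDiffBump (0 : EuclideanSpace ℝ (Fin d)) := fun k =>
    ⟨1 / (2 * ((k : ℝ) + 1)), 1 / ((k : ℝ) + 1), by positivity, by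
      rw [div_lt_div_iff₀ (by positivity) (by positivity)]
      have : (0 : ℝ) ≤ k := k.cast_nonneg
      linarith⟩
  have hzero : ∀ r > 0, ∀ᶠ k in atTop, ∀ x, r ≤ ‖x‖ → (φ k).normed volume x = 0 := by
    intro r hr
    filter_upwards [(tendsto_one_div_add_atTop_nhds_zero_nat (𝕜 := ℝ)).eventually (gt_mem_nhds hr)]
      with k hk x hx
    have : x ∉ Function.support ((φ k).normed volume) := by
      rw [(φ k).support_normed_eq, Metric.mem_ball, dist_zero_right, not_lt]
      exact hk.le.trans hx
    simpa using this
  refine ⟨fun k => (φ k).normed volume, fun k => (φ k).contDiff_normed,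
    fun k => (φ k).hasCompactSupport_normed, hzero, fun f hf => ?_⟩
  refine ENNReal.tendsto_nhds_zero.2 fun δ hδ => ?_
  obtain ⟨r, hr, h⟩ := MemLp.exists_eLpNorm_mollify_sub_le hf hδ.ne'
  filter_upwards [hzero r hr] with k hk
  exact h _ (φ k).continuous_normed (φ k).hasCompactSupport_normed (φ k).nonneg_normed
    (φ k).integral_normed hk

end Mollification

end QuasiReversibility

namespace QuasiReversibility

/-! ### `L²` limits and the Carleman estimate under weak differentiability. -/

section Limit

open Filter Topology
open scoped ENNReal

variable {d : ℕ}

/-! ### Convergence in `L²` -/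

/-- Convergence in `L²` of a sequence of functions. -/
def TendstoL2 (F : ℕ → EuclideanSpace ℝ (Fin d) → ℝ) (f : EuclideanSpace ℝ (Fin d) → ℝ) : Prop :=
  (∀ k, MemLp (F k) 2 volume) ∧ MemLp f 2 volume ∧
    Tendsto (fun k => eLpNorm (F k - f) 2 volume) atTop (𝓝 0)

theorem TendstoL2.add {F G : ℕ → EuclideanSpace ℝ (Fin d) → ℝ}
    {f g : EuclideanSpace ℝ (Fin d) → ℝ} (hF : TendstoL2 F f) (hG : TendstoL2 G g) :
    TendstoL2 (fun k x => F k x + G k x) (fun x => f x + g x) := by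
  refine ⟨fun k => (hF.1 k).add (hG.1 k), hF.2.1.add hG.2.1, ?_⟩
  have h := hF.2.2.add hG.2.2
  rw [add_zero] at h
  refine tendsto_of_tendsto_of_tendsto_of_le_of_le tendsto_const_nhds h (fun _ => zero_le)
    fun k => ?_
  have e : (fun x => F k x + G k x) - (fun x => f x + g x) = (F k - f) + (G k - g) := by
    ext x; simp only [Pi.sub_apply, Pi.add_apply]; ring
  change eLpNorm ((fun x => F k x + G k x) - (fun x => f x + g x)) 2 volume ≤ _
  rw [e]
  exact eLpNorm_add_le ((hF.1 k).sub hF.2.1).1 ((hG.1 k).sub hG.2.1).1 one_le_two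

theorem TendstoL2.sum {ι : Type*} (s : Finset ι) {F : ι → ℕ → EuclideanSpace ℝ (Fin d) → ℝ}
    {f : ι → EuclideanSpace ℝ (Fin d) → ℝ} (h : ∀ i ∈ s, TendstoL2 (F i) (f i)) :
    TendstoL2 (fun k x => ∑ i ∈ s, F i k x) (fun x => ∑ i ∈ s, f i x) := by
  classical
  induction s using Finset.induction_on with
  | empty =>
    refine ⟨fun k => by simp, by simp, ?_⟩
    have : ∀ k : ℕ, eLpNorm ((fun x : EuclideanSpace ℝ (Fin d) => ∑ i ∈ (∅ : Finset ι), F i k x)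
        - fun x => ∑ i ∈ (∅ : Finset ι), f i x) 2 volume = 0 := by
      intro k
      simp only [Finset.sum_empty, sub_self]
      exact eLpNorm_zero
    simp only [this]
    exact tendsto_const_nhds
  | insert a s ha ih =>
    simp only [Finset.sum_insert ha]
    exact (h a (Finset.mem_insert_self a s)).add
      (ih fun j hj => h j (Finset.mem_insert_of_mem hj))

/-- A continuous multiplier is bounded only on bounded sets, hence the common bounded set outside
which everything vanishes. -/
theorem TendstoL2.continuous_mul {F : ℕ → EuclideanSpace ℝ (Fin d) → ℝ}
    {f a : EuclideanSpace ℝ (Fin d) → ℝ} (hF : TendstoL2 F f) (ha : Continuous a)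
    {s : Set (EuclideanSpace ℝ (Fin d))} (hs : Bornology.IsBounded s)
    (hFs : ∀ k, ∀ x ∉ s, F k x = 0) (hfs : ∀ x ∉ s, f x = 0) :
    TendstoL2 (fun k x => a x * F k x) (fun x => a x * f x) := by
  obtain ⟨C, hC⟩ := hs.exists_bound_of_continuous ha
  have bound : ∀ h : EuclideanSpace ℝ (Fin d) → ℝ, (∀ x ∉ s, h x = 0) →
      ∀ x, ‖a x * h x‖ ≤ C * ‖h x‖ := by
    intro h hh x
    by_cases hx : x ∈ s
    · rw [norm_mul]
      exact mul_le_mul_of_nonneg_right (hC x hx) (norm_nonneg _)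
    · simp [hh x hx]
  have memLp : ∀ h : EuclideanSpace ℝ (Fin d) → ℝ, MemLp h 2 volume → (∀ x ∉ s, h x = 0) →
      MemLp (fun x => a x * h x) 2 volume := fun h hm hh =>
    MemLp.of_le_mul (c := C) hm (ha.aestronglyMeasurable.mul hm.1)
      (Eventually.of_forall (bound h hh))
  refine ⟨fun k => memLp _ (hF.1 k) (hFs k), memLp _ hF.2.1 hfs, ?_⟩
  have h := ENNReal.Tendsto.const_mul (a := ENNReal.ofReal C) hF.2.2
    (Or.inr ENNReal.ofReal_ne_top)
  rw [mul_zero] at h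
  refine tendsto_of_tendsto_of_tendsto_of_le_of_le tendsto_const_nhds h (fun _ => zero_le)
    fun k => ?_
  refine eLpNorm_le_mul_eLpNorm_of_ae_le_mul (Eventually.of_forall fun x => ?_) 2
  have := bound (F k - f) (fun x hx => by simp [hFs k x hx, hfs x hx]) x
  simpa [mul_sub] using this

theorem norm_toLp_sq {f : EuclideanSpace ℝ (Fin d) → ℝ} (hf : MemLp f 2 volume) :
    ‖hf.toLp f‖ ^ 2 = ∫ x, f x ^ 2 := by
  rw [← real_inner_self_eq_norm_sq, L2.inner_def]
  refine integral_congr_ae ?_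
  filter_upwards [hf.coeFn_toLp] with x hx
  rw [hx]
  simp [pow_two]

theorem TendstoL2.integral_sq {F : ℕ → EuclideanSpace ℝ (Fin d) → ℝ}
    {f : EuclideanSpace ℝ (Fin d) → ℝ} (hF : TendstoL2 F f) :
    Tendsto (fun k => ∫ x, F k x ^ 2) atTop (𝓝 (∫ x, f x ^ 2)) := by
  have h := (Lp.tendsto_Lp_iff_tendsto_eLpNorm'' F hF.1 f hF.2.1).2 hF.2.2
  have h2 := (h.norm).pow 2
  simpa only [norm_toLp_sq] using h2

/-! ### The Carleman estimate for functions with vanishing Cauchy data -/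

/-- `g` and `G` are first and second weak derivatives of `f` on the whole space, and all vanish
outside `Ω`. The estimate holds for their mollifications and passes to the `L²` limit. -/
theorem carleman_estimate_weak (z : Fin d) {Ω : Set (EuclideanSpace ℝ (Fin d))}
    (hb : Bornology.IsBounded Ω) {μ M : ℝ} (hμ : 0 < μ) (hM : 0 ≤ M) :
    ∃ φ : EuclideanSpace ℝ (Fin d) → ℝ, Continuous φ ∧ ∃ κ > 0, ∃ lam₀ > 0,
      ∀ A : EuclideanSpace ℝ (Fin d) → Matrix (Fin d) (Fin d) ℝ,
      (∀ i j, ContDiff ℝ 1 (fun x => A x i j)) → (∀ x i j, A x i j = A x j i) →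
      (∀ x, ∀ ξ : Fin d → ℝ, μ * ∑ i, ξ i ^ 2 ≤ ∑ i, (∑ j, A x i j * ξ j) * ξ i) →
      C1NormLE Ω A M →
      ∀ (f : EuclideanSpace ℝ (Fin d) → ℝ) (g : Fin d → EuclideanSpace ℝ (Fin d) → ℝ)
        (G : Fin d → Fin d → EuclideanSpace ℝ (Fin d) → ℝ),
      MemLp f 2 volume → (∀ j, MemLp (g j) 2 volume) → (∀ i j, MemLp (G i j) 2 volume) →
      (∀ x ∉ Ω, f x = 0) → (∀ j, ∀ x ∉ Ω, g j x = 0) → (∀ i j, ∀ x ∉ Ω, G i j x = 0) →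
      (∀ i, ∀ ψ : EuclideanSpace ℝ (Fin d) → ℝ, ContDiff ℝ 1 ψ →
        ∫ x, (f x * partialDeriv i ψ x + g i x * ψ x) = 0) →
      (∀ i j, ∀ ψ : EuclideanSpace ℝ (Fin d) → ℝ, ContDiff ℝ 1 ψ →
        ∫ x, (g j x * partialDeriv i ψ x + G i j x * ψ x) = 0) →
      ∀ lam ≥ lam₀,
        κ * lam * ((∑ j, ∫ x, (Real.exp (lam * φ x) * g j x) ^ 2)
            + lam ^ 2 * ∫ x, (Real.exp (lam * φ x) * f x) ^ 2) ≤
          ∫ x, (Real.exp (lam * φ x) * ∑ i, ∑ j, (partialDeriv i (fun y => A y i j) x * g j x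
            + A x i j * G i j x)) ^ 2 := by
  obtain ⟨R, hR⟩ := hb.closure.exists_norm_le
  -- Mollification spreads supports slightly beyond the closure of `Ω`. The enlarged bounds `M + 1`
  -- and `R + 1` hold on a neighbourhood of it by continuity. The size of that neighbourhood depends
  -- on `A`, but the constants do not.
  obtain ⟨φ, hφ, κ, hκ, lam₀, hlam₀, hcar⟩ :=
    carleman_estimate z hμ (show 0 ≤ M + 1 by linarith) (R + 1)
  refine ⟨φ, hφ, κ, hκ, lam₀, hlam₀, ?_⟩
  intro A hA hsym hell hAM f g G mf mg mG f0 g0 G0 hf hg lam hlam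
  have cdA : ∀ i j k, Continuous (partialDeriv i (fun y => A y j k)) := fun i j k =>
    (contDiff_partialDeriv (m := 0) (hA j k) (by simp) i).continuous
  set V : Set (EuclideanSpace ℝ (Fin d)) := {x | ‖x‖ < R + 1} ∩
    ((⋂ i, ⋂ j, {x | |A x i j| < M + 1}) ∩
      ⋂ i, ⋂ j, ⋂ k, {x | |partialDeriv i (fun y => A y j k) x| < M + 1}) with hV
  have hVo : IsOpen V := by
    refine (isOpen_lt continuous_norm continuous_const).inter (IsOpen.inter ?_ ?_)
    · exact isOpen_iInter_of_finite fun i => isOpen_iInter_of_finite fun j =>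
        isOpen_lt (hA i j).continuous.abs continuous_const
    · exact isOpen_iInter_of_finite fun i => isOpen_iInter_of_finite fun j =>
        isOpen_iInter_of_finite fun k => isOpen_lt (cdA i j k).abs continuous_const
  have hΩV : closure Ω ⊆ V := by
    intro x hx
    simp only [hV, mem_inter_iff, mem_iInter, mem_ofPred_eq]
    refine ⟨by linarith [hR x hx], fun i j => ?_, fun i j k => ?_⟩
    · linarith [(hAM x hx i j).1]
    · linarith [(hAM x hx j k).2 i]
  have hcomp : IsCompact (closure Ω) :=
    Metric.isCompact_of_isClosed_isBounded isClosed_closure hb.closure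
  obtain ⟨r, hr, hrV⟩ := hcomp.exists_cthickening_subset_open hVo hΩV
  obtain ⟨η₀, η₀s, η₀c, η₀r, η₀L⟩ := exists_mollifier_sequence d
  obtain ⟨k₀, hk₀⟩ := eventually_atTop.1 (η₀r r hr)
  -- Dropping the first `k₀` kernels makes the support condition hold for every index.
  set η : ℕ → EuclideanSpace ℝ (Fin d) → ℝ := fun k => η₀ (k + k₀) with hη
  have ηs : ∀ k, ContDiff ℝ ∞ (η k) := fun k => η₀s _
  have ηc : ∀ k, HasCompactSupport (η k) := fun k => η₀c _
  have ηr : ∀ k x, r ≤ ‖x‖ → η k x = 0 := fun k => hk₀ _ (by omega)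
  have ηL : ∀ f : EuclideanSpace ℝ (Fin d) → ℝ, MemLp f 2 volume →
      Tendsto (fun k => eLpNorm (mollify (η k) f - f) 2 volume) atTop (𝓝 0) := fun f hf =>
    (η₀L f hf).comp (tendsto_add_atTop_nat k₀)
  -- supports
  set T := Metric.cthickening r (closure Ω) with hT
  have hTc : IsCompact T := hcomp.cthickening
  have hTb : Bornology.IsBounded T := hTc.isBounded
  have hΩT : Ω ⊆ T := subset_closure.trans (Metric.self_subset_cthickening _)
  have mz : ∀ k (h : EuclideanSpace ℝ (Fin d) → ℝ), (∀ x ∉ Ω, h x = 0) →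
      ∀ x ∉ T, mollify (η k) h x = 0 := fun k h hh x hx =>
    mollify_eq_zero (s := closure Ω) (fun y hy => hh y fun h => hy (subset_closure h)) (ηr k)
      fun h => hx (Metric.thickening_subset_cthickening _ _ h)
  have sm : ∀ k (h : EuclideanSpace ℝ (Fin d) → ℝ), MemLp h 2 volume →
      ContDiff ℝ ∞ (mollify (η k) h) := fun k h hh =>
    contDiff_mollify (ηs k) (ηc k) (hh.locallyIntegrable one_le_two)
  have mcs : ∀ k (h : EuclideanSpace ℝ (Fin d) → ℝ), (∀ x ∉ Ω, h x = 0) →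
      HasCompactSupport (mollify (η k) h) := fun k h hh =>
    HasCompactSupport.intro hTc (mz k h hh)
  have L2 : ∀ h : EuclideanSpace ℝ (Fin d) → ℝ, MemLp h 2 volume → (∀ x ∉ Ω, h x = 0) →
      TendstoL2 (fun k => mollify (η k) h) h := fun h hm hh =>
    ⟨fun k => (sm k h hm).continuous.memLp_of_hasCompactSupport (mcs k h hh), hm, ηL h hm⟩
  have zT : ∀ h : EuclideanSpace ℝ (Fin d) → ℝ, (∀ x ∉ Ω, h x = 0) → ∀ x ∉ T, h x = 0 :=
    fun h hh x hx => hh x fun h => hx (hΩT h)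
  -- the smooth inequality
  have ce : Continuous fun x => Real.exp (lam * φ x) := (continuous_const.mul hφ).rexp
  have D1 : ∀ k j, partialDeriv j (mollify (η k) f) = mollify (η k) (g j) := fun k j =>
    partialDeriv_mollify (ηs k) (ηc k) (mf.locallyIntegrable one_le_two)
      ((mg j).locallyIntegrable one_le_two) j (hf j)
  have D2 : ∀ k i j, partialDeriv i (mollify (η k) (g j)) = mollify (η k) (G i j) := fun k i j =>
    partialDeriv_mollify (ηs k) (ηc k) ((mg j).locallyIntegrable one_le_two)
      ((mG i j).locallyIntegrable one_le_two) i (hg i j)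
  have two_le : (2 : WithTop ℕ∞) ≤ ((⊤ : ℕ∞) : WithTop ℕ∞) := WithTop.coe_le_coe.2 (le_top : (2 : ℕ∞) ≤ ⊤)
  have cg : ∀ k j, Continuous (mollify (η k) (g j)) := fun k j => (sm k _ (mg j)).continuous
  have hsm : ∀ k, κ * lam * ((∑ j, ∫ x, (Real.exp (lam * φ x) * mollify (η k) (g j) x) ^ 2)
      + lam ^ 2 * ∫ x, (Real.exp (lam * φ x) * mollify (η k) f x) ^ 2) ≤
      ∫ x, (Real.exp (lam * φ x) * ∑ i, ∑ j, (partialDeriv i (fun y => A y i j) x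
        * mollify (η k) (g j) x + A x i j * mollify (η k) (G i j) x)) ^ 2 := by
    intro k
    have w2 : ContDiff ℝ 2 (mollify (η k) f) := (sm k f mf).of_le two_le
    have h := hcar A hA hsym hell (mollify (η k) f) w2 (mcs k f f0) (fun x hx => by
      have hsub : tsupport (mollify (η k) f) ⊆ T :=
        closure_minimal (fun y hy => by_contra fun hyT => hy (mz k f f0 y hyT)) hTc.isClosed
      have hxV := hrV (hsub hx)
      simp only [hV, mem_inter_iff, mem_iInter, mem_ofPred_eq] at hxV
      exact ⟨hxV.1.le, fun i j => (hxV.2.1 i j).le, fun i j k => (hxV.2.2 i j k).le⟩) lam hlam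
    simp only [partialDeriv_flux hA w2, D1, D2] at h
    rw [integral_add, integral_finsetSum, integral_const_mul] at h
    · exact h
    · intro j _
      exact ((ce.mul (cg k j)).pow 2).integrable_of_hasCompactSupport
        (HasCompactSupport.intro hTc fun x hx => by simp [mz k _ (g0 j) x hx])
    · exact (continuous_finsetSum _ fun j _ => (ce.mul (cg k j)).pow 2).integrable_of_hasCompactSupport
        (HasCompactSupport.intro hTc fun x hx => by simp [mz k _ (g0 _) x hx])
    · exact (continuous_const.mul ((ce.mul w2.continuous).pow 2)).integrable_of_hasCompactSupport
        (HasCompactSupport.intro hTc fun x hx => by simp [mz k _ f0 x hx])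
  -- passing to the limit
  have lf := ((L2 f mf f0).continuous_mul ce hTb (fun k => mz k f f0) (zT f f0)).integral_sq
  have lg := fun j => ((L2 (g j) (mg j) (g0 j)).continuous_mul ce hTb (fun k => mz k _ (g0 j))
    (zT _ (g0 j))).integral_sq
  have lG : TendstoL2 (fun k x => ∑ i, ∑ j, (partialDeriv i (fun y => A y i j) x
        * mollify (η k) (g j) x + A x i j * mollify (η k) (G i j) x))
      (fun x => ∑ i, ∑ j, (partialDeriv i (fun y => A y i j) x * g j x + A x i j * G i j x)) :=
    TendstoL2.sum _ fun i _ => TendstoL2.sum _ fun j _ =>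
      ((L2 (g j) (mg j) (g0 j)).continuous_mul (cdA i i j) hTb (fun k => mz k _ (g0 j))
        (zT _ (g0 j))).add
      ((L2 (G i j) (mG i j) (G0 i j)).continuous_mul (hA i j).continuous hTb
        (fun k => mz k _ (G0 i j)) (zT _ (G0 i j)))
  have lG' := (lG.continuous_mul ce hTb (fun k x hx => by simp [mz k _ (g0 _) x hx, mz k _ (G0 _ _) x hx])
    (fun x hx => by simp [zT _ (g0 _) x hx, zT _ (G0 _ _) x hx])).integral_sq
  refine le_of_tendsto_of_tendsto' (Tendsto.const_mul _ (Tendsto.add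
    (tendsto_finsetSum _ fun j _ => lg j) (Tendsto.const_mul _ lf))) lG' hsm

end Limit

end QuasiReversibility

namespace QuasiReversibility

/-! ### Lipschitz stability from vanishing Cauchy data. -/

section Stability

variable {d N : ℕ} {Ω : Set (EuclideanSpace ℝ (Fin d))}

/-! ### Lipschitz stability for functions with vanishing Cauchy data -/

/-- Zero traces of `u` and of its first derivatives say precisely that extension by zero creates no
boundary terms, so the indicator extensions are weak derivatives of one another on the whole space.
-/
theorem carleman_estimate_of_isTrace_zero (z : Fin d) (hΩ : IsOpen Ω)
    (hb : Bornology.IsBounded Ω) {μ M : ℝ} (hμ : 0 < μ) (hM : 0 ≤ M) :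
    ∃ φ : EuclideanSpace ℝ (Fin d) → ℝ, Continuous φ ∧ ∃ κ > 0, ∃ lam₀ > 0,
      ∀ A : EuclideanSpace ℝ (Fin d) → Matrix (Fin d) (Fin d) ℝ,
      (∀ i j, ContDiff ℝ 1 (fun x => A x i j)) → (∀ x i j, A x i j = A x j i) →
      (∀ x, ∀ ξ : Fin d → ℝ, μ * ∑ i, ξ i ^ 2 ≤ ∑ i, (∑ j, A x i j * ξ j) * ξ i) →
      C1NormLE Ω A M →
      ∀ u : EuclideanSpace ℝ (Fin d) → ℝ, MemSobolev Ω 3 u → IsTrace Ω u 0 →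
      (∀ j, IsTrace Ω (weakPartial Ω j u) 0) →
      ∀ lam ≥ lam₀,
        κ * lam * ((∑ j, ∫ x in Ω, (Real.exp (lam * φ x) * weakPartial Ω j u x) ^ 2)
            + lam ^ 2 * ∫ x in Ω, (Real.exp (lam * φ x) * u x) ^ 2) ≤
          ∫ x in Ω, (Real.exp (lam * φ x) * ∑ i, ∑ j, (partialDeriv i (fun y => A y i j) x
            * weakPartial Ω j u x + A x i j * weakPartial Ω i (weakPartial Ω j u) x)) ^ 2 := by
  obtain ⟨φ, hφ, κ, hκ, lam₀, hlam₀, hcar⟩ := carleman_estimate_weak z hb hμ hM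
  refine ⟨φ, hφ, κ, hκ, lam₀, hlam₀, fun A hA hsym hell hAM u mu h0 h1 lam hlam => ?_⟩
  have mind : ∀ v : EuclideanSpace ℝ (Fin d) → ℝ, MemLp v 2 (volume.restrict Ω) →
      MemLp (Ω.indicator v) 2 volume := fun v hv =>
    (memLp_indicator_iff_restrict hΩ.measurableSet).2 hv
  have hz : ∀ v : EuclideanSpace ℝ (Fin d) → ℝ, ∀ x ∉ Ω, Ω.indicator v x = 0 := fun v x hx =>
    indicator_of_notMem hx v
  have conv : ∀ f g : EuclideanSpace ℝ (Fin d) → ℝ, (∀ x ∈ Ω, f x = g x) → (∀ x ∉ Ω, f x = 0) →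
      ∫ x, f x = ∫ x in Ω, g x := by
    intro f g h h'
    rw [← setIntegral_eq_integral_of_forall_compl_eq_zero h']
    exact setIntegral_congr_fun hΩ.measurableSet h
  have ibp : ∀ v : EuclideanSpace ℝ (Fin d) → ℝ, IsTrace Ω v 0 → ∀ i,
      ∀ ψ : EuclideanSpace ℝ (Fin d) → ℝ, ContDiff ℝ 1 ψ →
      ∫ x, (Ω.indicator v x * partialDeriv i ψ x
        + Ω.indicator (weakPartial Ω i v) x * ψ x) = 0 := by
    intro v hv i ψ hψ
    rw [conv _ (fun x => v x * partialDeriv i ψ x + weakPartial Ω i v x * ψ x)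
      (fun x hx => by simp only [indicator_of_mem hx]) (fun x hx => by simp [hx]), hv.2 i ψ hψ]
    simp
  have h := hcar A hA hsym hell hAM (Ω.indicator u) (fun j => Ω.indicator (weakPartial Ω j u))
    (fun i j => Ω.indicator (weakPartial Ω i (weakPartial Ω j u))) (mind _ mu.1)
    (fun j => mind _ (mu.memLp_weakPartial hΩ j))
    (fun i j => mind _ (mu.memLp_weakPartial_weakPartial hΩ i j)) (hz _) (fun _ => hz _)
    (fun _ _ => hz _) (ibp u h0) (fun i j => ibp _ (h1 j) i) lam hlam
  rw [conv _ (fun x => (Real.exp (lam * φ x) * u x) ^ 2)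
      (fun x hx => by simp only [indicator_of_mem hx]) (fun x hx => by simp [hx]),
    conv _ (fun x => (Real.exp (lam * φ x) * ∑ i, ∑ j, (partialDeriv i (fun y => A y i j) x
            * weakPartial Ω j u x + A x i j * weakPartial Ω i (weakPartial Ω j u) x)) ^ 2)
      (fun x hx => by simp only [indicator_of_mem hx]) (fun x hx => by simp [hx]),
    Finset.sum_congr rfl fun j _ => conv _
      (fun x => (Real.exp (lam * φ x) * weakPartial Ω j u x) ^ 2)
      (fun x hx => by simp only [indicator_of_mem hx]) (fun x hx => by simp [hx])] at h
  exact h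

/-- The principal part, with a weight, is controlled by the residual and the lower order terms. -/
theorem weighted_principal_sq_le {K L e : ℝ} {x : EuclideanSpace ℝ (Fin d)}
    {A : EuclideanSpace ℝ (Fin d) → Matrix (Fin d) (Fin d) ℝ}
    {b : EuclideanSpace ℝ (Fin d) → EuclideanSpace ℝ (Fin d)}
    {c : EuclideanSpace ℝ (Fin d) → ℝ} (hbc : ‖b x‖ ≤ K ∧ |c x| ≤ K)
    (S : Matrix (Fin N) (Fin N) ℝ) (hS : ∀ m n, |S m n| ≤ L)
    (U : EuclideanSpace ℝ (Fin d) → Fin N → ℝ) (m : Fin N) :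
    (e * ∑ i, ∑ j, (partialDeriv i (fun y => A y i j) x * weakPartial Ω j (fun y => U y m) x
      + A x i j * weakPartial Ω i (weakPartial Ω j (fun y => U y m)) x)) ^ 2 ≤
      4 * ((e * (expandedOp Ω A b c (fun y => U y m) x - ∑ n, S m n * U x n)) ^ 2
        + d * ∑ i, K ^ 2 * (e * weakPartial Ω i (fun y => U y m) x) ^ 2
        + K ^ 2 * (e * U x m) ^ 2 + N * ∑ n, L ^ 2 * (e * U x n) ^ 2) := by
  have t2 := sum_mul_sq_le (fun i => b x i) (fun i => e * weakPartial Ω i (fun y => U y m) x)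
    (fun i => (PiLp.norm_apply_le (b x) i).trans hbc.1)
  have t3 : (c x * (e * U x m)) ^ 2 ≤ K ^ 2 * (e * U x m) ^ 2 := by
    rw [mul_pow]
    exact mul_le_mul_of_nonneg_right (sq_le_sq_of_abs_le hbc.2) (sq_nonneg _)
  have t4 := sum_mul_sq_le (fun n => S m n) (fun n => e * U x n) (fun n => hS m n)
  have four : ∀ a b c d : ℝ, (a - b - c + d) ^ 2 ≤ 4 * (a ^ 2 + b ^ 2 + c ^ 2 + d ^ 2) := by
    intro a b c d
    nlinarith [sq_nonneg (a + b), sq_nonneg (a + c), sq_nonneg (a - d), sq_nonneg (b - c),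
      sq_nonneg (b + d), sq_nonneg (c + d)]
  have h := four (e * (expandedOp Ω A b c (fun y => U y m) x - ∑ n, S m n * U x n))
    (∑ i, b x i * (e * weakPartial Ω i (fun y => U y m) x)) (c x * (e * U x m))
    (∑ n, S m n * (e * U x n))
  refine le_trans (le_of_eq ?_) (h.trans ?_)
  · congr 1
    have s1 : ∑ i, b x i * (e * weakPartial Ω i (fun y => U y m) x) =
        e * ∑ i, b x i * weakPartial Ω i (fun y => U y m) x := by
      rw [Finset.mul_sum]; exact Finset.sum_congr rfl fun i _ => by ring
    have s2 : ∑ n, S m n * (e * U x n) = e * ∑ n, S m n * U x n := by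
      rw [Finset.mul_sum]; exact Finset.sum_congr rfl fun i _ => by ring
    rw [s1, s2, expandedOp]
    ring
  · linarith

/-- For `lam ≥ 1` and `κ lam ≥ 4p + 4D + 1` the left side dominates `(4p + 4D + 1)(I + Z)`; the
lower-order terms are absorbed and `I + Z` remains. -/
theorem le_of_weighted_estimate {κ lam I Z r p D : ℝ} (hI : 0 ≤ I) (hZ : 0 ≤ Z) (hκ : 0 < κ)
    (hp : 0 ≤ p) (hD : 0 ≤ D) (h1 : 1 ≤ lam) (hlam : (4 * p + 4 * D + 1) / κ ≤ lam)
    (h : κ * lam * (I + lam ^ 2 * Z) ≤ 4 * (r + p * I + D * Z)) : Z ≤ 4 * r := by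
  rw [div_le_iff₀ hκ] at hlam
  have hZ' : Z ≤ lam ^ 2 * Z := le_mul_of_one_le_left hZ (one_le_pow₀ h1)
  have h2 : (4 * p + 4 * D + 1) * (I + Z) ≤ κ * lam * (I + lam ^ 2 * Z) :=
    mul_le_mul (by linarith) (by linarith) (by linarith) (by positivity)
  nlinarith [mul_nonneg hp hZ, mul_nonneg hD hI]

/-- The Carleman estimate is applied to every component with one weight and one `lam`. After
summation over the components, drift, potential and coupling are absorbed. With `lam` now fixed, the
weight is bounded above and below on `Ω` and can be removed. -/
theorem exists_stability_constant (z : Fin d) (hΩ : IsOpen Ω) (hb : Bornology.IsBounded Ω)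
    (hs : HasSmoothBoundary Ω) {μ : ℝ} (hμ : 0 < μ) (M K L : ℝ) :
    ∃ C : ℝ, 0 < C ∧
      ∀ (A : EuclideanSpace ℝ (Fin d) → Matrix (Fin d) (Fin d) ℝ)
        (b : EuclideanSpace ℝ (Fin d) → EuclideanSpace ℝ (Fin d))
        (c : EuclideanSpace ℝ (Fin d) → ℝ),
        IsEllipticCoeff μ A b c → C1NormLE Ω A M →
        (∀ x ∈ closure Ω, ‖b x‖ ≤ K ∧ |c x| ≤ K) →
        ∀ S : Matrix (Fin N) (Fin N) ℝ, (∀ m n, |S m n| ≤ L) →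
        ∀ W ∈ admissible Ω A (0 : EuclideanSpace ℝ (Fin d) → Fin N → ℝ) 0,
          ∑ m, ∫ x in Ω, (W x m) ^ 2 ≤ C * ∑ m, ∫ x in Ω, (systemResidual Ω A b c S W x m) ^ 2 := by
  obtain ⟨φ, hφ, κ, hκ, lam₀, hlam₀, hcar⟩ :=
    carleman_estimate_of_isTrace_zero z hΩ hb hμ (abs_nonneg M)
  obtain ⟨B, hB⟩ := hb.exists_bound_of_continuous hφ
  set p : ℝ := d * K ^ 2 with hp
  -- One factor `N` comes from Cauchy–Schwarz on a row of `S`, the other from summing over the rows.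
  set D : ℝ := K ^ 2 + N * (N * L ^ 2) with hD
  set lam : ℝ := max (max lam₀ 1) ((4 * p + 4 * D + 1) / κ) with hlam
  have lam_ge : lam₀ ≤ lam := (le_max_left _ _).trans (le_max_left _ _)
  have lam_one : 1 ≤ lam := (le_max_right _ _).trans (le_max_left _ _)
  -- On `Ω` the squared weight lies between `E⁻¹` and `E`; it is removed once on each side, hence
  -- the constant `4 E E`.
  set E : ℝ := Real.exp (2 * (lam * B)) with hE
  have hEpos : 0 < E := Real.exp_pos _
  refine ⟨4 * E * E, by positivity, fun A b c hcoef hAM hbc S hS W hW => ?_⟩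
  have hA : ∀ i j, ContDiff ℝ 1 (fun x => A x i j) := fun i j =>
    (hcoef.contDiff_A i j).of_le one_le_two
  have cb := hcoef.contDiff_b.continuous
  have cc := hcoef.contDiff_c.continuous
  have tr : ∀ m, IsTrace Ω (fun x => W x m) 0 := fun m => (hW.2 m).1
  have tr' : ∀ m j, IsTrace Ω (weakPartial Ω j fun x => W x m) 0 := fun m j =>
    IsConormalTrace.isTrace_zero hμ z.pos hΩ hb hs hcoef.elliptic (hW.1 m) (tr m) (hW.2 m).2 j
  have ce : Continuous fun x => Real.exp (lam * φ x) := (continuous_const.mul hφ).rexp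
  have hsym : ∀ x i j, A x i j = A x j i := fun x i j => (hcoef.symm x).apply j i
  have hell : ∀ x, ∀ ξ : Fin d → ℝ, μ * ∑ i, ξ i ^ 2 ≤ ∑ i, (∑ j, A x i j * ξ j) * ξ i := by
    intro x ξ
    have := hcoef.elliptic x (WithLp.toLp 2 ξ)
    simpa [EuclideanSpace.norm_sq_eq, Finset.sum_mul] using this
  have hAM' : C1NormLE Ω A |M| := fun x hx i j =>
    ⟨(hAM x hx i j).1.trans (le_abs_self M), fun k => ((hAM x hx i j).2 k).trans (le_abs_self M)⟩
  have car := fun m => hcar A hA hsym hell hAM' (fun x => W x m) (hW.1 m) (tr m) (tr' m) lam lam_ge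
  set I : Fin N → Fin d → ℝ := fun m j =>
    ∫ x in Ω, (Real.exp (lam * φ x) * weakPartial Ω j (fun y => W y m) x) ^ 2 with hI
  set Z : Fin N → ℝ := fun m => ∫ x in Ω, (Real.exp (lam * φ x) * W x m) ^ 2 with hZ
  set r : Fin N → ℝ := fun m =>
    ∫ x in Ω, (Real.exp (lam * φ x) * systemResidual Ω A b c S W x m) ^ 2 with hr
  have iW : ∀ m, Integrable (fun x => (Real.exp (lam * φ x) * W x m) ^ 2) (volume.restrict Ω) :=
    fun m => (memLp_continuous_mul hb hΩ ce (hW.1 m).1).integrable_sq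
  have iD : ∀ m j, Integrable (fun x => (Real.exp (lam * φ x)
      * weakPartial Ω j (fun y => W y m) x) ^ 2) (volume.restrict Ω) := fun m j =>
    (memLp_continuous_mul hb hΩ ce ((hW.1 m).memLp_weakPartial hΩ j)).integrable_sq
  have iR : ∀ m, Integrable (fun x => (Real.exp (lam * φ x)
      * systemResidual Ω A b c S W x m) ^ 2) (volume.restrict Ω) := fun m =>
    (memLp_continuous_mul hb hΩ ce (memLp_systemResidual hΩ hb hA cb cc S hW m)).integrable_sq
  have step : ∀ m, κ * lam * (∑ j, I m j + lam ^ 2 * Z m) ≤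
      4 * (r m + d * ∑ j, K ^ 2 * I m j + K ^ 2 * Z m + N * ∑ n, L ^ 2 * Z n) := by
    intro m
    refine (car m).trans ?_
    have j2 : Integrable (fun x => (d : ℝ) * ∑ i, K ^ 2 * (Real.exp (lam * φ x)
        * weakPartial Ω i (fun y => W y m) x) ^ 2) (volume.restrict Ω) :=
      (integrable_finsetSum _ fun i _ => (iD m i).const_mul _).const_mul _
    have j3 : Integrable (fun x => K ^ 2 * (Real.exp (lam * φ x) * W x m) ^ 2)
      (volume.restrict Ω) := (iW m).const_mul _
    have j4 : Integrable (fun x => (N : ℝ) * ∑ n, L ^ 2 * (Real.exp (lam * φ x) * W x n) ^ 2)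
      (volume.restrict Ω) := (integrable_finsetSum _ fun i _ => (iW i).const_mul _).const_mul _
    have hint : ∫ x in Ω, 4 * ((Real.exp (lam * φ x) * systemResidual Ω A b c S W x m) ^ 2
        + d * ∑ i, K ^ 2 * (Real.exp (lam * φ x) * weakPartial Ω i (fun y => W y m) x) ^ 2
        + K ^ 2 * (Real.exp (lam * φ x) * W x m) ^ 2
        + N * ∑ n, L ^ 2 * (Real.exp (lam * φ x) * W x n) ^ 2) =
        4 * (r m + d * ∑ j, K ^ 2 * I m j + K ^ 2 * Z m + N * ∑ n, L ^ 2 * Z n) := by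
      rw [integral_const_mul, integral_add (((iR m).fun_add j2).fun_add j3) j4,
        integral_add ((iR m).fun_add j2) j3, integral_add (iR m) j2, integral_const_mul,
        integral_const_mul, integral_const_mul,
        integral_finsetSum _ fun i _ => (iD m i).const_mul (K ^ 2),
        integral_finsetSum _ fun n _ => (iW n).const_mul (L ^ 2)]
      simp only [integral_const_mul, hI, hZ, hr]
    rw [← hint]
    refine integral_mono_of_nonneg (Filter.Eventually.of_forall fun x => sq_nonneg _)
      (((((iR m).fun_add j2).fun_add j3).fun_add j4).const_mul 4) ?_
    filter_upwards [systemResidual_ae_eq (b := b) (c := c) hΩ hA S hW m,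
      ae_restrict_mem hΩ.measurableSet] with x hx hxΩ
    rw [hx]
    exact weighted_principal_sq_le (hbc x (subset_closure hxΩ)) S hS W m
  have hZr : ∑ m, Z m ≤ 4 * ∑ m, r m := by
    refine le_of_weighted_estimate (I := ∑ m, ∑ j, I m j) (lam := lam)
      (Finset.sum_nonneg fun m _ => Finset.sum_nonneg fun j _ =>
        integral_nonneg fun x => sq_nonneg _)
      (Finset.sum_nonneg fun m _ => integral_nonneg fun x => sq_nonneg _) hκ
      (show 0 ≤ p by positivity) (show 0 ≤ D by positivity) lam_one (le_max_right _ _) ?_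
    have h := Finset.sum_le_sum fun m (_ : m ∈ Finset.univ) => step m
    simp only [← Finset.mul_sum, Finset.sum_add_distrib] at h
    refine h.trans (le_of_eq ?_)
    simp only [Finset.sum_const, Finset.card_univ, Fintype.card_fin, nsmul_eq_mul, hp, hD]
    ring
  have exb : ∀ x ∈ Ω, 1 ≤ E * Real.exp (lam * φ x) ^ 2 ∧ Real.exp (lam * φ x) ^ 2 ≤ E := by
    intro x hx
    have hl : 0 ≤ lam := by linarith
    obtain ⟨h1, h2⟩ := abs_le.1 (hB x hx)
    have h3 := mul_le_mul_of_nonneg_left h1 hl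
    have h4 := mul_le_mul_of_nonneg_left h2 hl
    rw [← Real.exp_nat_mul, hE, ← Real.exp_add]
    refine ⟨Real.one_le_exp ?_, Real.exp_le_exp.2 ?_⟩ <;> push_cast <;> linarith
  have lower : ∀ m, ∫ x in Ω, (W x m) ^ 2 ≤ E * Z m := by
    intro m
    rw [hZ, ← integral_const_mul]
    refine setIntegral_mono_on (hW.1 m).1.integrable_sq ((iW m).const_mul _) hΩ.measurableSet
      fun x hx => ?_
    rw [mul_pow, ← mul_assoc]
    exact le_mul_of_one_le_left (sq_nonneg _) (exb x hx).1
  have upper : ∀ m, r m ≤ E * ∫ x in Ω, (systemResidual Ω A b c S W x m) ^ 2 := by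
    intro m
    rw [hr, ← integral_const_mul]
    refine setIntegral_mono_on (iR m)
      ((memLp_systemResidual hΩ hb hA cb cc S hW m).integrable_sq.const_mul _) hΩ.measurableSet
      fun x hx => ?_
    rw [mul_pow]
    exact mul_le_mul_of_nonneg_right (exb x hx).2 (sq_nonneg _)
  calc ∑ m, ∫ x in Ω, (W x m) ^ 2 ≤ ∑ m, E * Z m := Finset.sum_le_sum fun m _ => lower m
    _ = E * ∑ m, Z m := by rw [Finset.mul_sum]
    _ ≤ E * (4 * ∑ m, r m) := mul_le_mul_of_nonneg_left hZr hEpos.le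
    _ ≤ E * (4 * ∑ m, E * ∫ x in Ω, (systemResidual Ω A b c S W x m) ^ 2) := by
      gcongr with m _
      exact upper m
    _ = 4 * E * E * ∑ m, ∫ x in Ω, (systemResidual Ω A b c S W x m) ^ 2 := by
      rw [← Finset.mul_sum]; ring

end Stability

end QuasiReversibility

namespace QuasiReversibility

/-! ### The error of the minimizer. -/

section Convergence

variable {d N : ℕ} {Ω : Set (EuclideanSpace ℝ (Fin d))}

/-! ### The error of the quasi-reversibility method -/

/-- For large `ε` the term `ε e` cannot be bounded by `e`. Instead the penalty bounds `v` itself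
after division by `ε`, and `h ≤ ε h`. -/
theorem le_of_functional_le_of_one_le {C ε a e h v y : ℝ} (hC : 0 ≤ C) (ha : 0 ≤ a) (he : 0 ≤ e)
    (hh : 0 ≤ h) (hε : 1 ≤ ε) (hJ : a + ε * v ≤ C * e + ε * (2 * h + 2 * e))
    (hy : y ≤ 2 * v + 2 * h) : y ≤ (2 * (C + 2) + 6) * (e + ε * h) := by
  have hCe : C * e ≤ ε * (C * e) := le_mul_of_one_le_left (mul_nonneg hC he) hε
  have hv : v ≤ C * e + (2 * h + 2 * e) := by
    refine le_of_mul_le_mul_left ?_ (zero_lt_one.trans_le hε)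
    linarith
  have hεh : h ≤ ε * h := le_mul_of_one_le_left hh hε
  have hCh : 0 ≤ C * (ε * h) := mul_nonneg hC (hh.trans hεh)
  linarith

/-- For small `ε` the term `ε e` is at most `e`, so the residual has the right size; the penalty
term on the left is discarded. -/
theorem residual_le_of_functional_le_of_le_one {C ε a e h v : ℝ} (hC : 0 ≤ C) (he : 0 ≤ e)
    (hh : 0 ≤ h) (hv : 0 ≤ v) (hε : 0 ≤ ε) (hε1 : ε ≤ 1)
    (hJ : a + ε * v ≤ C * e + ε * (2 * h + 2 * e)) :
    2 * a + 2 * (C * e) ≤ (4 * C + 4) * (e + ε * h) := by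
  have hεe : ε * e ≤ e := mul_le_of_le_one_left he hε1
  have hCh : 0 ≤ C * (ε * h) := mul_nonneg hC (mul_nonneg hε hh)
  have hεv : 0 ≤ ε * v := mul_nonneg hε hv
  linarith

-- The comparison function is the exact solution plus the extension of the noise. For `ε ≤ 1`
-- stability is applied to the minimizer minus this function, whose Cauchy data vanish; for `ε ≥ 1`
-- the `H³` penalty alone suffices.
set_option maxHeartbeats 1000000 in
theorem exists_quasiReversibility_error_constant (z : Fin d) (hΩ : IsOpen Ω)
    (hb : Bornology.IsBounded Ω) (hs : HasSmoothBoundary Ω) {μ : ℝ} (hμ : 0 < μ) (M K L : ℝ) :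
    ∃ Q : ℝ, 0 ≤ Q ∧
      ∀ (A : EuclideanSpace ℝ (Fin d) → Matrix (Fin d) (Fin d) ℝ)
        (b : EuclideanSpace ℝ (Fin d) → EuclideanSpace ℝ (Fin d))
        (c : EuclideanSpace ℝ (Fin d) → ℝ),
        IsEllipticCoeff μ A b c → C1NormLE Ω A M →
        (∀ x ∈ closure Ω, ‖b x‖ ≤ K ∧ |c x| ≤ K) →
        ∀ S : Matrix (Fin N) (Fin N) ℝ, (∀ m n, |S m n| ≤ L) →
        ∀ (F G F' G' U V E : EuclideanSpace ℝ (Fin d) → Fin N → ℝ) (ε : ℝ), 0 < ε →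
          U ∈ admissible Ω A F G →
          (∀ᵐ x ∂(volume.restrict Ω), ∀ m, systemResidual Ω A b c S U x m = 0) →
          V ∈ admissible Ω A F' G' →
          IsMinOn (functionalJ Ω A b c S ε) (admissible Ω A F' G') V →
          E ∈ admissible Ω A (F' - F) (G' - G) →
          ∑ m, ∫ x in Ω, (V x m - U x m) ^ 2 ≤ Q * (h3NormSq Ω E + ε * h3NormSq Ω U) := by
  obtain ⟨C₂, hC₂, hstab⟩ := exists_stability_constant (N := N) z hΩ hb hs hμ M K L
  set C₁ : ℝ := N * (4 * (d * (d * ((2 * d) * (d * M ^ 2))) + d * (d * ((2 * d) * (d * M ^ 2)))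
        + d * (d * K ^ 2) + K ^ 2 + N * (N * L ^ 2)))
  have hC₁0 : 0 ≤ C₁ := by positivity
  -- The first summand is the constant for `ε ≥ 1`, the other two together the constant for `ε ≤ 1`.
  refine ⟨N * (2 * (C₁ + 2) + 6) + 2 * C₂ * (4 * C₁ + 4) + 2 * N, by positivity, ?_⟩
  intro A b c hcoef hAM hbc S hS F G F' G' U V E ε hε hU hU0 hV hmin hE
  have hA : ∀ i j, ContDiff ℝ 1 (fun x => A x i j) := fun i j =>
    (hcoef.contDiff_A i j).of_le one_le_two
  have cb := hcoef.contDiff_b.continuous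
  have cc := hcoef.contDiff_c.continuous
  set e := h3NormSq Ω E with he
  set h := h3NormSq Ω U with hh
  have he0 : 0 ≤ e := h3NormSq_nonneg E
  have hh0 : 0 ≤ h := h3NormSq_nonneg U
  -- the comparison function
  set X : EuclideanSpace ℝ (Fin d) → Fin N → ℝ := fun x m => U x m + 1 * E x m with hX
  have hXa : X ∈ admissible Ω A F' G' := by
    have := admissible_add_mul z.pos hΩ hb hs hU hE 1
    simpa [hX] using this
  have resX : ∀ m, (fun x => systemResidual Ω A b c S X x m) =ᵐ[volume.restrict Ω]
      fun x => systemResidual Ω A b c S E x m := by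
    intro m
    filter_upwards [systemResidual_add_mul (b := b) (c := c) z.pos hΩ hb hs hA S hU hE 1 m, hU0]
      with x hx hx0
    rw [hx, hx0 m]; ring
  have sq : ∀ {F G Y : EuclideanSpace ℝ (Fin d) → Fin N → ℝ}, Y ∈ admissible Ω A F G → ∀ m,
      Integrable (fun x => (systemResidual Ω A b c S Y x m) ^ 2) (volume.restrict Ω) :=
    fun hY m => (memLp_systemResidual hΩ hb hA cb cc S hY m).integrable_sq
  have sumI : ∀ {F G Y : EuclideanSpace ℝ (Fin d) → Fin N → ℝ}, Y ∈ admissible Ω A F G →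
      ∫ x in Ω, ∑ m, (systemResidual Ω A b c S Y x m) ^ 2 =
        ∑ m, ∫ x in Ω, (systemResidual Ω A b c S Y x m) ^ 2 :=
    fun hY => integral_finsetSum _ fun m _ => sq hY m
  have resE : ∑ m, ∫ x in Ω, (systemResidual Ω A b c S E x m) ^ 2 ≤ C₁ * e := by
    rw [← sumI hE]
    exact integral_systemResidual_sq_le hΩ hb hA cb cc hAM hbc S hS hE
  clear_value C₁
  have eqX : ∑ m, ∫ x in Ω, (systemResidual Ω A b c S X x m) ^ 2 =
      ∑ m, ∫ x in Ω, (systemResidual Ω A b c S E x m) ^ 2 := by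
    refine Finset.sum_congr rfl fun m _ => integral_congr_ae ?_
    filter_upwards [resX m] with x hx
    rw [hx]
  have hXn : h3NormSq Ω X ≤ 2 * h + 2 * e := by
    have := h3NormSq_add_mul_le hΩ hU.1 hE.1 1
    rwa [one_pow, mul_one] at this
  set a := ∑ m, ∫ x in Ω, (systemResidual Ω A b c S V x m) ^ 2 with ha
  have ha0 : 0 ≤ a := Finset.sum_nonneg fun m _ => integral_nonneg fun x => sq_nonneg _
  have hJ : a + ε * h3NormSq Ω V ≤ C₁ * e + ε * (2 * h + 2 * e) := by
    have hJ := isMinOn_iff.1 hmin X hXa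
    rw [functionalJ, functionalJ, sumI hV, sumI hXa, eqX] at hJ
    exact hJ.trans (add_le_add resE (mul_le_mul_of_nonneg_left hXn hε.le))
  have hVn : 0 ≤ h3NormSq Ω V := h3NormSq_nonneg V
  -- The term `ε ‖E‖²` in the bound for the functional separates the two regimes.
  rcases le_total 1 ε with h1 | h1
  · have hD := h3NormSq_add_mul_le hΩ hV.1 hU.1 (-1)
    have hsub := fun m => MemSobolev.integral_sq_le_h3NormSq hΩ
      (admissible_add_mul z.pos hΩ hb hs hV hU (-1)).1 m
    have hone : ∀ m, ∫ x in Ω, (V x m - U x m) ^ 2 ≤ (2 * (C₁ + 2) + 6) * (e + ε * h) := by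
      intro m
      refine le_of_functional_le_of_one_le hC₁0 ha0 he0 hh0 h1 hJ ?_
      have := (hsub m).trans hD
      simpa only [neg_mul, one_mul, ← sub_eq_add_neg, even_two.neg_pow, one_pow, mul_one] using this
    calc ∑ m, ∫ x in Ω, (V x m - U x m) ^ 2
        ≤ ∑ _m : Fin N, (2 * (C₁ + 2) + 6) * (e + ε * h) := Finset.sum_le_sum fun m _ => hone m
      _ = N * (2 * (C₁ + 2) + 6) * (e + ε * h) := by simp; ring
      _ ≤ _ := by
        refine mul_le_mul_of_nonneg_right ?_ (by positivity)
        have : 0 ≤ 2 * C₂ * (4 * C₁ + 4) + 2 * N := by positivity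
        linarith
  · set W : EuclideanSpace ℝ (Fin d) → Fin N → ℝ := fun x m => V x m + (-1) * X x m with hW
    have hWa : W ∈ admissible Ω A (0 : EuclideanSpace ℝ (Fin d) → Fin N → ℝ) 0 := by
      have := admissible_add_mul z.pos hΩ hb hs hV hXa (-1)
      simp only [neg_mul, one_mul, add_neg_cancel] at this
      simp only [hW, neg_mul, one_mul]
      exact this
    have resW : ∑ m, ∫ x in Ω, (systemResidual Ω A b c S W x m) ^ 2 ≤ 2 * a + 2 * (C₁ * e) := by
      refine le_trans ?_ (add_le_add_right (mul_le_mul_of_nonneg_left resE (by norm_num)) _)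
      rw [ha, Finset.mul_sum, Finset.mul_sum, ← Finset.sum_add_distrib]
      refine Finset.sum_le_sum fun m _ => ?_
      rw [← integral_const_mul, ← integral_const_mul,
        ← integral_add ((sq hV m).const_mul 2) ((sq hE m).const_mul 2)]
      refine integral_mono_ae (sq hWa m) (((sq hV m).const_mul 2).add ((sq hE m).const_mul 2)) ?_
      filter_upwards [systemResidual_add_mul (b := b) (c := c) z.pos hΩ hb hs hA S hV hXa (-1) m,
        resX m] with x hx hxX
      rw [hx, hxX]
      nlinarith [sq_nonneg (systemResidual Ω A b c S V x m + systemResidual Ω A b c S E x m)]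
    have hWle := hstab A b c hcoef hAM hbc S hS W hWa
    have hEle : ∑ m, ∫ x in Ω, (E x m) ^ 2 ≤ N * e := by
      refine (Finset.sum_le_sum fun m _ => MemSobolev.integral_sq_le_h3NormSq hΩ hE.1 m).trans ?_
      simp [he]
    have hsplit : ∑ m, ∫ x in Ω, (V x m - U x m) ^ 2 ≤
        (2 * ∑ m, ∫ x in Ω, (W x m) ^ 2) + 2 * ∑ m, ∫ x in Ω, (E x m) ^ 2 := by
      rw [Finset.mul_sum, Finset.mul_sum, ← Finset.sum_add_distrib]
      refine Finset.sum_le_sum fun m _ => ?_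
      have iW : Integrable (fun x => (W x m) ^ 2) (volume.restrict Ω) := (hWa.1 m).1.integrable_sq
      have iE : Integrable (fun x => (E x m) ^ 2) (volume.restrict Ω) := (hE.1 m).1.integrable_sq
      rw [← integral_const_mul, ← integral_const_mul,
        ← integral_add (iW.const_mul 2) (iE.const_mul 2)]
      refine integral_mono ((hV.1 m).1.sub (hU.1 m).1).integrable_sq
        ((iW.const_mul 2).add (iE.const_mul 2)) fun x => ?_
      have : V x m - U x m = W x m + E x m := by simp only [hW, hX]; ring
      simp only
      rw [this]
      nlinarith [sq_nonneg (W x m - E x m)]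
    have hεh : 0 ≤ ε * h := mul_nonneg hε.le hh0
    have hR := residual_le_of_functional_le_of_le_one hC₁0 he0 hh0 hVn hε.le h1 hJ
    have hT := mul_le_mul_of_nonneg_left (resW.trans hR) hC₂.le
    have hNe : N * e ≤ N * (e + ε * h) :=
      mul_le_mul_of_nonneg_left (le_add_of_nonneg_right hεh) (Nat.cast_nonneg N)
    have hP : 0 ≤ N * (2 * (C₁ + 2) + 6) * (e + ε * h) := by positivity
    calc ∑ m, ∫ x in Ω, (V x m - U x m) ^ 2
        ≤ 2 * (C₂ * ((4 * C₁ + 4) * (e + ε * h))) + 2 * (N * (e + ε * h)) := by linarith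
      _ ≤ _ := by linarith

/-- Pointwise linear combinations of the components are controlled in `L²`. -/
theorem eLpNorm_sum_mul_le {α : Type*} [MeasurableSpace α] {ν : Measure α} {V : α → Fin N → ℝ}
    (hV : ∀ m, MemLp (fun x => V x m) 2 ν) (p : Fin N → ℝ) :
    eLpNorm (fun x => ∑ n, V x n * p n) 2 ν ≤
      ENNReal.ofReal (Real.sqrt ((∑ n, p n ^ 2) * ∑ n, ∫ x, (V x n) ^ 2 ∂ν)) := by
  have mf : MemLp (fun x => ∑ n, V x n * p n) 2 ν :=
    memLp_finsetSum _ fun n _ => by simpa only [mul_comm] using (hV n).const_mul (p n)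
  rw [mf.eLpNorm_eq_integral_rpow_norm (by norm_num) (by norm_num)]
  refine ENNReal.ofReal_le_ofReal ?_
  simp only [ENNReal.toReal_ofNat, Real.rpow_ofNat, Real.norm_eq_abs, sq_abs]
  rw [← one_div, ← Real.sqrt_eq_rpow]
  refine Real.sqrt_le_sqrt ?_
  rw [← integral_finsetSum _ fun n _ => (hV n).integrable_sq, ← integral_const_mul]
  refine integral_mono mf.integrable_sq
    ((integrable_finsetSum _ fun n _ => (hV n).integrable_sq).const_mul _) fun x => ?_
  have := Finset.sum_mul_sq_le_sq_mul_sq Finset.univ (fun n => V x n) p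
  simp only
  linarith

end Convergence

end QuasiReversibility
-- The convergence rate.
theorem mainTheorem4 {d : ℕ} (hd : 2 ≤ d) (Ω : Set (EuclideanSpace ℝ (Fin d)))
    (hΩ_open : IsOpen Ω) (hΩ_bdd : Bornology.IsBounded Ω) (hΩ_smooth : HasSmoothBoundary Ω)
    (N : ℕ) (hN : 0 < N) (T : ℝ) (hT : 0 < T) (μ : ℝ) (hμ : 0 < μ) (M K : ℝ) :
    ∃ C : ℝ, 0 < C ∧
      ∀ (A : EuclideanSpace ℝ (Fin d) → Matrix (Fin d) (Fin d) ℝ)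
        (b : EuclideanSpace ℝ (Fin d) → EuclideanSpace ℝ (Fin d))
        (c : EuclideanSpace ℝ (Fin d) → ℝ),
        IsEllipticCoeff μ A b c → C1NormLE Ω A M →
        (∀ x ∈ closure Ω, ‖b x‖ ≤ K ∧ |c x| ≤ K) →
        ∀ (Fstar Gstar Fδ Gδ Ustar Uδ err : EuclideanSpace ℝ (Fin d) → Fin N → ℝ) (ε δ : ℝ),
          0 < ε →
          -- the true solution, for the noiseless data
          Ustar ∈ admissible Ω A Fstar Gstar →
          (∀ᵐ x ∂(volume.restrict Ω), ∀ m, systemResidual Ω A b c (matS T N) Ustar x m = 0) →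
          -- the regularized solution, for the noisy data
          Uδ ∈ admissible Ω A Fδ Gδ →
          IsMinOn (functionalJ Ω A b c (matS T N) ε) (admissible Ω A Fδ Gδ) Uδ →
          -- the noise level
          err ∈ admissible Ω A (Fδ - Fstar) (Gδ - Gstar) →
          h3Norm Ω err < δ →
          eLpNorm (initialValue T Uδ - initialValue T Ustar) 2 (volume.restrict Ω) ≤
            ENNReal.ofReal (C * (δ + Real.sqrt ε * h3Norm Ω Ustar)) := by
  -- The direction of the Carleman weight; any coordinate would do.
  have z : Fin d := ⟨0, by omega⟩
  -- The sum of all `|s_mn|` serves as a bound for each entry of `S`; it depends only on `T` and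
  -- `N`.
  obtain ⟨Q, hQ, herr⟩ := exists_quasiReversibility_error_constant (N := N) z hΩ_open hΩ_bdd
    hΩ_smooth hμ M K (∑ m, ∑ n, |matS T N m n|)
  set P : ℝ := ∑ n : Fin N, Psi T n 0 ^ 2 with hP
  have hP0 : 0 ≤ P := Finset.sum_nonneg fun n _ => sq_nonneg _
  -- Cauchy–Schwarz over the components gives `P`, the error estimate gives `Q`; the `1` ensures
  -- positivity.
  refine ⟨Real.sqrt (P * Q) + 1, by positivity, ?_⟩
  intro A b c hcoef hAM hbc Fstar Gstar Fδ Gδ Ustar Uδ err ε δ hε hU hU0 hV hmin hE hδ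
  have hS : ∀ m n, |matS T N m n| ≤ ∑ m, ∑ n, |matS T N m n| := fun m n =>
    (Finset.single_le_sum (f := fun n => |matS T N m n|) (fun n _ => abs_nonneg _)
      (Finset.mem_univ n)).trans
    (Finset.single_le_sum (f := fun m => ∑ n, |matS T N m n|)
      (fun m _ => Finset.sum_nonneg fun n _ => abs_nonneg _) (Finset.mem_univ m))
  have hsq := herr A b c hcoef hAM hbc (matS T N) hS Fstar Gstar Fδ Gδ Ustar Uδ err ε hε hU hU0 hV
    hmin hE
  have hδ0 : 0 ≤ δ := (Real.sqrt_nonneg _).trans hδ.le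
  have heδ : h3NormSq Ω err ≤ δ ^ 2 := (Real.sqrt_le_left hδ0).1 hδ.le
  have hn : Real.sqrt ε * h3Norm Ω Ustar = Real.sqrt (ε * h3NormSq Ω Ustar) :=
    (Real.sqrt_mul hε.le _).symm
  have hnn : 0 ≤ Real.sqrt ε * h3Norm Ω Ustar := by rw [hn]; exact Real.sqrt_nonneg _
  have hnsq : (Real.sqrt ε * h3Norm Ω Ustar) ^ 2 = ε * h3NormSq Ω Ustar := by
    rw [hn, Real.sq_sqrt (mul_nonneg hε.le (h3NormSq_nonneg _))]
  have hdiff : initialValue T Uδ - initialValue T Ustar =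
      fun x => ∑ n : Fin N, (Uδ x n - Ustar x n) * Psi T n 0 := by
    ext x
    simp only [Pi.sub_apply, initialValue, sub_mul, Finset.sum_sub_distrib]
  rw [hdiff]
  refine (eLpNorm_sum_mul_le (V := fun x n => Uδ x n - Ustar x n)
    (fun m => (hV.1 m).1.sub (hU.1 m).1) fun n => Psi T n 0).trans (ENNReal.ofReal_le_ofReal ?_)
  -- Uses `δ² + y² ≤ (δ + y)²` for nonnegative `δ` and `y`, with `y² = ε ‖U*‖²`.
  have hle : P * ∑ n, ∫ x in Ω, (Uδ x n - Ustar x n) ^ 2 ≤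
      P * Q * (δ + Real.sqrt ε * h3Norm Ω Ustar) ^ 2 := by
    rw [mul_assoc]
    refine mul_le_mul_of_nonneg_left (hsq.trans (mul_le_mul_of_nonneg_left ?_ hQ)) hP0
    nlinarith [mul_nonneg hδ0 hnn]
  refine (Real.sqrt_le_sqrt hle).trans ?_
  rw [Real.sqrt_mul (mul_nonneg hP0 hQ), Real.sqrt_sq (add_nonneg hδ0 hnn)]
  exact mul_le_mul_of_nonneg_right (by linarith) (add_nonneg hδ0 hnn)
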